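/- **Theorem.** Work over $\mathbb C$, with homogeneous coordinates $(x_1:x_2:x_3)\times(y_1:y_2:y_3)$ on $\mathbb P^2\times\mathbb P^2$. Let $u_1=(1:0:0)$, $u_2=(0:1:0)$, $u_3=(0:0:1)$, $u_4=(1:1:1)$, let $O_4=\{(u_i,u_i)\}_{1\le i\le 4}\subset\mathbb P^2\times\mathbb P^2$, and let $\mathcal I$ be the ideal sheaf of $O_4$. Let $V^{ram}\subset\mathbb P^2\times\mathbb P^2$ be the threefold of bidegree $(2,2)$ $$(x_1-x_2)x_3\,y_1(y_2-y_3)\;-\;x_1(x_2-x_3)\,(y_1-y_2)y_3=0 .$$ (a) $V^{ram}$ has exactly $19$ singular points, and all of them are ordinary double points. (b) $V^{ram}$ is attached to a Morin configuration of $20$ planes in $\mathbb P^5=\mathbb P(W)$. Precisely: there are a Lagrangian subspace $A\subset\wedge^3W$ (for the wedge pairing $\wedge^3W\times\wedge^3W\to\wedge^6W$) and a plane $P_u=\mathbb P(U)$, with $A\subset U\wedge W\wedge W$ and $A\cap(U\wedge U\wedge W)=\wedge^3U$, such that the set $F$ of the planes whose Plücker point lies in $\mathbb P(A)$ has exactly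 $20$ elements, $P_u\in F$, $\mathbb P(A)$ is the linear span of $F$, and $F$ is a complete reduced scheme of incident planes: $F=\bigcap_{Q\in F}\{P: P\cap Q\neq\emptyset\}$ as schemes. Moreover, for suitable coordinates on $P_u$ and on the net $P_u^\perp=\mathbb P(\wedge^2(W/U))$ of hyperplanes through $P_u$, $V^{ram}$ is the threefold $V_A\subset P_u\times P_u^\perp$ defined by the form of bidegree $(2,2)$ whose value at $(x,\,v\wedge w \bmod U)$ is $x\wedge v\wedge w\wedge a\in\wedge^6W\cong\mathbb C$, for any $a\in A$ with $a\equiv x\wedge v\wedge w$ modulo $U\wedge U\wedge W$. (c) $\dim H^0(\mathcal I(1,1))=5$, and the rational map $\phi:\mathbb P^2\times\mathbb P^2\dashrightarrow\mathbb P^4$ defined by $|\mathcal I(1,1)|$ has degree $2$, that is, its fibre over a general point of $\mathbb P^4$ consists of exactly two points. (d) $V^{ram}$ is the ramification divisor of $\phi$, that is, the divisor of the Jacobian determinant of $\phi$, with multiplicities (defined outside the base locus of $\phi$). (e) The image $\phi(V^{ram})$ (the Zariski closure of the image of the points of $V^{ram}$ at which $\phi$ is defined) is the Igusa quartic: it is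 an irreducible quartic hypersurface of $\mathbb P^4$, and it is the dual variety of a Segre cubic, that is, of a cubic threefold in $\mathbb P^4$ whose singular locus consists of ten ordinary double points. -/

import Mathlib

open MvPolynomial
open scoped LinearAlgebra.Projectivization

noncomputable section

/-! ## Forms on `ℙ² × ℙ²` -/

/-- Bihomogeneous coordinates on `ℙ² × ℙ²`: the `x`-coordinates are `X (Sum.inl i)`,
the `y`-coordinates are `X (Sum.inr j)`. -/
abbrev BiPoly := MvPolynomial (Fin 3 ⊕ Fin 3) ℂ

abbrev P2 := ℙ ℂ (Fin 3 → ℂ)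

abbrev P4 := ℙ ℂ (Fin 5 → ℂ)

/-- The space of forms of bidegree `(a, b)`. -/
def biForms (a b : ℕ) : Submodule ℂ BiPoly :=
  weightedHomogeneousSubmodule ℂ
    (Sum.elim (fun _ => ((1, 0) : ℕ × ℕ)) (fun _ => ((0, 1) : ℕ × ℕ))) (a, b)

/-- Chosen homogeneous coordinates of a point of `ℙ² × ℙ²`. -/
def coords (p : P2 × P2) : Fin 3 ⊕ Fin 3 → ℂ := Sum.elim p.1.rep p.2.rep

/-- Four points of `ℙ²` in general position: the coordinate points and `(1 : 1 : 1)`. -/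
def fourPts : Fin 4 → Fin 3 → ℂ := ![![1, 0, 0], ![0, 1, 0], ![0, 0, 1], ![1, 1, 1]]

/-- `H⁰(𝓘(1,1))`: the forms of bidegree `(1, 1)` vanishing at the set `O₄` of the four points
`(uᵢ, uᵢ)` of `ℙ² × ℙ²`. -/
def formsThroughO4 : Submodule ℂ BiPoly :=
  biForms 1 1 ⊓ ⨅ k : Fin 4,
    LinearMap.ker (aeval (R := ℂ) (Sum.elim (fourPts k) (fourPts k))).toLinearMap

/-- The equation of `V^ram`:
`(x₁ - x₂) x₃ y₁ (y₂ - y₃) - x₁ (x₂ - x₃) (y₁ - y₂) y₃`. -/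
def vRam : BiPoly :=
  let x : Fin 3 → BiPoly := fun i => X (Sum.inl i)
  let y : Fin 3 → BiPoly := fun j => X (Sum.inr j)
  (x 0 - x 1) * x 2 * (y 0 * (y 1 - y 2)) - x 0 * (x 1 - x 2) * ((y 0 - y 1) * y 2)

/-! ## Singular points and nodes -/

/-- The Hessian matrix of a polynomial at a vector. -/
def hessianAt {σ : Type} (f : MvPolynomial σ ℂ) (v : σ → ℂ) : Matrix σ σ ℂ :=
  Matrix.of fun i j => eval v (pderiv i (pderiv j f))

/-- The singular points of the hypersurface of `ℙ² × ℙ²` defined by a bihomogeneous form of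
positive bidegree. -/
def biSing (f : BiPoly) : Set (P2 × P2) := {p | ∀ s, eval (coords p) (pderiv s f) = 0}

/-- A singular point `(x, y)` is an ordinary double point: the Hessian, whose kernel always contains
the two vectors `(x, 0)` and `(0, y)`, is nondegenerate on the 4-dimensional quotient
by them, which is the tangent space of `ℙ² × ℙ²`. -/
def IsBiNode (f : BiPoly) (p : P2 × P2) : Prop :=
  p ∈ biSing f ∧ (hessianAt f (coords p)).rank = 4

/-- The singular points of the hypersurface of `ℙ⁴` defined by a form of positive degree. -/
def singPts (g : MvPolynomial (Fin 5) ℂ) : Set P4 := {p | ∀ i, eval p.rep (pderiv i g) = 0}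

/-- Ordinary double points of a hypersurface of degree at least two of `ℙ⁴`: the Hessian at a
singular point `v` always has `v` in its kernel, and it is nondegenerate on the quotient by it. -/
def IsNode (g : MvPolynomial (Fin 5) ℂ) (p : P4) : Prop :=
  p ∈ singPts g ∧ (hessianAt g p.rep).rank = 4

/-! ## The rational map `φ` -/

/-- Values of five forms at a point of `ℙ² × ℙ²`. -/
def phiVec (b : Fin 5 → BiPoly) (p : P2 × P2) : Fin 5 → ℂ := fun k => eval (coords p) (b k)

/-- The graph of the rational map `ℙ² × ℙ² ⇢ ℙ⁴` given by five forms of the same bidegree: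
`p` is not a base point and it is mapped to `q`. -/
def PhiMaps (b : Fin 5 → BiPoly) (p : P2 × P2) (q : P4) : Prop :=
  ∃ h : phiVec b p ≠ 0, Projectivization.mk ℂ (phiVec b p) h = q

/-- The rational map is dominant of degree two: over a nonempty Zariski open set of `ℙ⁴`, every
fibre consists of exactly two points. -/
def HasDegreeTwo (b : Fin 5 → BiPoly) : Prop :=
  ∃ (n : ℕ) (h : MvPolynomial (Fin 5) ℂ), h.IsHomogeneous n ∧ h ≠ 0 ∧
    ∀ q : P4, eval q.rep h ≠ 0 → {p | PhiMaps b p q}.ncard = 2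

/-- Dehomogenization on the affine chart `xᵢ = 1`, `yⱼ = 1` of `ℙ² × ℙ²`, a copy of `𝔸⁴`. -/
def dehom (i j : Fin 3) : BiPoly →ₐ[ℂ] MvPolynomial (Fin 2 ⊕ Fin 2) ℂ :=
  aeval (Sum.elim
    (i.insertNth (α := fun _ => MvPolynomial (Fin 2 ⊕ Fin 2) ℂ) 1 (fun m => X (Sum.inl m)))
    (j.insertNth (α := fun _ => MvPolynomial (Fin 2 ⊕ Fin 2) ℂ) 1 (fun m => X (Sum.inr m))))

/-- Let `β` be the dehomogenized forms on the chart `xᵢ = 1`, `yⱼ = 1`. On the part `β k ≠ 0` of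
the chart the map is given by the four functions `β l / β k`, `l ≠ k`, of the four coordinates.
Up to the unit `(β k) ^ 8` its Jacobian determinant is this polynomial, by the quotient rule. -/
def jacobianNumerator (b : Fin 5 → BiPoly) (i j : Fin 3) (k : Fin 5) :
    MvPolynomial (Fin 2 ⊕ Fin 2) ℂ :=
  (Matrix.of fun m l : Fin 2 ⊕ Fin 2 =>
    pderiv m (dehom i j (b (k.succAbove (finSumFinEquiv l)))) * dehom i j (b k) -
      dehom i j (b (k.succAbove (finSumFinEquiv l))) * pderiv m (dehom i j (b k))).det

/-- The ramification divisor of the rational map is the divisor of the bihomogeneous form `f`,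
with multiplicities: on each of the affine open sets `xᵢ ≠ 0, yⱼ ≠ 0, bₖ ≠ 0`, which cover the
complement of the base locus, the Jacobian determinant equals the local equation of
`f` up to a unit of the coordinate ring. -/
def IsRamificationDivisor (b : Fin 5 → BiPoly) (f : BiPoly) : Prop :=
  f ≠ 0 ∧ ∀ (i j : Fin 3) (k : Fin 5),
    Associated
      (algebraMap _ (Localization.Away (dehom i j (b k))) (jacobianNumerator b i j k))
      (algebraMap _ (Localization.Away (dehom i j (b k))) (dehom i j f))

/-! ## Closures, hypersurfaces and duals in `ℙ⁴` -/

/-- The Zariski closure of a subset of `ℙ⁴`. -/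
def zariskiClosure (S : Set P4) : Set P4 :=
  {q | ∀ (n : ℕ) (F : MvPolynomial (Fin 5) ℂ), F.IsHomogeneous n →
    (∀ p ∈ S, eval p.rep F = 0) → eval q.rep F = 0}

/-- The image under the rational map of the hypersurface `f = 0` of `ℙ² × ℙ²`, that is, the Zariski
closure of the image of its points that are not base points. -/
def imageOfHypersurface (b : Fin 5 → BiPoly) (f : BiPoly) : Set P4 :=
  zariskiClosure {q | ∃ p, eval (coords p) f = 0 ∧ PhiMaps b p q}

/-- The gradient of `g` at a vector. -/
def gradAt (g : MvPolynomial (Fin 5) ℂ) (v : Fin 5 → ℂ) : Fin 5 → ℂ := fun i => eval v (pderiv i g)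

/-- The dual variety of the hypersurface `g = 0` of `ℙ⁴`: the Zariski closure of the set of its
tangent hyperplanes at smooth points, a hyperplane `∑ aᵢ zᵢ = 0` being the point `[a]` of the dual
space. -/
def dualVariety (g : MvPolynomial (Fin 5) ℂ) : Set P4 :=
  zariskiClosure {q | ∃ p : P4, eval p.rep g = 0 ∧
    ∃ h : gradAt g p.rep ≠ 0, Projectivization.mk ℂ (gradAt g p.rep) h = q}

/-- A Segre cubic (Segre primal): a cubic hypersurface of `ℙ⁴` whose singular locus consists of ten
ordinary double points. -/
def IsSegrePrimal (g : MvPolynomial (Fin 5) ℂ) : Prop :=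
  g.IsHomogeneous 3 ∧ (singPts g).ncard = 10 ∧ ∀ p ∈ singPts g, IsNode g p

/-- A set of points of `ℙ⁴` is an Igusa quartic: it is an irreducible quartic hypersurface and it
is the dual of a Segre cubic. -/
def IsIgusaQuartic (S : Set P4) : Prop :=
  (∃ h : MvPolynomial (Fin 5) ℂ, h.IsHomogeneous 4 ∧ Irreducible h ∧
    S = {q | eval q.rep h = 0}) ∧
  ∃ g : MvPolynomial (Fin 5) ℂ, IsSegrePrimal g ∧ S = dualVariety g

/-! ## Morin configurations of planes in `ℙ⁵ = ℙ(W)` and their `V`-threefolds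

Planes of `ℙ⁵` are 3-dimensional subspaces of `W = ℂ⁶`, and `⋀³ W` lies in the exterior algebra. -/

abbrev W6 := Fin 6 → ℂ

/-- `p ∧ q ∧ r`. -/
def wedge3 (p q r : W6) : ExteriorAlgebra ℂ W6 :=
  ExteriorAlgebra.ι ℂ p * ExteriorAlgebra.ι ℂ q * ExteriorAlgebra.ι ℂ r

/-- A fixed plane `P_u = ℙ(U)`, with `U` spanned by the first three basis vectors. -/
def planeU : Submodule ℂ W6 := Submodule.span ℂ {Pi.single 0 1, Pi.single 1 1, Pi.single 2 1}

/-- `U ∧ W ∧ W`. -/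
def filt1 : Submodule ℂ (ExteriorAlgebra ℂ W6) :=
  Submodule.span ℂ {e | ∃ p ∈ planeU, ∃ q r, e = wedge3 p q r}

/-- `U ∧ U ∧ W`. -/
def filt2 : Submodule ℂ (ExteriorAlgebra ℂ W6) :=
  Submodule.span ℂ {e | ∃ p ∈ planeU, ∃ q ∈ planeU, ∃ r, e = wedge3 p q r}

/-- `U ∧ U ∧ U`. -/
def filt3 : Submodule ℂ (ExteriorAlgebra ℂ W6) :=
  Submodule.span ℂ {e | ∃ p ∈ planeU, ∃ q ∈ planeU, ∃ r ∈ planeU, e = wedge3 p q r}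

/-- `A` is a Lagrangian subspace of `⋀³ W` for the wedge pairing `⋀³ W × ⋀³ W → ⋀⁶ W`. -/
def IsLagrangian (A : Submodule ℂ (ExteriorAlgebra ℂ W6)) : Prop :=
  A ≤ ⋀[ℂ]^3 W6 ∧ Module.finrank ℂ A = 10 ∧ ∀ a ∈ A, ∀ b ∈ A, a * b = 0

/-- The planes whose Plücker point lies in `ℙ(A)`. -/
def planesIn (A : Submodule ℂ (ExteriorAlgebra ℂ W6)) : Set (Submodule ℂ W6) :=
  {P | Module.finrank ℂ P = 3 ∧ ∀ p ∈ P, ∀ q ∈ P, ∀ r ∈ P, wedge3 p q r ∈ A}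

/-- A finite reduced Morin configuration of planes: as a scheme, `F` is the
intersection of the Schubert divisors `σ_Q` (the planes that meet `Q`), `Q ∈ F`.
The second clause is the equality of points. The third one says that this intersection has zero
tangent space at each `P ∈ F`: tangent vectors of the Grassmannian at `P` are linear maps
`P → W / P`, here lifted to maps `τ` to `W`, and such a vector is tangent to `σ_Q` when the
derivative of the Plücker equation `(p₁ ∧ p₂ ∧ p₃) ∧ (q₁ ∧ q₂ ∧ q₃) = 0` vanishes along it. -/
def IsFiniteMorinConfiguration (F : Set (Submodule ℂ W6)) : Prop :=
  F.Finite ∧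
  (∀ P : Submodule ℂ W6, P ∈ F ↔ Module.finrank ℂ P = 3 ∧ ∀ Q ∈ F, P ⊓ Q ≠ ⊥) ∧
  ∀ P ∈ F, ∀ τ : P →ₗ[ℂ] W6,
    (∀ Q ∈ F, ∀ p₁ p₂ p₃ : P, ∀ q₁ ∈ Q, ∀ q₂ ∈ Q, ∀ q₃ ∈ Q,
      (wedge3 (τ p₁) p₂ p₃ + wedge3 p₁ (τ p₂) p₃ + wedge3 p₁ p₂ (τ p₃)) * wedge3 q₁ q₂ q₃ = 0) →
    ∀ p : P, τ p ∈ P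

/-- The basis element of `⋀⁶ W`. -/
def volW : ExteriorAlgebra ℂ W6 :=
  wedge3 (Pi.single 0 1) (Pi.single 1 1) (Pi.single 2 1) *
    wedge3 (Pi.single 3 1) (Pi.single 4 1) (Pi.single 5 1)

/-- The `V`-threefold `V_A ⊂ P_u × P_u^⊥` of the pair `(A, u)` is `f = 0`. Here a point of `P_u`
is `[x]` with `x ∈ U`, and a point of `P_u^⊥ = ℙ(⋀² (W / U))`, a hyperplane through `P_u`, is given
by vectors `v, w` that span it together with `U`; its coordinates are those of `v ∧ w` mod `U`, the
cross product of the last three coordinates. If `a ∈ A` is congruent to `a₁ = x ∧ v ∧ w` modulo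
`U ∧ U ∧ W`, with difference `a₂`, then the section defining `V_A` takes the value
`a₁ ∧ a₂ = a₁ ∧ a` in `⋀⁶ W`. -/
def IsThreefoldOf (A : Submodule ℂ (ExteriorAlgebra ℂ W6)) (f : BiPoly) : Prop :=
  ∃ c : ℂ, c ≠ 0 ∧ ∀ x ∈ planeU, ∀ v w : W6, ∀ a ∈ A, a - wedge3 x v w ∈ filt2 →
    wedge3 x v w * a =
      (c * eval (Sum.elim (![x 0, x 1, x 2])
        (crossProduct ![v 3, v 4, v 5] ![w 3, w 4, w 5])) f) • volW

/-- The `V`-threefold `f = 0` is attached to a Morin configuration `F` of 20 planes containing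
`P_u`: the span of `F` is `ℙ(A)` with `A` Lagrangian, `F` consists of the
planes in `ℙ(A)`, it is reduced at `u`, and `V_A` is `f = 0`. -/
def IsAttachedTo20Planes (f : BiPoly) : Prop :=
  ∃ (A : Submodule ℂ (ExteriorAlgebra ℂ W6)) (F : Set (Submodule ℂ W6)),
    IsLagrangian A ∧ A ≤ filt1 ∧ A ⊓ filt2 = filt3 ∧
    F = planesIn A ∧ planeU ∈ F ∧ F.ncard = 20 ∧ IsFiniteMorinConfiguration F ∧
    A = Submodule.span ℂ {e | ∃ P ∈ F, ∃ p ∈ P, ∃ q ∈ P, ∃ r ∈ P, e = wedge3 p q r} ∧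
    IsThreefoldOf A f

end

/-!
The conics through the four points `uᵢ` form the pencil spanned by `A = (x₀ - x₁) x₂` and
`B = x₀ (x₁ - x₂)`, and `vRam = A(x) B(y) - B(x) A(y)` says that `x` and `y` lie on the same member
of it. The singular points of the threefold are therefore the 16 pairs of base points and the three
pairs `(n, n)` with `n` the node of one of the three singular members.

In suitable coordinates `w` of `ℙ⁴`, the parameter `t = x₁ y₀` of a point `(x, y)` of the fibre of
`φ` over `w` satisfies `(w₀ + t) (w₁ + t) (w₂ + t) = (w₃ + t) (w₄ + t) t`, and `t` determines the
point. The cubic terms cancel, so that `φ` has degree 2. It is branched along the discriminant of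
this quadratic equation, a quartic whose pullback is the square of `vRam`. A double root `t` of the
equation gives a point of the Segre cubic `α₀ α₁ α₂ + β₀ β₁ β₂ = 0`, `∑ αᵢ + ∑ βⱼ = 0`, with tangent
hyperplane `w`: the quartic is the dual of the Segre cubic.

The Lagrangian subspace is the sum of `⋀³ U` and the graph of a polarity of the space of 3 by 3
matrices, whose quadratic form restricts to `2 * vRam` on the matrices of rank one. A decomposable
element of it that is not in `⋀³ U` has matrix `x yᵀ` for a singular point `(x, y)` of the
threefold, and each singular point comes from exactly one line of decomposable elements, whence
the `1 + 19` planes. The Hessian of `vRam` at such a point is as nondegenerate as the scalings of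
`x` and `y` allow, and this makes the scheme of planes incident to all of them reduced.
-/

noncomputable section

/-! ## Homogeneous forms and projective points -/

lemma exists_rep_mk_eq_smul {K V : Type*} [DivisionRing K] [AddCommGroup V] [Module K V] {v : V}
    (hv : v ≠ 0) : ∃ c : K, c ≠ 0 ∧ (Projectivization.mk K v hv).rep = c • v := by
  obtain ⟨a, ha⟩ := Projectivization.exists_smul_eq_mk_rep K v hv
  exact ⟨a, a.ne_zero, ha.symm⟩

lemma mk_eq_of_smul_eq_smul_rep {K V : Type*} [Field K] [AddCommGroup V] [Module K V] {v : V}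
    (hv : v ≠ 0) {p : ℙ K V} {c d : K} (hc : c ≠ 0) (h : c • v = d • p.rep) :
    Projectivization.mk K v hv = p := by
  conv_rhs => rw [← p.mk_rep]
  exact (Projectivization.mk_eq_mk_iff' K _ _ hv p.rep_nonzero).2
    ⟨c⁻¹ * d, by rw [mul_smul, ← h, inv_smul_smul₀ hc]⟩

lemma eval_smul_of_isHomogeneous {R σ : Type*} [CommSemiring R] {F : MvPolynomial σ R} {n : ℕ}
    (hF : F.IsHomogeneous n) (c : R) (v : σ → R) : eval (c • v) F = c ^ n * eval v F := by
  rw [eval_eq, eval_eq, Finset.mul_sum]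
  refine Finset.sum_congr rfl fun d hd => ?_
  have hdeg : ∑ i ∈ d.support, d i = n := by
    rw [← hF (mem_support_iff.mp hd), Finsupp.weight_apply, Finsupp.sum]
    simp only [Pi.one_apply, smul_eq_mul, mul_one]
  simp only [Pi.smul_apply, smul_eq_mul, mul_pow, Finset.prod_mul_distrib,
    Finset.prod_pow_eq_pow_sum, hdeg]
  ring

lemma eval_rep_mk_eq_zero_iff {K σ : Type*} [Field K] {F : MvPolynomial σ K} {n : ℕ}
    (hF : F.IsHomogeneous n) {v : σ → K} (hv : v ≠ 0) :
    eval (Projectivization.mk K v hv).rep F = 0 ↔ eval v F = 0 := by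
  obtain ⟨c, hc, hrep⟩ := exists_rep_mk_eq_smul (K := K) hv
  rw [hrep, eval_smul_of_isHomogeneous hF, mul_eq_zero_iff_left (pow_ne_zero n hc)]

lemma eval_zero_of_isHomogeneous {R σ : Type*} [CommSemiring R] {F : MvPolynomial σ R} {n : ℕ}
    (hF : F.IsHomogeneous n) (hn : n ≠ 0) : eval 0 F = 0 := by
  have h := eval_smul_of_isHomogeneous hF 0 0
  rwa [zero_smul, zero_pow hn, zero_mul] at h

lemma dvd_of_forall_eval_eq_zero {K σ : Type*} [Field K] [IsAlgClosed K] [Finite σ]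
    {h l F : MvPolynomial σ K} (hirr : Irreducible h) (hdvd : ¬h ∣ l)
    (hF : ∀ v, eval v h = 0 → eval v l ≠ 0 → eval v F = 0) : h ∣ F := by
  have hmem : F * l ∈ (Ideal.span {h}).radical := by
    rw [← vanishingIdeal_zeroLocus_eq_radical (K := K), mem_vanishingIdeal_iff]
    intro v hv
    have hv0 : eval v h = 0 := mem_zeroLocus_iff.1 hv h (Ideal.subset_span rfl)
    rw [aeval_eq_eval, map_mul, mul_eq_zero]
    exact or_iff_not_imp_right.2 (hF v hv0)
  obtain ⟨N, hN⟩ := hmem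
  exact (hirr.prime.dvd_or_dvd (hirr.prime.dvd_of_dvd_pow
    (Ideal.mem_span_singleton.1 hN))).resolve_right hdvd

lemma zariskiClosure_eq_hypersurface {S : Set P4} {h l : MvPolynomial (Fin 5) ℂ} {m n : ℕ}
    (hh : h.IsHomogeneous m) (hl : l.IsHomogeneous n) (hn : n ≠ 0) (hirr : Irreducible h)
    (hdvd : ¬h ∣ l) (hS : ∀ q ∈ S, eval q.rep h = 0)
    (hS' : ∀ q : P4, eval q.rep h = 0 → eval q.rep l ≠ 0 → q ∈ S) :
    zariskiClosure S = {q | eval q.rep h = 0} := by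
  ext q
  refine ⟨fun hq => hq m h hh hS, fun hq k F hF hFS => ?_⟩
  obtain ⟨G, rfl⟩ : h ∣ F := by
    refine dvd_of_forall_eval_eq_zero hirr hdvd fun v hv hlv => ?_
    have hv0 : v ≠ 0 := by
      rintro rfl
      exact hlv (eval_zero_of_isHomogeneous hl hn)
    rw [← eval_rep_mk_eq_zero_iff hF hv0]
    exact hFS _ (hS' _ ((eval_rep_mk_eq_zero_iff hh hv0).2 hv)
      (mt (eval_rep_mk_eq_zero_iff hl hv0).1 hlv))
  rw [map_mul, show eval q.rep h = 0 from hq, zero_mul]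

/-! ## Linear substitutions -/

/-- The linear substitution `zᵢ ↦ ∑ⱼ Mᵢⱼ zⱼ`, that is, the pullback of polynomial functions along
the linear map `M`. -/
def linSubst {R σ τ : Type*} [CommSemiring R] [Fintype τ] (M : Matrix σ τ R) :
    MvPolynomial σ R →ₐ[R] MvPolynomial τ R :=
  bind₁ M.toMvPolynomial

lemma pderiv_bind₁ {R σ τ : Type*} [CommSemiring R] [Fintype σ] (g : σ → MvPolynomial τ R)
    (f : MvPolynomial σ R) (i : τ) :
    pderiv i (bind₁ g f) = ∑ k, pderiv i (g k) * bind₁ g (pderiv k f) := by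
  classical
  induction f using MvPolynomial.induction_on with
  | C a => simp
  | add p q hp hq => simp only [map_add, hp, hq, mul_add, Finset.sum_add_distrib]
  | mul_X p n hp =>
    simp only [map_mul, bind₁_X_right, Derivation.leibniz, hp, smul_eq_mul, map_add, mul_add,
      Finset.sum_add_distrib, Finset.mul_sum]
    congr 1
    · rw [Finset.sum_eq_single n (fun k _ hk => by rw [pderiv_X_of_ne hk.symm]; simp) (by simp)]
      simp [mul_comm]
    · exact Finset.sum_congr rfl fun k _ => mul_left_comm _ _ _

lemma eval_linSubst {R σ τ : Type*} [CommSemiring R] [Fintype τ] (M : Matrix σ τ R)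
    (f : MvPolynomial σ R) (v : τ → R) : eval v (linSubst M f) = eval (M.mulVec v) f := by
  rw [linSubst, ← aeval_eq_eval, aeval_bind₁, ← aeval_eq_eval]
  simp only [aeval_eq_eval, Matrix.toMvPolynomial_eval_eq_apply]

lemma linSubst_isHomogeneous {R σ τ : Type*} [CommSemiring R] [Fintype τ] (M : Matrix σ τ R)
    {f : MvPolynomial σ R} {n : ℕ} (hf : f.IsHomogeneous n) : (linSubst M f).IsHomogeneous n := by
  have h := hf.aeval (n := 1) M.toMvPolynomial M.toMvPolynomial_isHomogeneous
  rwa [one_mul] at h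

lemma pderiv_linSubst {R σ τ : Type*} [CommSemiring R] [Fintype σ] [Fintype τ]
    (M : Matrix σ τ R) (f : MvPolynomial σ R) (i : τ) :
    pderiv i (linSubst M f) = ∑ k, C (M k i) * linSubst M (pderiv k f) := by
  classical
  have hlin (k : σ) : pderiv i (M.toMvPolynomial k) = C (M k i) := by
    rw [Matrix.toMvPolynomial, map_sum, Finset.sum_eq_single i]
    · simp
    · exact fun j _ hj => by simp [hj]
    · simp
  simp only [linSubst, pderiv_bind₁, hlin]

lemma linSubst_linSubst {R σ τ υ : Type*} [CommSemiring R] [Fintype τ] [Fintype υ]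
    (M : Matrix τ υ R) (N : Matrix σ τ R) (f : MvPolynomial σ R) :
    linSubst M (linSubst N f) = linSubst (N * M) f := by
  simp only [linSubst, bind₁_bind₁, ← Matrix.toMvPolynomial_mul]

lemma linSubst_one {R σ : Type*} [CommSemiring R] [Fintype σ] [DecidableEq σ]
    (f : MvPolynomial σ R) : linSubst (1 : Matrix σ σ R) f = f := by
  rw [linSubst, Matrix.toMvPolynomial_one, bind₁_X_left, AlgHom.id_apply]

section

variable {R σ : Type*} [CommRing R] [Fintype σ] [DecidableEq σ] {M : Matrix σ σ R}

/-- The substitution `linSubst M` for an invertible matrix `M`, as an automorphism. -/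
def linSubstEquiv (hM : IsUnit M.det) : MvPolynomial σ R ≃ₐ[R] MvPolynomial σ R :=
  AlgEquiv.ofAlgHom (linSubst M) (linSubst M⁻¹)
    (AlgHom.ext fun p => by simp [linSubst_linSubst, Matrix.nonsing_inv_mul M hM, linSubst_one])
    (AlgHom.ext fun p => by simp [linSubst_linSubst, Matrix.mul_nonsing_inv M hM, linSubst_one])

lemma linSubst_irreducible (hM : IsUnit M.det) {f : MvPolynomial σ R} (hf : Irreducible f) :
    Irreducible (linSubst M f) :=
  (MulEquiv.irreducible_iff (linSubstEquiv hM)).2 hf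

lemma linSubst_dvd_linSubst_iff (hM : IsUnit M.det) {f g : MvPolynomial σ R} :
    linSubst M f ∣ linSubst M g ↔ f ∣ g :=
  map_dvd_iff (linSubstEquiv hM)

end

lemma hessianAt_linSubst {σ τ : Type} [Fintype σ] [Fintype τ] (M : Matrix σ τ ℂ)
    (f : MvPolynomial σ ℂ) (v : τ → ℂ) :
    hessianAt (linSubst M f) v = M.transpose * hessianAt f (M.mulVec v) * M := by
  ext i j
  simp only [hessianAt, Matrix.of_apply, pderiv_linSubst, map_sum, Matrix.mul_apply,
    Matrix.transpose_apply, pderiv_C_mul, Finset.sum_mul, map_mul, eval_C, eval_linSubst,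
    Finset.mul_sum]
  exact Finset.sum_congr rfl fun k _ => Finset.sum_congr rfl fun l _ => by ring

lemma gradAt_linSubst (M : Matrix (Fin 5) (Fin 5) ℂ) (f : MvPolynomial (Fin 5) ℂ)
    (v : Fin 5 → ℂ) : gradAt (linSubst M f) v = M.transpose.mulVec (gradAt f (M.mulVec v)) := by
  ext i
  simp [gradAt, pderiv_linSubst, eval_linSubst, Matrix.mulVec, dotProduct]

/-! ## Forms of bidegree `(1, 1)` through the four points -/

lemma exists_eq_single_add_single_of_weight {σ τ : Type*} {d : σ ⊕ τ →₀ ℕ}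
    (hd : Finsupp.weight (Sum.elim (fun _ => ((1, 0) : ℕ × ℕ)) (fun _ => ((0, 1) : ℕ × ℕ))) d =
      (1, 1)) :
    ∃ i j, d = Finsupp.single (Sum.inl i) 1 + Finsupp.single (Sum.inr j) 1 := by
  obtain ⟨⟨a, b⟩, rfl⟩ := Finsupp.sumFinsuppAddEquivProdFinsupp.symm.surjective d
  have h : (a.sum fun _ n => n, b.sum fun _ n => n) = ((1, 1) : ℕ × ℕ) := by
    rw [← hd, Finsupp.weight_apply]
    ext <;> simp [Finsupp.sum, Prod.fst_sum, Prod.snd_sum]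
  obtain ⟨⟨i, rfl⟩, j, rfl⟩ :=
    (Prod.mk_inj.1 h).imp (Finsupp.sum_eq_one_iff a).1 (Finsupp.sum_eq_one_iff b).1
  exact ⟨i, j, by simp⟩

lemma biForms_one_one_eq_span :
    biForms 1 1 = Submodule.span ℂ
      (Set.range fun k : Fin 3 × Fin 3 => (X (Sum.inl k.1) * X (Sum.inr k.2) : BiPoly)) := by
  refine le_antisymm (fun p hp => ?_) (Submodule.span_le.2 ?_)
  · rw [p.as_sum]
    refine Submodule.sum_mem _ fun d hd => ?_
    obtain ⟨i, j, hd'⟩ := exists_eq_single_add_single_of_weight (hp (mem_support_iff.1 hd))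
    have hmon : monomial d (coeff d p) = coeff d p • (X (Sum.inl i) * X (Sum.inr j) : BiPoly) := by
      rw [X, X, monomial_mul, ← hd', smul_monomial, mul_one, smul_eq_mul, mul_one]
    rw [hmon]
    exact Submodule.smul_mem _ _ (Submodule.subset_span ⟨(i, j), rfl⟩)
  · rintro _ ⟨⟨i, j⟩, rfl⟩
    exact (isWeightedHomogeneous_X ℂ _ (Sum.inl i)).mul (isWeightedHomogeneous_X ℂ _ (Sum.inr j))

/-- The values at `(x, y)` of the five forms `xᵢ yⱼ - x₂ y₁`, `i ≠ j`, `(i, j) ≠ (2, 1)` (in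
one-based indices), which form a basis of `H⁰(𝓘(1,1))`. -/
def stdVec {R : Type*} [CommRing R] (x y : Fin 3 → R) : Fin 5 → R :=
  ![x 0 * y 1 - x 1 * y 0, x 1 * y 2 - x 1 * y 0, x 2 * y 0 - x 1 * y 0,
    x 0 * y 2 - x 1 * y 0, x 2 * y 1 - x 1 * y 0]

lemma stdVec_smul_smul {R : Type*} [CommRing R] (c d : R) (x y : Fin 3 → R) :
    stdVec (c • x) (d • y) = (c * d) • stdVec x y := by
  ext k
  fin_cases k <;> simp [stdVec] <;> ring

lemma map_stdVec {R S : Type*} [CommRing R] [CommRing S] (f : R →+* S) (x y : Fin 3 → R)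
    (k : Fin 5) : f (stdVec x y k) = stdVec (f ∘ x) (f ∘ y) k := by
  fin_cases k <;> simp [stdVec]

/-- The five forms `stdVec` as polynomials. -/
def stdForms : Fin 5 → BiPoly := stdVec (fun i => X (Sum.inl i)) (fun j => X (Sum.inr j))

lemma eval_stdForms (x y : Fin 3 → ℂ) (k : Fin 5) :
    eval (Sum.elim x y) (stdForms k) = stdVec x y k := by
  rw [stdForms, map_stdVec]
  congr 1 <;> ext <;> simp

lemma stdForms_mem (k : Fin 5) : stdForms k ∈ formsThroughO4 := by
  constructor
  · have hmem (i j : Fin 3) : (X (Sum.inl i) * X (Sum.inr j) : BiPoly) ∈ biForms 1 1 := by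
      rw [biForms_one_one_eq_span]
      exact Submodule.subset_span ⟨(i, j), rfl⟩
    fin_cases k <;> exact Submodule.sub_mem _ (hmem _ _) (hmem _ _)
  · simp only [SetLike.mem_coe, Submodule.mem_iInf, LinearMap.mem_ker, AlgHom.toLinearMap_apply,
      aeval_eq_eval, eval_stdForms]
    intro i
    fin_cases k <;> fin_cases i <;> simp [stdVec, fourPts]

lemma formsThroughO4_le_span : formsThroughO4 ≤ Submodule.span ℂ (Set.range stdForms) := by
  rintro p ⟨hp, hvan⟩
  rw [SetLike.mem_coe, biForms_one_one_eq_span, Submodule.mem_span_range_iff_exists_fun] at hp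
  obtain ⟨c, rfl⟩ := hp
  have hpt (k : Fin 4) : ∑ i, ∑ j, c (i, j) * (fourPts k i * fourPts k j) = 0 := by
    have h := (Submodule.mem_iInf _).1 hvan k
    simpa only [LinearMap.mem_ker, AlgHom.toLinearMap_apply, map_sum, map_smul, map_mul, aeval_X,
      Sum.elim_inl, Sum.elim_inr, smul_eq_mul, Fintype.sum_prod_type] using h
  have h00 : c (0, 0) = 0 := by simpa [Fin.sum_univ_three, fourPts] using hpt 0
  have h11 : c (1, 1) = 0 := by simpa [Fin.sum_univ_three, fourPts] using hpt 1
  have h22 : c (2, 2) = 0 := by simpa [Fin.sum_univ_three, fourPts] using hpt 2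
  have h10 : c (1, 0) = -(c (0, 1) + c (1, 2) + c (2, 0) + c (0, 2) + c (2, 1)) := by
    have h : c (0, 1) + c (0, 2) + (c (1, 0) + c (1, 2)) + (c (2, 0) + c (2, 1)) = 0 := by
      simpa [Fin.sum_univ_three, fourPts, h00, h11, h22] using hpt 3
    linear_combination h
  refine (Submodule.mem_span_range_iff_exists_fun ℂ).2
    ⟨![c (0, 1), c (1, 2), c (2, 0), c (0, 2), c (2, 1)], ?_⟩
  simp [Fintype.sum_prod_type, Fin.sum_univ_three, Fin.sum_univ_five, h00, h11, h22, h10, stdForms,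
    stdVec, smul_eq_C_mul]
  ring

lemma linearIndependent_stdForms : LinearIndependent ℂ stdForms := by
  rw [Fintype.linearIndependent_iff]
  intro g hg
  have key (x y : Fin 3 → ℂ) : ∑ k, g k * stdVec x y k = 0 := by
    have h := congrArg (eval (Sum.elim x y)) hg
    simpa only [map_sum, smul_eval, eval_stdForms, map_zero] using h
  have h0 : g 0 = 0 := by simpa [Fin.sum_univ_five, stdVec] using key ![1, 0, 0] ![0, 1, 0]
  have h1 : g 1 = 0 := by simpa [Fin.sum_univ_five, stdVec] using key ![0, 1, 0] ![0, 0, 1]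
  have h2 : g 2 = 0 := by simpa [Fin.sum_univ_five, stdVec] using key ![0, 0, 1] ![1, 0, 0]
  have h3 : g 3 = 0 := by simpa [Fin.sum_univ_five, stdVec] using key ![1, 0, 0] ![0, 0, 1]
  have h4 : g 4 = 0 := by simpa [Fin.sum_univ_five, stdVec] using key ![0, 0, 1] ![0, 1, 0]
  intro k
  fin_cases k <;> assumption

/-- The basis `stdForms` of `H⁰(𝓘(1,1))`. -/
def stdBasis : Module.Basis (Fin 5) ℂ formsThroughO4 :=
  (Module.Basis.span linearIndependent_stdForms).map <| LinearEquiv.ofEq _ _ <|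
    le_antisymm (Submodule.span_le.2 (Set.range_subset_iff.2 stdForms_mem)) formsThroughO4_le_span

lemma coe_stdBasis (k : Fin 5) : (stdBasis k : BiPoly) = stdForms k := by
  simp [stdBasis, Module.Basis.span_apply]

lemma finrank_formsThroughO4 : Module.finrank ℂ formsThroughO4 = 5 := by
  rw [Module.finrank_eq_card_basis stdBasis, Fintype.card_fin]

/-- The five forms obtained from `stdForms` by the linear change of coordinates `M` of `ℙ⁴`. -/
def stdSystem (M : Matrix (Fin 5) (Fin 5) ℂ) : Fin 5 → BiPoly :=
  fun k => ∑ l, C (M k l) * stdForms l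

lemma exists_eq_stdSystem (b : Module.Basis (Fin 5) ℂ formsThroughO4) :
    ∃ M : Matrix (Fin 5) (Fin 5) ℂ, IsUnit M.det ∧ (fun k => (b k : BiPoly)) = stdSystem M := by
  refine ⟨(stdBasis.toMatrix b).transpose, ?_, funext fun k => ?_⟩
  · rw [Matrix.det_transpose, ← Matrix.isUnit_iff_isUnit_det]
    exact IsUnit.of_mul_eq_one _ (stdBasis.toMatrix_mul_toMatrix_flip b)
  · rw [← stdBasis.sum_toMatrix_smul_self b k]
    simp only [Submodule.coe_sum, Submodule.coe_smul, coe_stdBasis, smul_eq_C_mul, stdSystem,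
      Matrix.transpose_apply]

lemma phiVec_stdSystem (M : Matrix (Fin 5) (Fin 5) ℂ) (p : P2 × P2) :
    phiVec (stdSystem M) p = M.mulVec (stdVec p.1.rep p.2.rep) := by
  ext k
  simp [phiVec, stdSystem, coords, eval_stdForms, Matrix.mulVec, dotProduct]

lemma phiMaps_stdSystem_iff {M : Matrix (Fin 5) (Fin 5) ℂ} (hM : IsUnit M.det) (p : P2 × P2)
    (q : P4) :
    PhiMaps (stdSystem M) p q ↔
      ∃ c : ℂ, c ≠ 0 ∧ stdVec p.1.rep p.2.rep = c • M⁻¹.mulVec q.rep := by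
  have hphi (w : Fin 5 → ℂ) :
      phiVec (stdSystem M) p = w ↔ stdVec p.1.rep p.2.rep = M⁻¹.mulVec w := by
    have := M.invertibleOfIsUnitDet hM
    rw [phiVec_stdSystem]
    exact ⟨by rintro rfl; simp, fun h => by simp [h]⟩
  constructor
  · rintro ⟨h, rfl⟩
    obtain ⟨c, hc, hrep⟩ := exists_rep_mk_eq_smul (K := ℂ) h
    refine ⟨c⁻¹, inv_ne_zero hc, ?_⟩
    rw [hrep, Matrix.mulVec_smul, inv_smul_smul₀ hc, ← hphi]
  · rintro ⟨c, hc, h⟩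
    rw [← Matrix.mulVec_smul, ← hphi] at h
    refine ⟨h ▸ smul_ne_zero hc q.rep_nonzero, Eq.trans ?_ q.mk_rep⟩
    exact (Projectivization.mk_eq_mk_iff' ℂ _ _ _ q.rep_nonzero).2 ⟨c, h.symm⟩

lemma exists_stdVec_rep_eq_smul {x y : Fin 3 → ℂ} (hx : x ≠ 0) (hy : y ≠ 0) :
    ∃ c : ℂ, c ≠ 0 ∧ stdVec (Projectivization.mk ℂ x hx).rep (Projectivization.mk ℂ y hy).rep =
      c • stdVec x y := by
  obtain ⟨c, hc, hcx⟩ := exists_rep_mk_eq_smul (K := ℂ) hx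
  obtain ⟨d, hd, hdy⟩ := exists_rep_mk_eq_smul (K := ℂ) hy
  exact ⟨c * d, mul_ne_zero hc hd, by rw [hcx, hdy, stdVec_smul_smul]⟩

/-! ## The fibres of the map -/

/-- The Igusa quartic in the coordinates `stdForms`: the discriminant of the polynomial
`(w₀ + t) (w₁ + t) (w₂ + t) - (w₃ + t) (w₄ + t) t` of degree two in `t`. -/
def igusaForm : MvPolynomial (Fin 5) ℂ :=
  (X 0 * X 1 + X 0 * X 2 + X 1 * X 2 - X 3 * X 4) ^ 2 -
    C 4 * (X 0 + X 1 + X 2 - X 3 - X 4) * (X 0 * X 1 * X 2)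

/-- Away from this form the polynomial `(w₀ + t) (w₁ + t) (w₂ + t) - (w₃ + t) (w₄ + t) t` has
degree exactly two, and none of its roots is a root of one of the six factors. -/
def exceptionalForm : MvPolynomial (Fin 5) ℂ :=
  (X 0 + X 1 + X 2 - X 3 - X 4) * (X 0 * X 1 * X 2) *
    ((X 0 - X 3) * (X 1 - X 3) * (X 2 - X 3)) * ((X 0 - X 4) * (X 1 - X 4) * (X 2 - X 4))

lemma igusaForm_isHomogeneous : igusaForm.IsHomogeneous 4 := by
  have hX := isHomogeneous_X (σ := Fin 5) ℂ
  have hE := ((((hX 0).mul (hX 1)).add ((hX 0).mul (hX 2))).add ((hX 1).mul (hX 2))).sub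
    ((hX 3).mul (hX 4))
  have hL := (((((hX 0).add (hX 1)).add (hX 2)).sub (hX 3)).sub (hX 4)).C_mul 4
  exact (hE.pow 2).sub (hL.mul (((hX 0).mul (hX 1)).mul (hX 2)))

lemma exceptionalForm_isHomogeneous : exceptionalForm.IsHomogeneous 10 := by
  have hX := isHomogeneous_X (σ := Fin 5) ℂ
  have hL := ((((hX 0).add (hX 1)).add (hX 2)).sub (hX 3)).sub (hX 4)
  have hsub (j : Fin 5) := (((hX 0).sub (hX j)).mul ((hX 1).sub (hX j))).mul ((hX 2).sub (hX j))
  exact ((hL.mul (((hX 0).mul (hX 1)).mul (hX 2))).mul (hsub 3)).mul (hsub 4)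

lemma eval_igusaForm (w : Fin 5 → ℂ) :
    eval w igusaForm = (w 0 * w 1 + w 0 * w 2 + w 1 * w 2 - w 3 * w 4) ^ 2 -
      4 * (w 0 + w 1 + w 2 - w 3 - w 4) * (w 0 * w 1 * w 2) := by
  simp [igusaForm]

lemma eval_exceptionalForm (w : Fin 5 → ℂ) :
    eval w exceptionalForm = (w 0 + w 1 + w 2 - w 3 - w 4) * (w 0 * w 1 * w 2) *
      ((w 0 - w 3) * (w 1 - w 3) * (w 2 - w 3)) * ((w 0 - w 4) * (w 1 - w 4) * (w 2 - w 4)) := by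
  simp [exceptionalForm]

lemma not_igusaForm_dvd_exceptionalForm : ¬igusaForm ∣ exceptionalForm := by
  intro h
  have hdvd := map_dvd (eval ![16, 1, 1, 7, 7]) h
  rw [eval_igusaForm, eval_exceptionalForm] at hdvd
  simp at hdvd
  norm_num at hdvd

lemma eval_vRam (x y : Fin 3 → ℂ) :
    eval (Sum.elim x y) vRam = (x 0 - x 1) * x 2 * (y 0 * (y 1 - y 2)) -
      x 0 * (x 1 - x 2) * ((y 0 - y 1) * y 2) := by
  simp [vRam]

lemma eval_stdVec_igusaForm (x y : Fin 3 → ℂ) :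
    eval (stdVec x y) igusaForm = eval (Sum.elim x y) vRam ^ 2 := by
  rw [eval_igusaForm, eval_vRam]
  simp [stdVec]
  ring

section

variable {R : Type*} [CommRing R]

/-- The equation in the parameter `t = x₁ y₀` of the points `(x, y)` of the fibre over `w`: if
`stdVec x y = w` then the products `xᵢ yⱼ`, `i ≠ j`, are the `wₖ + t` and `t`, and the two sides are
`(x₀ y₁) (x₁ y₂) (x₂ y₀)` and `(x₀ y₂) (x₂ y₁) (x₁ y₀)`. -/
def FibreEq (w : Fin 5 → R) (t : R) : Prop :=
  (w 0 + t) * (w 1 + t) * (w 2 + t) = (w 3 + t) * (w 4 + t) * t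

/-- The `x`-coordinates of the point with parameter `t` of the fibre over `w`. -/
def fibreX (w : Fin 5 → R) (t : R) : Fin 3 → R :=
  ![(w 0 + t) * (w 2 + t), t * (w 4 + t), (w 2 + t) * (w 4 + t)]

/-- The `y`-coordinates of the point with parameter `t` of the fibre over `w`. -/
def fibreY (w : Fin 5 → R) (t : R) : Fin 3 → R :=
  ![t * (w 2 + t), t * (w 4 + t), (w 1 + t) * (w 2 + t)]

lemma fibreEq_iff_quadratic_eq_zero (w : Fin 5 → R) (t : R) :
    FibreEq w t ↔ (w 0 + w 1 + w 2 - w 3 - w 4) * (t * t) +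
      (w 0 * w 1 + w 0 * w 2 + w 1 * w 2 - w 3 * w 4) * t + w 0 * w 1 * w 2 = 0 := by
  rw [FibreEq, ← sub_eq_zero]
  ring_nf

lemma stdVec_fibre {w : Fin 5 → R} {t : R} (h : FibreEq w t) :
    stdVec (fibreX w t) (fibreY w t) = ((w 4 + t) * t * (w 2 + t)) • w := by
  unfold FibreEq at h
  ext k
  fin_cases k <;> simp [stdVec, fibreX, fibreY]
  · ring
  · ring
  · ring
  · linear_combination (w 2 + t) * h
  · ring

lemma products_eq_of_stdVec_eq {w : Fin 5 → R} {x y : Fin 3 → R} {c t : R}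
    (h : stdVec x y = c • w) (ht : x 1 * y 0 = c * t) :
    x 0 * y 1 = c * (w 0 + t) ∧ x 1 * y 2 = c * (w 1 + t) ∧ x 2 * y 0 = c * (w 2 + t) ∧
      x 0 * y 2 = c * (w 3 + t) ∧ x 2 * y 1 = c * (w 4 + t) := by
  have h0 : x 0 * y 1 - x 1 * y 0 = c * w 0 := congrFun h 0
  have h1 : x 1 * y 2 - x 1 * y 0 = c * w 1 := congrFun h 1
  have h2 : x 2 * y 0 - x 1 * y 0 = c * w 2 := congrFun h 2
  have h3 : x 0 * y 2 - x 1 * y 0 = c * w 3 := congrFun h 3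
  have h4 : x 2 * y 1 - x 1 * y 0 = c * w 4 := congrFun h 4
  exact ⟨by linear_combination h0 + ht, by linear_combination h1 + ht,
    by linear_combination h2 + ht, by linear_combination h3 + ht, by linear_combination h4 + ht⟩

lemma smul_fibreX_eq {w : Fin 5 → R} {x y : Fin 3 → R} {c t : R}
    (h : stdVec x y = c • w) (ht : x 1 * y 0 = c * t) :
    c ^ 2 • fibreX w t = (x 2 * y 0 * y 1) • x := by
  obtain ⟨h01, -, h20, -, h21⟩ := products_eq_of_stdVec_eq h ht
  ext i
  fin_cases i <;> simp [fibreX]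
  · linear_combination (-x 2 * y 0) * h01 - c * (w 0 + t) * h20
  · linear_combination (-x 2 * y 1) * ht - c * t * h21
  · linear_combination (-x 2 * y 1) * h20 - c * (w 2 + t) * h21

lemma smul_fibreY_eq {w : Fin 5 → R} {x y : Fin 3 → R} {c t : R}
    (h : stdVec x y = c • w) (ht : x 1 * y 0 = c * t) :
    c ^ 2 • fibreY w t = (x 1 * x 2 * y 0) • y := by
  obtain ⟨-, h12, h20, -, h21⟩ := products_eq_of_stdVec_eq h ht
  ext i
  fin_cases i <;> simp [fibreY]
  · linear_combination (-x 2 * y 0) * ht - c * t * h20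
  · linear_combination (-x 2 * y 1) * ht - c * t * h21
  · linear_combination (-x 2 * y 0) * h12 - c * (w 1 + t) * h20

lemma fibreEq_of_stdVec_eq [IsDomain R] {w : Fin 5 → R} {x y : Fin 3 → R} {c t : R} (hc : c ≠ 0)
    (h : stdVec x y = c • w) (ht : x 1 * y 0 = c * t) : FibreEq w t := by
  obtain ⟨h01, h12, h20, h02, h21⟩ := products_eq_of_stdVec_eq h ht
  refine mul_left_cancel₀ (pow_ne_zero 3 hc) ?_
  calc c ^ 3 * ((w 0 + t) * (w 1 + t) * (w 2 + t))
      = (c * (w 0 + t)) * (c * (w 1 + t)) * (c * (w 2 + t)) := by ring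
    _ = (c * (w 3 + t)) * (c * (w 4 + t)) * (c * t) := by
      rw [← h01, ← h12, ← h20, ← h02, ← h21, ← ht]; ring
    _ = c ^ 3 * ((w 3 + t) * (w 4 + t) * t) := by ring

end

lemma ncard_quadratic_roots {K : Type*} [Field K] [NeZero (2 : K)] [IsAlgClosed K] {a b c : K}
    (ha : a ≠ 0) (hd : discrim a b c ≠ 0) :
    {t : K | a * (t * t) + b * t + c = 0}.ncard = 2 := by
  obtain ⟨s, hs⟩ := IsAlgClosed.exists_eq_mul_self (discrim a b c)
  have hroots : {t : K | a * (t * t) + b * t + c = 0} =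
      {(-b + s) / (2 * a), (-b - s) / (2 * a)} :=
    Set.ext fun t => quadratic_eq_zero_iff ha hs t
  rw [hroots, Set.ncard_pair]
  intro h
  have h2 : (2 : K) ≠ 0 := two_ne_zero
  have hs0 : 2 * s = 0 := by
    field_simp at h
    linear_combination h
  rw [hs, (mul_eq_zero.1 hs0).resolve_left h2, mul_zero] at hd
  exact hd rfl

section

variable {w : Fin 5 → ℂ} (hw : eval w exceptionalForm ≠ 0)
include hw

lemma FibreEq.ne_zero {t : ℂ} (h : FibreEq w t) :
    w 0 + t ≠ 0 ∧ w 1 + t ≠ 0 ∧ w 2 + t ≠ 0 ∧ w 3 + t ≠ 0 ∧ w 4 + t ≠ 0 ∧ t ≠ 0 := by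
  rw [eval_exceptionalForm] at hw
  simp only [ne_eq, mul_eq_zero, not_or, sub_eq_zero] at hw
  obtain ⟨⟨⟨-, ⟨h0, h1⟩, h2⟩, ⟨h03, h13⟩, h23⟩, ⟨h04, h14⟩, h24⟩ := hw
  have shift {p q : ℂ} (hpq : p ≠ q) (hp : p + t = 0) : q + t ≠ 0 := fun hq =>
    hpq (add_right_cancel (hp.trans hq.symm))
  have right_ne_zero {p : ℂ} (hp3 : p ≠ w 3) (hp4 : p ≠ w 4) (hp0 : p ≠ 0) (hp : p + t = 0) :
      (w 3 + t) * (w 4 + t) * t ≠ 0 :=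
    mul_ne_zero (mul_ne_zero (shift hp3 hp) (shift hp4 hp)) (by simpa using shift hp0 hp)
  have n0 : w 0 + t ≠ 0 := fun hp => right_ne_zero h03 h04 h0 hp (by rw [← h, hp]; ring)
  have n1 : w 1 + t ≠ 0 := fun hp => right_ne_zero h13 h14 h1 hp (by rw [← h, hp]; ring)
  have n2 : w 2 + t ≠ 0 := fun hp => right_ne_zero h23 h24 h2 hp (by rw [← h, hp]; ring)
  have n345 : (w 3 + t) * (w 4 + t) * t ≠ 0 := by
    rw [← h]
    exact mul_ne_zero (mul_ne_zero n0 n1) n2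
  simp only [ne_eq, mul_eq_zero, not_or] at n345
  exact ⟨n0, n1, n2, n345.1.1, n345.1.2, n345.2⟩

lemma FibreEq.fibreX_ne_zero {t : ℂ} (h : FibreEq w t) : fibreX w t ≠ 0 := by
  obtain ⟨-, -, n2, -, n4, -⟩ := h.ne_zero hw
  exact fun h0 => mul_ne_zero n2 n4 (congrFun h0 2)

lemma FibreEq.fibreY_ne_zero {t : ℂ} (h : FibreEq w t) : fibreY w t ≠ 0 := by
  obtain ⟨-, n1, n2, -, -, -⟩ := h.ne_zero hw
  exact fun h0 => mul_ne_zero n1 n2 (congrFun h0 2)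

lemma exists_fibreEq : ∃ t, FibreEq w t := by
  simp only [fibreEq_iff_quadratic_eq_zero]
  refine exists_quadratic_eq_zero ?_ (IsAlgClosed.exists_eq_mul_self _)
  rw [eval_exceptionalForm] at hw
  exact left_ne_zero_of_mul (left_ne_zero_of_mul (left_ne_zero_of_mul hw))

lemma ncard_fibreEq (hd : eval w igusaForm ≠ 0) : {t | FibreEq w t}.ncard = 2 := by
  simp only [fibreEq_iff_quadratic_eq_zero]
  refine ncard_quadratic_roots ?_ ?_
  · rw [eval_exceptionalForm] at hw
    exact left_ne_zero_of_mul (left_ne_zero_of_mul (left_ne_zero_of_mul hw))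
  · rwa [eval_igusaForm] at hd

end

/-- The point with parameter `t` of the fibre over `w`. -/
def fibrePt {w : Fin 5 → ℂ} (hw : eval w exceptionalForm ≠ 0) (t : {t // FibreEq w t}) : P2 × P2 :=
  (Projectivization.mk ℂ _ (t.2.fibreX_ne_zero hw), Projectivization.mk ℂ _ (t.2.fibreY_ne_zero hw))

lemma fibrePt_injective {w : Fin 5 → ℂ} (hw : eval w exceptionalForm ≠ 0) :
    Function.Injective (fibrePt hw) := by
  rintro ⟨t, ht⟩ ⟨s, hs⟩ hts
  obtain ⟨-, -, n2, -, n4, -⟩ := ht.ne_zero hw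
  obtain ⟨-, -, -, -, m4, -⟩ := hs.ne_zero hw
  obtain ⟨k, hk⟩ := (Projectivization.mk_eq_mk_iff' _ _ _ _ _).1 (congrArg Prod.fst hts)
  have hk1 : k * (s * (w 4 + s)) = t * (w 4 + t) := congrFun hk 1
  have hk2 : k * ((w 2 + s) * (w 4 + s)) = (w 2 + t) * (w 4 + t) := congrFun hk 2
  have hk0 : k ≠ 0 := by
    rintro rfl
    exact mul_ne_zero n2 n4 (by rw [← hk2, zero_mul])
  have hw2 : w 2 ≠ 0 := by
    rw [eval_exceptionalForm] at hw
    intro h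
    simp [h] at hw
  have hprod : (k * w 2 * ((w 4 + t) * (w 4 + s))) * (s - t) = 0 := by
    linear_combination (w 2 + t) * (w 4 + t) * hk1 - t * (w 4 + t) * hk2
  have hst := (mul_eq_zero.1 hprod).resolve_left
    (mul_ne_zero (mul_ne_zero hk0 hw2) (mul_ne_zero n4 m4))
  exact Subtype.ext (sub_eq_zero.1 hst).symm

lemma setOf_phiMaps_eq_range_fibrePt {M : Matrix (Fin 5) (Fin 5) ℂ} (hM : IsUnit M.det) {q : P4}
    (hw : eval (M⁻¹.mulVec q.rep) exceptionalForm ≠ 0) :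
    {p | PhiMaps (stdSystem M) p q} = Set.range (fibrePt hw) := by
  ext p
  rw [Set.mem_ofPred_eq, phiMaps_stdSystem_iff hM]
  constructor
  · rintro ⟨c, hc, h⟩
    have ht : p.1.rep 1 * p.2.rep 0 = c * (p.1.rep 1 * p.2.rep 0 / c) := by field_simp
    have hF := fibreEq_of_stdVec_eq hc h ht
    exact ⟨⟨_, hF⟩, Prod.ext
      (mk_eq_of_smul_eq_smul_rep _ (pow_ne_zero 2 hc) (smul_fibreX_eq h ht))
      (mk_eq_of_smul_eq_smul_rep _ (pow_ne_zero 2 hc) (smul_fibreY_eq h ht))⟩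
  · rintro ⟨t, rfl⟩
    obtain ⟨-, -, n2, -, n4, nt⟩ := t.2.ne_zero hw
    obtain ⟨c, hc, h⟩ :=
      exists_stdVec_rep_eq_smul (t.2.fibreX_ne_zero hw) (t.2.fibreY_ne_zero hw)
    rw [stdVec_fibre t.2, smul_smul] at h
    exact ⟨_, mul_ne_zero hc (mul_ne_zero (mul_ne_zero n4 nt) n2), h⟩

lemma hasDegreeTwo_stdSystem {M : Matrix (Fin 5) (Fin 5) ℂ} (hM : IsUnit M.det) :
    HasDegreeTwo (stdSystem M) := by
  refine ⟨14, linSubst M⁻¹ (igusaForm * exceptionalForm), linSubst_isHomogeneous _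
    (igusaForm_isHomogeneous.mul exceptionalForm_isHomogeneous), fun h0 => ?_, fun q hq => ?_⟩
  · have h := congrArg (eval (M.mulVec ![1, 2, 3, 4, 5])) h0
    rw [eval_linSubst, Matrix.mulVec_mulVec, Matrix.nonsing_inv_mul M hM, Matrix.one_mulVec,
      map_mul, eval_igusaForm, eval_exceptionalForm] at h
    simp at h
    norm_num at h
  · rw [eval_linSubst, map_mul] at hq
    obtain ⟨hd, hw⟩ := mul_ne_zero_iff.1 hq
    rw [setOf_phiMaps_eq_range_fibrePt hM hw, ← Set.image_univ,
      Set.ncard_image_of_injective _ (fibrePt_injective hw), Set.ncard_univ,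
      ← Set.coe_ofPred, Nat.card_coe_set_eq, ncard_fibreEq hw hd]

/-! ## Irreducibility of the Igusa quartic, and the image of the ramification divisor -/

section

variable {K S σ : Type*} [Field K] [CommRing S] [Algebra K S]
  {φ : MvPolynomial σ K →ₐ[K] Polynomial S} (hφ : ∀ i, (φ (X i)).natDegree ≤ 1)
include hφ

lemma natDegree_algHom_le_totalDegree (F : MvPolynomial σ K) :
    (φ F).natDegree ≤ F.totalDegree := by
  have h := aeval_natDegree_le (map (algebraMap K S) F) (Finset.sup_mono (support_map_subset _ _))
    (fun i => φ (X i)) hφ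
  rw [aeval_map_algebraMap, mul_one] at h
  rwa [aeval_unique φ]

lemma irreducible_of_irreducible_algHom [IsDomain S] {f : MvPolynomial σ K}
    (hirr : Irreducible (φ f)) (hdeg : (φ f).natDegree = f.totalDegree) : Irreducible f := by
  have isUnit_of_isUnit_map {F G : MvPolynomial σ K} (hf : f = F * G) (hF : IsUnit (φ F)) :
      IsUnit F := by
    have hφ0 : φ F * φ G ≠ 0 := by
      rw [← map_mul, ← hf]
      exact hirr.ne_zero
    have hG : (φ G).natDegree = f.totalDegree := by
      rw [← hdeg, hf, map_mul, Polynomial.natDegree_mul (left_ne_zero_of_mul hφ0)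
        (right_ne_zero_of_mul hφ0), Polynomial.natDegree_eq_zero_of_isUnit hF, zero_add]
    have hF0 : F ≠ 0 := fun h => hφ0 (by rw [h, map_zero, zero_mul])
    have hG0 : G ≠ 0 := fun h => hφ0 (by rw [h, map_zero, mul_zero])
    have htotal : F.totalDegree = 0 := by
      have hle := natDegree_algHom_le_totalDegree hφ G
      have hadd := totalDegree_mul_of_isDomain hF0 hG0
      rw [← hf] at hadd
      omega
    rw [totalDegree_eq_zero_iff_eq_C] at htotal
    rw [htotal] at hF0 ⊢
    exact (isUnit_iff_ne_zero.2 fun h => hF0 (by rw [h, map_zero])).map C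
  refine ⟨fun h => hirr.not_isUnit (h.map φ), fun F G hf => ?_⟩
  rcases hirr.isUnit_or_isUnit (by rw [hf, map_mul] : φ f = φ F * φ G) with hF | hG
  · exact Or.inl (isUnit_of_isUnit_map hf hF)
  · exact Or.inr (isUnit_of_isUnit_map (hf.trans (mul_comm F G)) hG)

end

section

variable {R : Type*} [CommRing R]

lemma monic_quartic (a b c d : R) :
    (Polynomial.X ^ 4 + Polynomial.C a * Polynomial.X ^ 3 + Polynomial.C b * Polynomial.X ^ 2 +
      Polynomial.C c * Polynomial.X + Polynomial.C d).Monic := by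
  monicity!

lemma isEisensteinAt_quartic {P : Ideal R} (hP : P ≠ ⊤) {a b c d : R} (ha : a ∈ P) (hb : b ∈ P)
    (hc : c ∈ P) (hd : d ∈ P) (hd' : d ∉ P ^ 2) :
    (Polynomial.X ^ 4 + Polynomial.C a * Polynomial.X ^ 3 + Polynomial.C b * Polynomial.X ^ 2 +
      Polynomial.C c * Polynomial.X + Polynomial.C d).IsEisensteinAt P := by
  refine (monic_quartic a b c d).isEisensteinAt_of_mem_of_notMem hP (fun {n} hn => ?_) ?_
  · have hn4 : n < 4 := hn.trans_le (by compute_degree)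
    interval_cases n <;> simpa [Polynomial.coeff_X, Polynomial.coeff_C]
  · simpa

end

/-- The substitution `w = (u, v + 1, v - 1, 2, -1 / 2)` with values in `ℂ[u][v]`; it turns the Igusa
quartic into an Eisenstein polynomial in `v` at the prime `u`. -/
def eisensteinSubst : MvPolynomial (Fin 5) ℂ →ₐ[ℂ] Polynomial (Polynomial ℂ) :=
  aeval ![Polynomial.C Polynomial.X, Polynomial.X + 1, Polynomial.X - 1, 2,
    algebraMap ℂ _ (-1 / 2)]

lemma natDegree_eisensteinSubst_X_le (i : Fin 5) : (eisensteinSubst (X i)).natDegree ≤ 1 := by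
  rw [eisensteinSubst, aeval_X]
  fin_cases i
  · simp
  · exact (Polynomial.natDegree_X_add_C 1).le
  · exact (Polynomial.natDegree_X_sub_C 1).le
  · simp
  · exact (Polynomial.natDegree_C _).trans_le zero_le_one

lemma eisensteinSubst_igusaForm :
    eisensteinSubst igusaForm = Polynomial.X ^ 4 + Polynomial.C (-4 * Polynomial.X) *
      Polynomial.X ^ 3 + Polynomial.C (6 * Polynomial.X) * Polynomial.X ^ 2 +
      Polynomial.C (8 * Polynomial.X) * Polynomial.X +
      Polynomial.C (4 * Polynomial.X ^ 2 - 6 * Polynomial.X) := by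
  have hhalf : algebraMap ℂ (Polynomial (Polynomial ℂ)) (-1 / 2) * 2 = -1 := by
    have h2 : (2 : Polynomial (Polynomial ℂ)) = algebraMap ℂ _ 2 := (map_ofNat _ 2).symm
    rw [h2, ← map_mul]
    norm_num
  simp only [eisensteinSubst, igusaForm, ← algebraMap_eq, map_sub, map_mul, map_add, map_pow,
    aeval_X, Matrix.cons_val, map_neg, map_ofNat]
  generalize algebraMap ℂ (Polynomial (Polynomial ℂ)) (-1 / 2) = k at hhalf
  generalize (Polynomial.C Polynomial.X : Polynomial (Polynomial ℂ)) = u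
  generalize (Polynomial.X : Polynomial (Polynomial ℂ)) = v
  linear_combination (-(2 * (2 * u * v + v ^ 2 - 1) - 2 * k + 1) + 2 * u * (v ^ 2 - 1)) * hhalf

lemma natDegree_eisensteinSubst_igusaForm : (eisensteinSubst igusaForm).natDegree = 4 := by
  rw [eisensteinSubst_igusaForm]
  compute_degree!

lemma irreducible_eisensteinSubst_igusaForm : Irreducible (eisensteinSubst igusaForm) := by
  have hprime : (Ideal.span {(Polynomial.X : Polynomial ℂ)}).IsPrime :=
    (Ideal.span_singleton_prime Polynomial.X_ne_zero).2 Polynomial.prime_X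
  have hmem (q : Polynomial ℂ) : q * Polynomial.X ∈ Ideal.span {(Polynomial.X : Polynomial ℂ)} :=
    Ideal.mul_mem_left _ q (Ideal.mem_span_singleton_self _)
  have hlast : 4 * Polynomial.X ^ 2 - 6 * Polynomial.X ∉
      Ideal.span {(Polynomial.X : Polynomial ℂ)} ^ 2 := by
    rw [Ideal.span_singleton_pow, Ideal.mem_span_singleton, Polynomial.X_pow_dvd_iff]
    intro h
    simpa [Polynomial.coeff_ofNat_mul] using h 1 one_lt_two
  have heis : (eisensteinSubst igusaForm).IsEisensteinAt (Ideal.span {Polynomial.X}) := by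
    rw [eisensteinSubst_igusaForm]
    refine isEisensteinAt_quartic hprime.ne_top (hmem _) (hmem _) (hmem _) ?_ hlast
    convert hmem (4 * Polynomial.X - 6) using 1
    ring
  refine heis.irreducible hprime ?_ (by rw [natDegree_eisensteinSubst_igusaForm]; norm_num)
  rw [eisensteinSubst_igusaForm]
  exact (monic_quartic _ _ _ _).isPrimitive

lemma irreducible_igusaForm : Irreducible igusaForm := by
  have hirr := irreducible_eisensteinSubst_igusaForm
  have h0 : igusaForm ≠ 0 := fun h => hirr.ne_zero (by rw [h, map_zero])
  refine irreducible_of_irreducible_algHom natDegree_eisensteinSubst_X_le hirr ?_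
  rw [natDegree_eisensteinSubst_igusaForm, igusaForm_isHomogeneous.totalDegree h0]

lemma eval_igusaForm_eq_zero_iff {M : Matrix (Fin 5) (Fin 5) ℂ} (hM : IsUnit M.det)
    {p : P2 × P2} {q : P4} (h : PhiMaps (stdSystem M) p q) :
    eval (M⁻¹.mulVec q.rep) igusaForm = 0 ↔ eval (coords p) vRam = 0 := by
  obtain ⟨c, hc, hpq⟩ := (phiMaps_stdSystem_iff hM p q).1 h
  rw [coords, ← pow_eq_zero_iff (a := eval _ vRam) two_ne_zero, ← eval_stdVec_igusaForm, hpq,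
    eval_smul_of_isHomogeneous igusaForm_isHomogeneous, mul_eq_zero_iff_left (pow_ne_zero 4 hc)]

lemma imageOfHypersurface_stdSystem_vRam {M : Matrix (Fin 5) (Fin 5) ℂ} (hM : IsUnit M.det) :
    imageOfHypersurface (stdSystem M) vRam = {q | eval q.rep (linSubst M⁻¹ igusaForm) = 0} := by
  have hM' : IsUnit (M⁻¹).det := Matrix.isUnit_nonsing_inv_det M hM
  refine zariskiClosure_eq_hypersurface (linSubst_isHomogeneous _ igusaForm_isHomogeneous)
    (linSubst_isHomogeneous _ exceptionalForm_isHomogeneous) (by norm_num)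
    (linSubst_irreducible hM' irreducible_igusaForm)
    (mt (linSubst_dvd_linSubst_iff hM').1 not_igusaForm_dvd_exceptionalForm) ?_ ?_
  · rintro q ⟨p, hp, hpq⟩
    rwa [eval_linSubst, eval_igusaForm_eq_zero_iff hM hpq]
  · intro q hq hw
    rw [eval_linSubst] at hq hw
    obtain ⟨t, ht⟩ := exists_fibreEq hw
    have hp : PhiMaps (stdSystem M) (fibrePt hw ⟨t, ht⟩) q := by
      have hmem := Set.mem_range_self (f := fibrePt hw) ⟨t, ht⟩
      rwa [← setOf_phiMaps_eq_range_fibrePt hM hw] at hmem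
    exact ⟨_, (eval_igusaForm_eq_zero_iff hM hp).1 hq, hp⟩

/-! ## Projective changes of coordinates -/

/-- The projective transformation of `ℙ⁴` induced by an invertible matrix. -/
def projPerm {N : Matrix (Fin 5) (Fin 5) ℂ} (hN : IsUnit N.det) : Equiv.Perm P4 :=
  MulAction.toPerm (Matrix.toLinearEquiv (Pi.basisFun ℂ (Fin 5)) N hN)

lemma exists_mulVec_rep_eq_smul_rep_projPerm {N : Matrix (Fin 5) (Fin 5) ℂ} (hN : IsUnit N.det)
    (p : P4) : ∃ c : ℂ, c ≠ 0 ∧ N.mulVec p.rep = c • (projPerm hN p).rep := by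
  have hmap : Matrix.toLinearEquiv (Pi.basisFun ℂ (Fin 5)) N hN p.rep = N.mulVec p.rep := by
    rw [Matrix.toLinearEquiv_apply, Matrix.toLin_eq_toLin', Matrix.toLin'_apply]
  have hne : N.mulVec p.rep ≠ 0 := by
    rw [← hmap]
    exact (LinearEquiv.map_ne_zero_iff _).2 p.rep_nonzero
  have hp : projPerm hN p = Projectivization.mk ℂ (N.mulVec p.rep) hne := by
    conv_lhs => rw [← p.mk_rep]
    simp only [projPerm, MulAction.toPerm_apply, Projectivization.smul_mk, LinearEquiv.smul_def,
      hmap]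
  obtain ⟨c, hc, hrep⟩ := exists_rep_mk_eq_smul (K := ℂ) hne
  exact ⟨c⁻¹, inv_ne_zero hc, by rw [hp, hrep, inv_smul_smul₀ hc]⟩

lemma gradAt_smul {g : MvPolynomial (Fin 5) ℂ} {n : ℕ} (hg : g.IsHomogeneous n) (c : ℂ)
    (v : Fin 5 → ℂ) : gradAt g (c • v) = c ^ (n - 1) • gradAt g v :=
  funext fun _ => eval_smul_of_isHomogeneous hg.pderiv c v

lemma hessianAt_smul {σ : Type} {f : MvPolynomial σ ℂ} {n : ℕ} (hf : f.IsHomogeneous n) (c : ℂ)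
    (v : σ → ℂ) : hessianAt f (c • v) = c ^ (n - 1 - 1) • hessianAt f v :=
  Matrix.ext fun _ _ => eval_smul_of_isHomogeneous hf.pderiv.pderiv c v

lemma mem_singPts_iff_gradAt_eq_zero {g : MvPolynomial (Fin 5) ℂ} {p : P4} :
    p ∈ singPts g ↔ gradAt g p.rep = 0 :=
  funext_iff.symm

lemma singPts_linSubst {N : Matrix (Fin 5) (Fin 5) ℂ} (hN : IsUnit N.det)
    {g : MvPolynomial (Fin 5) ℂ} {n : ℕ} (hg : g.IsHomogeneous n) :
    singPts (linSubst N g) = projPerm hN ⁻¹' singPts g := by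
  ext p
  obtain ⟨c, hc, hp⟩ := exists_mulVec_rep_eq_smul_rep_projPerm hN p
  have hinj : Function.Injective N.transpose.mulVec :=
    Matrix.mulVec_injective_iff_isUnit.2 (by rwa [Matrix.isUnit_iff_isUnit_det,
      Matrix.det_transpose])
  rw [Set.mem_preimage, mem_singPts_iff_gradAt_eq_zero, mem_singPts_iff_gradAt_eq_zero,
    gradAt_linSubst, hp, gradAt_smul hg]
  nth_rw 1 [← N.transpose.mulVec_zero]
  rw [hinj.eq_iff, smul_eq_zero_iff_right (pow_ne_zero _ hc)]

lemma rank_hessianAt_linSubst {N : Matrix (Fin 5) (Fin 5) ℂ} (hN : IsUnit N.det)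
    {g : MvPolynomial (Fin 5) ℂ} {n : ℕ} (hg : g.IsHomogeneous n) (p : P4) :
    (hessianAt (linSubst N g) p.rep).rank = (hessianAt g (projPerm hN p).rep).rank := by
  obtain ⟨c, hc, hp⟩ := exists_mulVec_rep_eq_smul_rep_projPerm hN p
  have hNt : IsUnit N.transpose.det := by rwa [Matrix.det_transpose]
  rw [hessianAt_linSubst, Matrix.rank_mul_eq_left_of_isUnit_det _ _ hN,
    Matrix.rank_mul_eq_right_of_isUnit_det _ _ hNt, hp, hessianAt_smul hg,
    Matrix.rank_smul_of_mem_nonZeroDivisors _ (mem_nonZeroDivisors_of_ne_zero (pow_ne_zero _ hc))]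

lemma isSegrePrimal_linSubst {N : Matrix (Fin 5) (Fin 5) ℂ} (hN : IsUnit N.det)
    {g : MvPolynomial (Fin 5) ℂ} (hg : IsSegrePrimal g) : IsSegrePrimal (linSubst N g) := by
  obtain ⟨hg3, hcard, hnode⟩ := hg
  refine ⟨linSubst_isHomogeneous N hg3, ?_, fun p hp => ⟨hp, ?_⟩⟩
  · rw [singPts_linSubst hN hg3, ← hcard]
    exact Set.ncard_preimage_of_injective_subset_range (projPerm hN).injective
      (by simp [(projPerm hN).range_eq_univ])
  · rw [singPts_linSubst hN hg3] at hp
    rw [rank_hessianAt_linSubst hN hg3, (hnode _ hp).2]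

/-! ## Vectors with integer coordinates -/

/-- The complex vector with given integer coordinates. -/
def intVec {n : Type*} (v : n → ℤ) : n → ℂ := fun i => (v i : ℂ)

lemma intVec_ne_zero {n : Type*} {v : n → ℤ} (h : v ≠ 0) : intVec v ≠ 0 := fun h' =>
  h (funext fun i => Int.cast_injective ((congrFun h' i).trans Int.cast_zero.symm))

lemma mul_eq_mul_of_smul_intVec_eq {n : Type*} {v w : n → ℤ} {c : ℂ}
    (h : c • intVec v = intVec w) (i j : n) : v i * w j = v j * w i := by
  have hw (k : n) : (w k : ℂ) = c * v k := (congrFun h k).symm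
  have hcast : (v i * w j : ℂ) = v j * w i := by rw [hw, hw]; ring
  exact_mod_cast hcast

lemma rank_eq_of_mulVec_eq_zero {K : Type*} [Field K] {n : ℕ}
    {H : Matrix (Fin (n + 1)) (Fin (n + 1)) K} {v : Fin (n + 1) → K} (hv : v ≠ 0)
    (hker : H.mulVec v = 0) {i : Fin (n + 1)}
    (hminor : (H.submatrix i.succAbove i.succAbove).det ≠ 0) : H.rank = n := by
  refine le_antisymm ?_ ?_
  · have hnullity : 1 ≤ Module.finrank K (LinearMap.ker H.mulVecLin) :=
      Submodule.one_le_finrank_iff.2 ((Submodule.ne_bot_iff _).2 ⟨v, hker, hv⟩)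
    have hrank : H.rank + Module.finrank K (LinearMap.ker H.mulVecLin) = n + 1 := by
      rw [Matrix.rank, LinearMap.finrank_range_add_finrank_ker, Module.finrank_fin_fun]
    omega
  · calc n = (H.submatrix i.succAbove i.succAbove).rank := by
          rw [Matrix.rank_of_isUnit _ ((Matrix.isUnit_iff_isUnit_det _).2 hminor.isUnit),
            Fintype.card_fin]
      _ ≤ H.rank := H.rank_submatrix_le _ _

/-! ## The Segre cubic -/

/-- The Segre cubic `α₀ α₁ α₂ + β₀ β₁ β₂ = 0`, `α₀ + α₁ + α₂ + β₀ + β₁ + β₂ = 0`, in the coordinates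
`α₀, α₁, α₂, β₀, β₁`. -/
def segreForm : MvPolynomial (Fin 5) ℂ :=
  X 0 * X 1 * X 2 - X 3 * X 4 * (X 0 + X 1 + X 2 + X 3 + X 4)

lemma segreForm_isHomogeneous : segreForm.IsHomogeneous 3 := by
  have hX (i : Fin 5) := isHomogeneous_X ℂ i
  exact (((hX 0).mul (hX 1)).mul (hX 2)).sub
    (((hX 3).mul (hX 4)).mul (((((hX 0).add (hX 1)).add (hX 2)).add (hX 3)).add (hX 4)))

lemma eval_segreForm (v : Fin 5 → ℂ) : eval v segreForm =
    v 0 * v 1 * v 2 - v 3 * v 4 * (v 0 + v 1 + v 2 + v 3 + v 4) := by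
  simp [segreForm]

lemma gradAt_segreForm (v : Fin 5 → ℂ) : gradAt segreForm v =
    ![v 1 * v 2 - v 3 * v 4, v 0 * v 2 - v 3 * v 4, v 0 * v 1 - v 3 * v 4,
      -(v 4 * (v 0 + v 1 + v 2 + v 3 + v 4)) - v 3 * v 4,
      -(v 3 * (v 0 + v 1 + v 2 + v 3 + v 4)) - v 3 * v 4] := by
  ext i
  fin_cases i <;> simp [gradAt, segreForm, pderiv_X, Derivation.leibniz] <;> ring

/-- The Hessian matrix of the Segre cubic, over any ring so that it can be evaluated on integer
vectors. -/
def segreHess {R : Type*} [CommRing R] (v : Fin 5 → R) : Matrix (Fin 5) (Fin 5) R :=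
  !![0, v 2, v 1, -v 4, -v 3;
     v 2, 0, v 0, -v 4, -v 3;
     v 1, v 0, 0, -v 4, -v 3;
     -v 4, -v 4, -v 4, -2 * v 4, -(v 0 + v 1 + v 2 + 2 * v 3 + 2 * v 4);
     -v 3, -v 3, -v 3, -(v 0 + v 1 + v 2 + 2 * v 3 + 2 * v 4), -2 * v 3]

lemma hessianAt_segreForm (v : Fin 5 → ℂ) : hessianAt segreForm v = segreHess v := by
  ext i j
  fin_cases i <;> fin_cases j <;>
    simp [hessianAt, segreHess, segreForm, pderiv_X, Pi.single_apply, Derivation.leibniz] <;> ring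

lemma segreHess_intVec (v : Fin 5 → ℤ) :
    segreHess (intVec v) = (segreHess v).map (Int.castRingHom ℂ) := by
  ext i j
  fin_cases i <;> fin_cases j <;> simp [segreHess, intVec]

/-- The ten nodes of the Segre cubic: the point `α = (1, 1, 1)`, `β = (-1, -1, -1)`, and the nine
points at which `α` and `-β` are coordinate vectors. -/
def segreNode : Fin 10 → Fin 5 → ℤ :=
  ![![1, 1, 1, -1, -1],
    ![1, 0, 0, -1, 0], ![1, 0, 0, 0, -1], ![1, 0, 0, 0, 0],
    ![0, 1, 0, -1, 0], ![0, 1, 0, 0, -1], ![0, 1, 0, 0, 0],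
    ![0, 0, 1, -1, 0], ![0, 0, 1, 0, -1], ![0, 0, 1, 0, 0]]

lemma segreNode_ne_zero (k : Fin 10) : segreNode k ≠ 0 := by
  revert k
  decide

lemma exists_segreNode_mul_ne {k l : Fin 10} (h : k ≠ l) :
    ∃ i j, segreNode k i * segreNode l j ≠ segreNode k j * segreNode l i := by
  revert k l
  decide

lemma gradAt_segreNode (k : Fin 10) : gradAt segreForm (intVec (segreNode k)) = 0 := by
  rw [gradAt_segreForm]
  ext i
  fin_cases k <;> fin_cases i <;> simp [segreNode, intVec]

lemma rank_segreHess_segreNode (k : Fin 10) :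
    (segreHess (intVec (segreNode k))).rank = 4 := by
  have hker : (segreHess (segreNode k)).mulVec (segreNode k) = 0 := by
    revert k
    decide
  have hminor : ∃ i : Fin 5,
      ((segreHess (segreNode k)).submatrix i.succAbove i.succAbove).det ≠ 0 := by
    revert k
    decide +kernel
  obtain ⟨i, hi⟩ := hminor
  refine rank_eq_of_mulVec_eq_zero (intVec_ne_zero (segreNode_ne_zero k)) (i := i) ?_ ?_
  · rw [segreHess_intVec]
    ext j
    exact (RingHom.map_mulVec (Int.castRingHom ℂ) _ _ j).symm.trans
      ((congrArg _ (congrFun hker j)).trans (map_zero _))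
  · rw [segreHess_intVec, Matrix.submatrix_map, ← RingHom.mapMatrix_apply, ← RingHom.map_det]
    exact Int.cast_ne_zero.2 hi

lemma two_eq_zero_of_mul_eq_zero {R : Type*} [MulZeroClass R] [NoZeroDivisors R] {p q r : R}
    (hpq : p * q = 0) (hpr : p * r = 0) (hqr : q * r = 0) :
    (q = 0 ∧ r = 0) ∨ (p = 0 ∧ r = 0) ∨ (p = 0 ∧ q = 0) := by
  rw [mul_eq_zero] at hpq hpr hqr
  tauto

lemma exists_segreNode_of_mul_eq_zero {a b c d e : ℂ} (hab : a * b = 0) (hac : a * c = 0)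
    (hbc : b * c = 0) (hde : d * e = 0) (hdf : d * (a + b + c + d + e) = 0)
    (hef : e * (a + b + c + d + e) = 0) :
    ∃ (k : Fin 10) (s : ℂ), ![a, b, c, d, e] = s • intVec (segreNode k) := by
  rcases two_eq_zero_of_mul_eq_zero hab hac hbc with ⟨rfl, rfl⟩ | ⟨rfl, rfl⟩ | ⟨rfl, rfl⟩ <;>
    rcases two_eq_zero_of_mul_eq_zero hde hdf hef with ⟨rfl, h⟩ | ⟨rfl, h⟩ | ⟨rfl, rfl⟩
  · exact ⟨1, a, by ext i; fin_cases i <;> simp [segreNode, intVec]; linear_combination h⟩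
  · exact ⟨2, a, by ext i; fin_cases i <;> simp [segreNode, intVec]; linear_combination h⟩
  · exact ⟨3, a, by ext i; fin_cases i <;> simp [segreNode, intVec]⟩
  · exact ⟨4, b, by ext i; fin_cases i <;> simp [segreNode, intVec]; linear_combination h⟩
  · exact ⟨5, b, by ext i; fin_cases i <;> simp [segreNode, intVec]; linear_combination h⟩
  · exact ⟨6, b, by ext i; fin_cases i <;> simp [segreNode, intVec]⟩
  · exact ⟨7, c, by ext i; fin_cases i <;> simp [segreNode, intVec]; linear_combination h⟩
  · exact ⟨8, c, by ext i; fin_cases i <;> simp [segreNode, intVec]; linear_combination h⟩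
  · exact ⟨9, c, by ext i; fin_cases i <;> simp [segreNode, intVec]⟩

lemma exists_segreNode_of_gradAt_eq_zero {v : Fin 5 → ℂ} (hv : gradAt segreForm v = 0) :
    ∃ (k : Fin 10) (s : ℂ), v = s • intVec (segreNode k) := by
  obtain ⟨a, b, c, d, e, rfl⟩ : ∃ a b c d e, v = ![a, b, c, d, e] :=
    ⟨_, _, _, _, _, (FinVec.etaExpand_eq v).symm⟩
  rw [gradAt_segreForm] at hv
  have h0 : b * c - d * e = 0 := congrFun hv 0
  have h1 : a * c - d * e = 0 := congrFun hv 1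
  have h2 : a * b - d * e = 0 := congrFun hv 2
  have h3 : -(e * (a + b + c + d + e)) - d * e = 0 := congrFun hv 3
  have h4 : -(d * (a + b + c + d + e)) - d * e = 0 := congrFun hv 4
  by_cases hde : d * e = 0
  · rw [hde, sub_zero] at h0 h1 h2 h3 h4
    exact exists_segreNode_of_mul_eq_zero h2 h1 h0 hde (neg_eq_zero.1 h4) (neg_eq_zero.1 h3)
  · obtain ⟨hd, he⟩ := mul_ne_zero_iff.1 hde
    obtain ⟨hb, hc⟩ := mul_ne_zero_iff.1 fun hbc : b * c = 0 => hde (by linear_combination hbc - h0)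
    obtain rfl : a = b := mul_right_cancel₀ hc (by linear_combination h1 - h0)
    obtain rfl : a = c := mul_right_cancel₀ hb (by linear_combination h2 - h0)
    have hf3 : -(a + a + a + d + e) = d := mul_left_cancel₀ he (by linear_combination h3)
    have hf4 : -(a + a + a + d + e) = e := mul_left_cancel₀ hd (by linear_combination h4)
    refine ⟨0, a, ?_⟩
    ext i
    fin_cases i <;> simp [segreNode, intVec]
    · linear_combination -(2 / 3 : ℂ) * hf3 + (1 / 3 : ℂ) * hf4
    · linear_combination (1 / 3 : ℂ) * hf3 - (2 / 3 : ℂ) * hf4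

/-- The nodes of the Segre cubic as points of `ℙ⁴`. -/
def segreNodePt (k : Fin 10) : P4 :=
  Projectivization.mk ℂ _ (intVec_ne_zero (segreNode_ne_zero k))

lemma segreNodePt_injective : Function.Injective segreNodePt := by
  intro k l hkl
  by_contra hne
  obtain ⟨c, hc⟩ := (Projectivization.mk_eq_mk_iff' _ _ _ _ _).1 hkl
  obtain ⟨i, j, hij⟩ := exists_segreNode_mul_ne (Ne.symm hne)
  exact hij (mul_eq_mul_of_smul_intVec_eq hc i j)

lemma singPts_segreForm : singPts segreForm = Set.range segreNodePt := by
  ext p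
  rw [mem_singPts_iff_gradAt_eq_zero]
  constructor
  · intro h
    obtain ⟨k, s, hs⟩ := exists_segreNode_of_gradAt_eq_zero h
    exact ⟨k, mk_eq_of_smul_eq_smul_rep _
      (fun h0 => p.rep_nonzero (by rw [hs, h0, zero_smul])) (hs.symm.trans (one_smul ℂ _).symm)⟩
  · rintro ⟨k, rfl⟩
    obtain ⟨c, -, hrep⟩ := exists_rep_mk_eq_smul (K := ℂ) (intVec_ne_zero (segreNode_ne_zero k))
    rw [segreNodePt, hrep, gradAt_smul segreForm_isHomogeneous, gradAt_segreNode, smul_zero]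

lemma isSegrePrimal_segreForm : IsSegrePrimal segreForm := by
  refine ⟨segreForm_isHomogeneous, ?_, fun p hp => ⟨hp, ?_⟩⟩
  · rw [singPts_segreForm, Set.ncard_range_of_injective segreNodePt_injective, Nat.card_fin]
  · rw [singPts_segreForm] at hp
    obtain ⟨k, rfl⟩ := hp
    obtain ⟨c, hc, hrep⟩ := exists_rep_mk_eq_smul (K := ℂ) (intVec_ne_zero (segreNode_ne_zero k))
    rw [segreNodePt, hrep, hessianAt_smul segreForm_isHomogeneous,
      Matrix.rank_smul_of_mem_nonZeroDivisors _
        (mem_nonZeroDivisors_of_ne_zero (pow_ne_zero _ hc)),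
      hessianAt_segreForm, rank_segreHess_segreNode]

/-! ## The dual of the Segre cubic -/

lemma eval_gradAt_igusaForm {v : Fin 5 → ℂ} (hv : eval v segreForm = 0) :
    eval (gradAt segreForm v) igusaForm = 0 := by
  rw [eval_segreForm] at hv
  rw [eval_igusaForm, gradAt_segreForm]
  simp
  linear_combination ((v 0 * v 1 * v 2 - v 3 * v 4 * (v 0 + v 1 + v 2 + v 3 + v 4)) *
    (v 0 + v 1 + v 2) ^ 2 - 4 * (v 0 * v 1 + v 0 * v 2 + v 1 * v 2 -
      (v 3 * v 4 - (v 3 + v 4) * (v 0 + v 1 + v 2 + v 3 + v 4))) *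
    (v 0 * v 1 * v 2 + v 3 * v 4 * (v 0 + v 1 + v 2 + v 3 + v 4))) * hv

/-- A double root of the fibre equation of `w`: besides the equation itself, its derivative
vanishes. -/
def IsDoubleFibreRoot {R : Type*} [CommRing R] (w : Fin 5 → R) (t : R) : Prop :=
  FibreEq w t ∧ (w 0 + t) * (w 1 + t) + (w 0 + t) * (w 2 + t) + (w 1 + t) * (w 2 + t) =
    (w 3 + t) * (w 4 + t) + (w 3 + t) * t + (w 4 + t) * t

lemma exists_isDoubleFibreRoot {w : Fin 5 → ℂ} (hw : eval w exceptionalForm ≠ 0)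
    (h : eval w igusaForm = 0) : ∃ t, IsDoubleFibreRoot w t := by
  have hlead : w 0 + w 1 + w 2 - w 3 - w 4 ≠ 0 := by
    rw [eval_exceptionalForm] at hw
    intro h0
    simp [h0] at hw
  have hroot : 2 * (w 0 + w 1 + w 2 - w 3 - w 4) * (-(w 0 * w 1 + w 0 * w 2 + w 1 * w 2 -
      w 3 * w 4) / (2 * (w 0 + w 1 + w 2 - w 3 - w 4))) +
      (w 0 * w 1 + w 0 * w 2 + w 1 * w 2 - w 3 * w 4) = 0 := by
    field_simp
    ring
  generalize -(w 0 * w 1 + w 0 * w 2 + w 1 * w 2 - w 3 * w 4) /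
    (2 * (w 0 + w 1 + w 2 - w 3 - w 4)) = t at hroot
  refine ⟨t, ?_, by linear_combination hroot⟩
  rw [eval_igusaForm] at h
  rw [fibreEq_iff_quadratic_eq_zero]
  apply mul_left_cancel₀ (mul_ne_zero (show (4 : ℂ) ≠ 0 by norm_num) hlead)
  linear_combination (2 * (w 0 + w 1 + w 2 - w 3 - w 4) * t +
    (w 0 * w 1 + w 0 * w 2 + w 1 * w 2 - w 3 * w 4)) * hroot - h

/-- The point of the Segre cubic at which the tangent hyperplane is `w`, if `t` is a double root of
the fibre equation of `w`: up to a factor, its coordinates `αᵢ` and `βⱼ` are the inverses of the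
factors of the two sides of that equation. -/
def contactPt {R : Type*} [CommRing R] (w : Fin 5 → R) (t : R) : Fin 5 → R :=
  ![(w 1 + t) * (w 2 + t), (w 0 + t) * (w 2 + t), (w 0 + t) * (w 1 + t),
    -((w 4 + t) * t), -((w 3 + t) * t)]

lemma IsDoubleFibreRoot.sum_contactPt {R : Type*} [CommRing R] {w : Fin 5 → R} {t : R}
    (h : IsDoubleFibreRoot w t) : contactPt w t 0 + contactPt w t 1 + contactPt w t 2 +
      contactPt w t 3 + contactPt w t 4 = (w 3 + t) * (w 4 + t) := by
  simp [contactPt]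
  linear_combination h.2

lemma IsDoubleFibreRoot.eval_contactPt {w : Fin 5 → ℂ} {t : ℂ} (h : IsDoubleFibreRoot w t) :
    eval (contactPt w t) segreForm = 0 := by
  have hF := h.1
  unfold FibreEq at hF
  rw [eval_segreForm, h.sum_contactPt]
  simp [contactPt]
  linear_combination ((w 0 + t) * (w 1 + t) * (w 2 + t) + (w 3 + t) * (w 4 + t) * t) * hF

lemma IsDoubleFibreRoot.gradAt_contactPt {w : Fin 5 → ℂ} {t : ℂ} (h : IsDoubleFibreRoot w t) :
    gradAt segreForm (contactPt w t) = ((w 3 + t) * (w 4 + t) * t) • w := by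
  have hF := h.1
  unfold FibreEq at hF
  rw [gradAt_segreForm, h.sum_contactPt]
  ext i
  fin_cases i <;> simp [contactPt]
  · linear_combination (w 0 + t) * hF
  · linear_combination (w 1 + t) * hF
  · linear_combination (w 2 + t) * hF
  · ring
  · ring

lemma exists_gradAt_eq_smul {w : Fin 5 → ℂ} (hw : eval w exceptionalForm ≠ 0)
    (h : eval w igusaForm = 0) :
    ∃ (v : Fin 5 → ℂ) (c : ℂ), eval v segreForm = 0 ∧ c ≠ 0 ∧ gradAt segreForm v = c • w := by
  obtain ⟨t, ht⟩ := exists_isDoubleFibreRoot hw h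
  obtain ⟨-, -, -, h3, h4, ht0⟩ := ht.1.ne_zero hw
  exact ⟨contactPt w t, (w 3 + t) * (w 4 + t) * t, ht.eval_contactPt,
    mul_ne_zero (mul_ne_zero h3 h4) ht0, ht.gradAt_contactPt⟩

lemma exists_gradAt_linSubst_segreForm_eq_smul {M : Matrix (Fin 5) (Fin 5) ℂ}
    (hM : IsUnit M.det) {q : Fin 5 → ℂ} (hw : eval (M⁻¹.mulVec q) exceptionalForm ≠ 0)
    (h : eval (M⁻¹.mulVec q) igusaForm = 0) :
    ∃ (v : Fin 5 → ℂ) (c : ℂ), eval v (linSubst M.transpose segreForm) = 0 ∧ c ≠ 0 ∧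
      gradAt (linSubst M.transpose segreForm) v = c • q := by
  have hMt : IsUnit M.transpose.det := by rwa [Matrix.det_transpose]
  obtain ⟨v, c, hv, hc, hgrad⟩ := exists_gradAt_eq_smul hw h
  have hcancel : M.transpose.mulVec (M.transpose⁻¹.mulVec v) = v := by
    rw [Matrix.mulVec_mulVec, Matrix.mul_nonsing_inv _ hMt, Matrix.one_mulVec]
  refine ⟨M.transpose⁻¹.mulVec v, c, by rw [eval_linSubst, hcancel, hv], hc, ?_⟩
  rw [gradAt_linSubst, hcancel, hgrad, Matrix.transpose_transpose, Matrix.mulVec_smul,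
    Matrix.mulVec_mulVec, Matrix.mul_nonsing_inv _ hM, Matrix.one_mulVec]

lemma mem_tangentHyperplanes {g : MvPolynomial (Fin 5) ℂ} {n : ℕ} (hg : g.IsHomogeneous n)
    (hn : 2 ≤ n) {q : P4} {v : Fin 5 → ℂ} {c : ℂ} (hv : eval v g = 0) (hc : c ≠ 0)
    (hgrad : gradAt g v = c • q.rep) :
    ∃ p : P4, eval p.rep g = 0 ∧
      ∃ h : gradAt g p.rep ≠ 0, Projectivization.mk ℂ (gradAt g p.rep) h = q := by
  have hgrad0 : gradAt g v ≠ 0 := hgrad ▸ smul_ne_zero hc q.rep_nonzero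
  have hv0 : v ≠ 0 := by
    rintro rfl
    have hzero := gradAt_smul hg 0 0
    rw [zero_smul, zero_pow (by omega), zero_smul] at hzero
    exact hgrad0 hzero
  obtain ⟨d, hd, hrep⟩ := exists_rep_mk_eq_smul (K := ℂ) hv0
  have hgrad' : gradAt g (Projectivization.mk ℂ v hv0).rep = d ^ (n - 1) • gradAt g v := by
    rw [hrep, gradAt_smul hg]
  refine ⟨Projectivization.mk ℂ v hv0, (eval_rep_mk_eq_zero_iff hg hv0).2 hv, ?_, ?_⟩
  · rw [hgrad']
    exact smul_ne_zero (pow_ne_zero _ hd) hgrad0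
  · exact mk_eq_of_smul_eq_smul_rep _ one_ne_zero
      (by rw [one_smul, hgrad', hgrad, smul_smul])

lemma dualVariety_linSubst_segreForm {M : Matrix (Fin 5) (Fin 5) ℂ} (hM : IsUnit M.det) :
    dualVariety (linSubst M.transpose segreForm) =
      {q | eval q.rep (linSubst M⁻¹ igusaForm) = 0} := by
  have hM' : IsUnit (M⁻¹).det := Matrix.isUnit_nonsing_inv_det M hM
  refine zariskiClosure_eq_hypersurface (linSubst_isHomogeneous _ igusaForm_isHomogeneous)
    (linSubst_isHomogeneous _ exceptionalForm_isHomogeneous) (by norm_num)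
    (linSubst_irreducible hM' irreducible_igusaForm)
    (mt (linSubst_dvd_linSubst_iff hM').1 not_igusaForm_dvd_exceptionalForm) ?_ ?_
  · rintro q ⟨p, hp, h, rfl⟩
    rw [eval_linSubst] at hp
    rw [eval_rep_mk_eq_zero_iff (linSubst_isHomogeneous _ igusaForm_isHomogeneous), eval_linSubst,
      gradAt_linSubst, Matrix.mulVec_mulVec, Matrix.transpose_transpose,
      Matrix.nonsing_inv_mul M hM, Matrix.one_mulVec]
    exact eval_gradAt_igusaForm hp
  · intro q hq hw
    rw [eval_linSubst] at hq hw
    obtain ⟨v, c, hv, hc, hgrad⟩ := exists_gradAt_linSubst_segreForm_eq_smul hM hw hq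
    exact mem_tangentHyperplanes (linSubst_isHomogeneous _ segreForm_isHomogeneous) (by norm_num)
      hv hc hgrad

lemma isIgusaQuartic_imageOfHypersurface {M : Matrix (Fin 5) (Fin 5) ℂ} (hM : IsUnit M.det) :
    IsIgusaQuartic (imageOfHypersurface (stdSystem M) vRam) := by
  rw [imageOfHypersurface_stdSystem_vRam hM]
  exact ⟨⟨linSubst M⁻¹ igusaForm, linSubst_isHomogeneous _ igusaForm_isHomogeneous,
    linSubst_irreducible (Matrix.isUnit_nonsing_inv_det M hM) irreducible_igusaForm, rfl⟩,
    linSubst M.transpose segreForm,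
    isSegrePrimal_linSubst (by rwa [Matrix.det_transpose]) isSegrePrimal_segreForm,
    (dualVariety_linSubst_segreForm hM).symm⟩

/-! ## The ramification divisor -/

lemma det_fromBlocks_mul_pow {n R : Type*} [Fintype n] [DecidableEq n] [CommRing R] (a : R)
    (r c : n → R) (D : Matrix n n R) :
    (Matrix.fromBlocks (a • 1) (Matrix.replicateRow Unit r) (Matrix.replicateCol Unit c) D).det *
      a ^ Fintype.card n = a * (a • D - Matrix.vecMulVec c r).det := by
  have hmul :
      Matrix.fromBlocks (a • 1) (Matrix.replicateRow Unit r) (Matrix.replicateCol Unit c) D *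
        Matrix.fromBlocks 1 (-Matrix.replicateRow Unit r) 0 (a • 1) =
      Matrix.fromBlocks (a • 1) 0 (Matrix.replicateCol Unit c) (a • D - Matrix.vecMulVec c r) := by
    rw [Matrix.fromBlocks_multiply, Matrix.vecMulVec_eq Unit]
    congr 1 <;> simp [neg_add_eq_sub]
  simpa [Matrix.det_fromBlocks_zero₁₂, Matrix.det_fromBlocks_zero₂₁] using
    congrArg Matrix.det hmul

lemma derivation_stdVec {R A : Type*} [CommRing R] [CommRing A] [Algebra R A]
    (D : Derivation R A A) (x y : Fin 3 → A) (k : Fin 5) :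
    D (stdVec x y k) = stdVec (D ∘ x) y k + stdVec x (D ∘ y) k := by
  fin_cases k <;> simp [stdVec] <;> ring

lemma aeval_vRam {A : Type*} [CommRing A] [Algebra ℂ A] (x y : Fin 3 → A) :
    aeval (Sum.elim x y) vRam =
      (x 0 - x 1) * x 2 * (y 0 * (y 1 - y 2)) - x 0 * (x 1 - x 2) * ((y 0 - y 1) * y 2) := by
  simp [vRam]

lemma stdVec_zero_left {A : Type*} [CommRing A] (y : Fin 3 → A) : stdVec 0 y = 0 := by
  ext k
  fin_cases k <;> simp [stdVec]

lemma stdVec_zero_right {A : Type*} [CommRing A] (x : Fin 3 → A) : stdVec x 0 = 0 := by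
  ext k
  fin_cases k <;> simp [stdVec]

lemma det_stdVec {A : Type*} [CommRing A] [Algebra ℂ A] (x a b y c d : Fin 3 → A) :
    (Matrix.of ![stdVec x y, stdVec a y, stdVec b y, stdVec x c, stdVec x d]).det =
      (Matrix.of ![x, a, b]).det * (Matrix.of ![y, c, d]).det *
        aeval (Sum.elim x y) vRam := by
  rw [aeval_vRam, Matrix.det_fin_three, Matrix.det_fin_three]
  simp [Matrix.det_succ_row_zero, Fin.sum_univ_succ, stdVec, Fin.succAbove]
  ring

/-- The `1`-jets of polynomial functions on an affine space: each column consists of a function and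
its partial derivatives. -/
def jetMatrix {ι τ : Type*} (β : ι → MvPolynomial τ ℂ) :
    Matrix (Unit ⊕ τ) ι (MvPolynomial τ ℂ) :=
  Matrix.of fun m l => m.elim (fun _ => β l) fun m => pderiv m (β l)

lemma jetMatrix_mulVec {ι κ τ : Type*} [Fintype ι] (β : ι → MvPolynomial τ ℂ)
    (M : Matrix κ ι ℂ) :
    jetMatrix ((M.map C).mulVec β) =
      jetMatrix β * M.transpose.map (C : ℂ →+* MvPolynomial τ ℂ) := by
  ext1 m k
  rw [Matrix.mul_apply]
  rcases m with _ | m <;> simp [jetMatrix, Matrix.mulVec, dotProduct, mul_comm]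

/-- The indices of five forms, starting with `k` and followed by the others in increasing order. -/
def indexEquiv (k : Fin 5) : Unit ⊕ (Fin 2 ⊕ Fin 2) ≃ Fin 5 :=
  (Equiv.sumComm _ _).trans
    ((Equiv.optionEquivSumPUnit _).symm.trans
      ((Equiv.optionCongr finSumFinEquiv).trans (finSuccEquiv' k).symm))

lemma indexEquiv_inl (k : Fin 5) (u : Unit) : indexEquiv k (Sum.inl u) = k := by
  simp [indexEquiv]

lemma indexEquiv_inr (k : Fin 5) (l : Fin 2 ⊕ Fin 2) :
    indexEquiv k (Sum.inr l) = k.succAbove (finSumFinEquiv l) := by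
  simp [indexEquiv]

lemma det_jetMatrix_mul_pow (b : Fin 5 → BiPoly) (i j : Fin 3) (k : Fin 5) :
    ((jetMatrix (dehom i j ∘ b)).submatrix id (indexEquiv k)).det * dehom i j (b k) ^ 4 =
      dehom i j (b k) * jacobianNumerator b i j k := by
  set r : Fin 2 ⊕ Fin 2 → MvPolynomial (Fin 2 ⊕ Fin 2) ℂ :=
    fun l => dehom i j (b (k.succAbove (finSumFinEquiv l))) with hr
  have hblocks : (jetMatrix (dehom i j ∘ b)).submatrix id (indexEquiv k) =
      Matrix.fromBlocks (dehom i j (b k) • 1) (Matrix.replicateRow Unit r)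
        (Matrix.replicateCol Unit fun m => pderiv m (dehom i j (b k)))
        (Matrix.of fun m l => pderiv m (r l)) := by
    ext1 (_ | m) (_ | l) <;> simp [jetMatrix, indexEquiv_inl, indexEquiv_inr, hr]
  have hjac : jacobianNumerator b i j k =
      (dehom i j (b k) • (Matrix.of fun m l => pderiv m (r l)) -
        Matrix.vecMulVec (fun m => pderiv m (dehom i j (b k))) r).det := by
    refine congrArg Matrix.det (Matrix.ext fun m l => ?_)
    simp only [Matrix.of_apply, Matrix.sub_apply, Matrix.smul_apply, Matrix.vecMulVec_apply,
      smul_eq_mul, hr]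
    ring
  rw [hblocks, hjac, ← det_fromBlocks_mul_pow, Fintype.card_sum, Fintype.card_fin]

/-- The point with affine coordinates `u` in the chart `xᵢ = 1` of `ℙ²`. -/
def chartPt {A : Type*} [CommRing A] (i : Fin 3) (u : Fin 2 → A) : Fin 3 → A :=
  i.insertNth (α := fun _ => A) 1 u

lemma dehom_eq_aeval_chartPt (i j : Fin 3) : dehom i j =
    aeval (Sum.elim (chartPt i (X ∘ Sum.inl)) (chartPt j (X ∘ Sum.inr))) := rfl

lemma pderiv_comp_chartPt {σ : Type*} {e : Fin 2 → σ} (he : e.Injective)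
    (i : Fin 3) (m : Fin 2) :
    pderiv (e m) ∘ chartPt i (X ∘ e) =
      (Pi.single (i.succAbove m) 1 : Fin 3 → MvPolynomial σ ℂ) := by
  classical
  ext1 k
  refine Fin.succAboveCases i ?_ (fun l => ?_) k <;>
    simp [chartPt, pderiv_X, Pi.single_apply, he.eq_iff]

lemma pderiv_comp_chartPt_of_notMem_range {σ : Type*} {s : σ} {e : Fin 2 → σ}
    (hs : s ∉ Set.range e) (i : Fin 3) :
    pderiv s ∘ chartPt i (X ∘ e) = (0 : Fin 3 → MvPolynomial σ ℂ) := by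
  classical
  ext1 k
  refine Fin.succAboveCases i ?_ (fun l => ?_) k
  · simp [chartPt]
  · simp [chartPt, pderiv_X_of_ne (ne_of_mem_of_not_mem (Set.mem_range_self l) hs)]

lemma det_chartPt {A : Type*} [CommRing A] (i : Fin 3) (u : Fin 2 → A) :
    (Matrix.of ![chartPt i u, Pi.single (i.succAbove 0) 1, Pi.single (i.succAbove 1) 1]).det =
      (-1) ^ (i : ℕ) := by
  fin_cases i <;> simp [Matrix.det_fin_three, chartPt, Fin.succAbove]

lemma dehom_stdForms (i j : Fin 3) (k : Fin 5) : dehom i j (stdForms k) =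
    stdVec (chartPt i (X ∘ Sum.inl)) (chartPt j (X ∘ Sum.inr)) k := by
  rw [stdForms, ← AlgHom.coe_toRingHom, map_stdVec, dehom_eq_aeval_chartPt]
  congr 1 <;> ext <;> simp

lemma pderiv_inl_dehom_stdForms (i j : Fin 3) (m : Fin 2) (k : Fin 5) :
    pderiv (Sum.inl m) (dehom i j (stdForms k)) =
      stdVec (Pi.single (i.succAbove m) 1) (chartPt j (X ∘ Sum.inr)) k := by
  rw [dehom_stdForms, derivation_stdVec, pderiv_comp_chartPt Sum.inl_injective,
    pderiv_comp_chartPt_of_notMem_range (by simp), stdVec_zero_right, Pi.zero_apply, add_zero]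

lemma pderiv_inr_dehom_stdForms (i j : Fin 3) (m : Fin 2) (k : Fin 5) :
    pderiv (Sum.inr m) (dehom i j (stdForms k)) =
      stdVec (chartPt i (X ∘ Sum.inl)) (Pi.single (j.succAbove m) 1) k := by
  rw [dehom_stdForms, derivation_stdVec, pderiv_comp_chartPt_of_notMem_range (by simp),
    pderiv_comp_chartPt Sum.inr_injective, stdVec_zero_left, Pi.zero_apply, zero_add]

lemma det_jetMatrix_stdForms (i j : Fin 3) :
    ((jetMatrix (dehom i j ∘ stdForms)).submatrix id (indexEquiv 0)).det =
      (-1) ^ (i : ℕ) * (-1) ^ (j : ℕ) * dehom i j vRam := by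
  rw [← Matrix.det_submatrix_equiv_self (indexEquiv 0).symm, ← det_chartPt i (X ∘ Sum.inl),
    ← det_chartPt j (X ∘ Sum.inr), dehom_eq_aeval_chartPt, ← det_stdVec,
    ← dehom_eq_aeval_chartPt]
  congr 1
  ext1 k l
  rw [Matrix.submatrix_submatrix, Matrix.submatrix_apply, Function.comp_apply,
    Equiv.self_comp_symm]
  fin_cases k
  · exact dehom_stdForms i j l
  · exact pderiv_inl_dehom_stdForms i j 0 l
  · exact pderiv_inl_dehom_stdForms i j 1 l
  · exact pderiv_inr_dehom_stdForms i j 0 l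
  · exact pderiv_inr_dehom_stdForms i j 1 l

lemma associated_det_jetMatrix_stdSystem {M : Matrix (Fin 5) (Fin 5) ℂ} (hM : IsUnit M.det)
    (i j : Fin 3) (k : Fin 5) :
    Associated ((jetMatrix (dehom i j ∘ stdSystem M)).submatrix id (indexEquiv k)).det
      (dehom i j vRam) := by
  have hlin : dehom i j ∘ stdSystem M = (M.map C).mulVec (dehom i j ∘ stdForms) := by
    ext1 k
    simp [stdSystem, Matrix.mulVec, dotProduct, dehom, algHom_C]
  have hMC : IsUnit ((M.transpose.map (C : ℂ →+* MvPolynomial (Fin 2 ⊕ Fin 2) ℂ)).submatrix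
      (indexEquiv 0) (indexEquiv k)).det := by
    rw [← Matrix.isUnit_iff_isUnit_det, Matrix.isUnit_submatrix_equiv,
      Matrix.isUnit_iff_isUnit_det]
    have hdet := hM.map (C : ℂ →+* MvPolynomial (Fin 2 ⊕ Fin 2) ℂ)
    rwa [← Matrix.det_transpose, RingHom.map_det] at hdet
  rw [hlin, jetMatrix_mulVec, ← Matrix.submatrix_mul_equiv _ _ _ (indexEquiv 0), Matrix.det_mul,
    det_jetMatrix_stdForms]
  refine (associated_mul_unit_left _ _ hMC).trans (associated_unit_mul_left _ _ ?_)
  exact (isUnit_one.neg.pow _).mul (isUnit_one.neg.pow _)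

lemma isRamificationDivisor_stdSystem_vRam {M : Matrix (Fin 5) (Fin 5) ℂ} (hM : IsUnit M.det) :
    IsRamificationDivisor (stdSystem M) vRam := by
  refine ⟨fun h => ?_, fun i j k => ?_⟩
  · have hval := eval_vRam ![1, 0, 1] ![1, 1, 0]
    simp [h] at hval
  set β := dehom i j (stdSystem M k)
  set ρ := algebraMap (MvPolynomial (Fin 2 ⊕ Fin 2) ℂ) (Localization.Away β)
  have hβ : IsUnit (ρ β) := IsLocalization.Away.algebraMap_isUnit β
  have hdet := congrArg ρ (det_jetMatrix_mul_pow (stdSystem M) i j k)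
  rw [map_mul ρ, map_mul ρ, map_pow] at hdet
  refine (associated_unit_mul_left _ _ hβ).symm.trans ?_
  rw [← hdet]
  exact (associated_mul_unit_left _ _ (hβ.pow 4)).trans
    ((associated_det_jetMatrix_stdSystem hM i j k).map ρ)

/-! ## The singular points of the threefold -/

section Pencil

variable {R : Type*} [CommRing R]

/-- The conic `(x₀ - x₁) x₂`. Together with `conicB` it spans the pencil of conics through the base
points `basePt`, and the equation of `vRam` is `A(x) B(y) - B(x) A(y)`. -/
def conicA (x : Fin 3 → R) : R := (x 0 - x 1) * x 2

/-- The conic `x₀ (x₁ - x₂)`. -/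
def conicB (x : Fin 3 → R) : R := x 0 * (x 1 - x 2)

/-- The gradient of `conicA`. -/
def gradConicA (x : Fin 3 → R) : Fin 3 → R := ![x 2, -x 2, x 0 - x 1]

/-- The gradient of `conicB`. -/
def gradConicB (x : Fin 3 → R) : Fin 3 → R := ![x 1 - x 2, x 0, -x 0]

/-- The partial derivatives of `vRam` in `x`. -/
def vRamGradX (x y : Fin 3 → R) : Fin 3 → R :=
  conicB y • gradConicA x - conicA y • gradConicB x

/-- The partial derivatives of `vRam` in `y`. -/
def vRamGradY (x y : Fin 3 → R) : Fin 3 → R :=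
  conicA x • gradConicB y - conicB x • gradConicA y

/-- The Hessian matrix of `vRam`. -/
def vRamHess (x y : Fin 3 → R) : Matrix (Fin 3 ⊕ Fin 3) (Fin 3 ⊕ Fin 3) R :=
  Matrix.fromBlocks
    (conicB y • !![0, 0, 1; 0, 0, -1; 1, -1, 0] - conicA y • !![0, 1, -1; 1, 0, 0; -1, 0, 0])
    (Matrix.vecMulVec (gradConicA x) (gradConicB y) -
      Matrix.vecMulVec (gradConicB x) (gradConicA y))
    (Matrix.vecMulVec (gradConicB y) (gradConicA x) -
      Matrix.vecMulVec (gradConicA y) (gradConicB x))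
    (conicA x • !![0, 1, -1; 1, 0, 0; -1, 0, 0] - conicB x • !![0, 0, 1; 0, 0, -1; 1, -1, 0])

lemma conicA_smul (c : R) (x : Fin 3 → R) : conicA (c • x) = c ^ 2 * conicA x := by
  simp only [conicA, Pi.smul_apply, smul_eq_mul]
  ring

lemma conicB_smul (c : R) (x : Fin 3 → R) : conicB (c • x) = c ^ 2 * conicB x := by
  simp only [conicB, Pi.smul_apply, smul_eq_mul]
  ring

lemma gradConicA_smul (c : R) (x : Fin 3 → R) : gradConicA (c • x) = c • gradConicA x := by
  ext i
  fin_cases i <;> simp [gradConicA, mul_sub]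

lemma gradConicB_smul (c : R) (x : Fin 3 → R) : gradConicB (c • x) = c • gradConicB x := by
  ext i
  fin_cases i <;> simp [gradConicB, mul_sub]

lemma gradConicA_dotProduct (x v : Fin 3 → R) : gradConicA x ⬝ᵥ v =
    x 2 * v 0 - x 2 * v 1 + (x 0 - x 1) * v 2 := by
  simp only [gradConicA, dotProduct, Fin.sum_univ_three, Matrix.cons_val]
  ring

lemma gradConicA_dotProduct_self (x : Fin 3 → R) : gradConicA x ⬝ᵥ x = 2 * conicA x := by
  rw [gradConicA_dotProduct, conicA]
  ring

lemma gradConicB_dotProduct (x v : Fin 3 → R) : gradConicB x ⬝ᵥ v =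
    (x 1 - x 2) * v 0 + x 0 * v 1 - x 0 * v 2 := by
  simp only [gradConicB, dotProduct, Fin.sum_univ_three, Matrix.cons_val]
  ring

lemma gradConicB_dotProduct_self (x : Fin 3 → R) : gradConicB x ⬝ᵥ x = 2 * conicB x := by
  rw [gradConicB_dotProduct, conicB]
  ring

lemma vRamHess_mulVec (x y x' y' : Fin 3 → R) : (vRamHess x y).mulVec (Sum.elim x' y') =
    Sum.elim
      (conicB y • gradConicA x' - conicA y • gradConicB x' +
        ((gradConicB y ⬝ᵥ y') • gradConicA x - (gradConicA y ⬝ᵥ y') • gradConicB x))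
      ((gradConicA x ⬝ᵥ x') • gradConicB y - (gradConicB x ⬝ᵥ x') • gradConicA y +
        (conicA x • gradConicB y' - conicB x • gradConicA y')) := by
  have hA (v : Fin 3 → R) : !![0, 0, 1; 0, 0, -1; 1, -1, 0].mulVec v = gradConicA v := by
    ext i
    fin_cases i <;> simp [gradConicA, Matrix.mulVec, dotProduct, Fin.sum_univ_three, sub_eq_add_neg]
  have hB (v : Fin 3 → R) : !![0, 1, -1; 1, 0, 0; -1, 0, 0].mulVec v = gradConicB v := by
    ext i
    fin_cases i <;> simp [gradConicB, Matrix.mulVec, dotProduct, Fin.sum_univ_three, sub_eq_add_neg]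
  simp only [vRamHess, Matrix.fromBlocks_mulVec, Sum.elim_comp_inl, Sum.elim_comp_inr,
    Matrix.sub_mulVec, Matrix.smul_mulVec, hA, hB, Matrix.vecMulVec_mulVec, op_smul_eq_smul]

end Pencil

lemma pderiv_vRam (s : Fin 3 ⊕ Fin 3) : pderiv s vRam =
    Sum.elim (vRamGradX (fun i => (X (Sum.inl i) : BiPoly)) fun i => X (Sum.inr i))
      (vRamGradY (fun i => (X (Sum.inl i) : BiPoly)) fun i => X (Sum.inr i)) s := by
  rcases s with i | i <;> fin_cases i <;>
    simp [vRam, vRamGradX, vRamGradY, conicA, conicB, gradConicA, gradConicB, pderiv_X,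
      Derivation.leibniz]

lemma eval_pderiv_vRam (x y : Fin 3 → ℂ) (s : Fin 3 ⊕ Fin 3) :
    eval (Sum.elim x y) (pderiv s vRam) = Sum.elim (vRamGradX x y) (vRamGradY x y) s := by
  rw [pderiv_vRam]
  rcases s with i | i <;> fin_cases i <;>
    simp [vRamGradX, vRamGradY, conicA, conicB, gradConicA, gradConicB]

lemma hessianAt_vRam (x y : Fin 3 → ℂ) : hessianAt vRam (Sum.elim x y) = vRamHess x y := by
  ext i j
  rw [hessianAt, Matrix.of_apply, pderiv_vRam]
  rcases j with j | j <;> rcases i with i | i <;> fin_cases j <;>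
    simp only [vRamGradX, vRamGradY, conicA, conicB, gradConicA, gradConicB, vRamHess,
      Sum.elim_inl, Sum.elim_inr, Pi.sub_apply, Pi.smul_apply, Matrix.fromBlocks_apply₁₁,
      Matrix.fromBlocks_apply₁₂, Matrix.fromBlocks_apply₂₁, Matrix.fromBlocks_apply₂₂] <;>
    fin_cases i <;> simp [pderiv_X, Derivation.leibniz] <;> ring

lemma mem_biSing_vRam_iff (p : P2 × P2) : p ∈ biSing vRam ↔
    vRamGradX p.1.rep p.2.rep = 0 ∧ vRamGradY p.1.rep p.2.rep = 0 := by
  simp only [biSing, coords, Set.mem_ofPred_eq, eval_pderiv_vRam, Sum.forall, Sum.elim_inl,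
    Sum.elim_inr, funext_iff, Pi.zero_apply]

/-- The base points of the pencil of conics spanned by `conicA` and `conicB`. -/
def basePt : Fin 4 → Fin 3 → ℤ := ![![1, 0, 0], ![0, 1, 0], ![0, 0, 1], ![1, 1, 1]]

/-- The nodes of the singular conics `A = 0`, `B = 0` and `A + B = 0` of the pencil spanned by
`conicA` and `conicB`. -/
def conicNode : Fin 3 → Fin 3 → ℤ := ![![1, 1, 0], ![0, 1, 1], ![1, 0, 1]]

lemma exists_eq_smul_basePt {x : Fin 3 → ℂ} (hA : conicA x = 0) (hB : conicB x = 0) :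
    ∃ (i : Fin 4) (c : ℂ), x = c • intVec (basePt i) := by
  rw [conicA, mul_eq_zero, sub_eq_zero] at hA
  rw [conicB, mul_eq_zero, sub_eq_zero] at hB
  rcases hA with hA | hA <;> rcases hB with hB | hB
  · exact ⟨2, x 2, by ext i; fin_cases i <;> simp [basePt, intVec, ← hA, hB]⟩
  · exact ⟨3, x 0, by ext i; fin_cases i <;> simp [basePt, intVec, hA, ← hB]⟩
  · exact ⟨1, x 1, by ext i; fin_cases i <;> simp [basePt, intVec, hA, hB]⟩
  · exact ⟨0, x 0, by ext i; fin_cases i <;> simp [basePt, intVec, hA, hB]⟩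

lemma conicA_basePt (i : Fin 4) : conicA (intVec (basePt i)) = 0 := by
  fin_cases i <;> simp [conicA, basePt, intVec]

lemma conicB_basePt (i : Fin 4) : conicB (intVec (basePt i)) = 0 := by
  fin_cases i <;> simp [conicB, basePt, intVec]

lemma eq_zero_of_smul_gradConic_eq {x : Fin 3 → ℂ} (hx : x ≠ 0) (hA : conicA x = 0)
    (hB : conicB x = 0) {l m : ℂ} (h : l • gradConicA x - m • gradConicB x = 0) :
    l = 0 ∧ m = 0 := by
  obtain ⟨i, c, rfl⟩ := exists_eq_smul_basePt hA hB
  have hc : c ≠ 0 := left_ne_zero_of_smul hx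
  have h0 := congrFun h 0
  have h1 := congrFun h 1
  have h2 := congrFun h 2
  fin_cases i <;> simp [gradConicA, gradConicB, intVec, basePt, hc] at h0 h1 h2 <;> simp_all

lemma eq_smul_of_gradConic_dotProduct_eq_zero {x x' : Fin 3 → ℂ} (hx : x ≠ 0)
    (hA : conicA x = 0) (hB : conicB x = 0) (hA' : gradConicA x ⬝ᵥ x' = 0)
    (hB' : gradConicB x ⬝ᵥ x' = 0) : ∃ c : ℂ, x' = c • x := by
  obtain ⟨i, c, rfl⟩ := exists_eq_smul_basePt hA hB
  have hc : c ≠ 0 := left_ne_zero_of_smul hx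
  suffices x' = x' (![0, 1, 2, 0] i) • intVec (basePt i) from
    ⟨x' (![0, 1, 2, 0] i) / c, by rwa [smul_smul, div_mul_cancel₀ _ hc]⟩
  rw [gradConicA_dotProduct] at hA'
  rw [gradConicB_dotProduct] at hB'
  fin_cases i <;> simp [intVec, basePt, hc] at hA' hB' <;> ext j <;> fin_cases j <;>
    simp [intVec, basePt] <;> grind

lemma exists_eq_mul_conicNode {x : Fin 3 → ℂ} (hx : x ≠ 0) {l m : ℂ}
    (h : l • gradConicA x - m • gradConicB x = 0) :
    ∃ (k : Fin 3) (t : ℂ), l = t * conicB (intVec (conicNode k)) ∧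
      m = t * conicA (intVec (conicNode k)) := by
  have h0 := congrFun h 0
  have h1 := congrFun h 1
  have h2 := congrFun h 2
  simp only [gradConicA, gradConicB, Pi.sub_apply, Pi.smul_apply, smul_eq_mul, Pi.zero_apply,
    Matrix.cons_val] at h0 h1 h2
  rcases eq_or_ne m 0 with rfl | hm
  · exact ⟨0, l, by simp [conicA, conicB, intVec, conicNode]⟩
  rcases eq_or_ne l 0 with rfl | hl
  · exact ⟨1, -m, by simp [conicA, conicB, intVec, conicNode]⟩
  have hx2 : x 2 = x 0 + x 1 := mul_left_cancel₀ hm (by linear_combination h0 + h1)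
  have hx0 : x 0 = x 1 + x 2 := mul_left_cancel₀ hl (by linear_combination h1 + h2)
  have hx1 : x 1 = 0 := by linear_combination -(hx2 + hx0) / 2
  have hlm : l = -m := by
    have hx0' : x 0 ≠ 0 := fun h0' => hx (by ext i; fin_cases i <;> simp [h0', hx1, hx2])
    refine mul_right_cancel₀ hx0' ?_
    linear_combination -h1 - l * hx2 - l * hx1
  exact ⟨2, m, by simp [conicA, conicB, intVec, conicNode, hlm]⟩

lemma eq_smul_conicNode (k : Fin 3) {x : Fin 3 → ℂ}
    (h : conicB (intVec (conicNode k)) • gradConicA x -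
      conicA (intVec (conicNode k)) • gradConicB x = 0) :
    ∃ c : ℂ, x = c • intVec (conicNode k) := by
  refine ⟨x (![0, 1, 2] k), ?_⟩
  have h0 := congrFun h 0
  have h1 := congrFun h 1
  have h2 := congrFun h 2
  fin_cases k <;>
    simp [conicA, conicB, gradConicA, gradConicB, intVec, conicNode] at h0 h1 h2 <;>
    ext i <;> fin_cases i <;> simp [intVec, conicNode] <;> grind

lemma eq_basePt_or_conicNode_of_vRamGrad_eq_zero {x y : Fin 3 → ℂ} (hx : x ≠ 0) (hy : y ≠ 0)
    (h1 : vRamGradX x y = 0) (h2 : vRamGradY x y = 0) :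
    (conicA x = 0 ∧ conicB x = 0 ∧ conicA y = 0 ∧ conicB y = 0) ∨
      ∃ (k : Fin 3) (c d : ℂ), x = c • intVec (conicNode k) ∧ y = d • intVec (conicNode k) := by
  by_cases hAB : conicA y = 0 ∧ conicB y = 0
  · obtain ⟨hB, hA⟩ := eq_zero_of_smul_gradConic_eq hy hAB.1 hAB.2
      (l := conicB x) (m := conicA x) (by rw [← neg_eq_zero, ← h2, vRamGradY, neg_sub])
    exact Or.inl ⟨hA, hB, hAB⟩
  right
  obtain ⟨k, t, hB, hA⟩ := exists_eq_mul_conicNode hx h1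
  have ht : t ≠ 0 := fun ht => hAB ⟨by rw [hA, ht, zero_mul], by rw [hB, ht, zero_mul]⟩
  rw [vRamGradX, hA, hB, mul_smul, mul_smul, ← smul_sub, smul_eq_zero, or_iff_right ht] at h1
  obtain ⟨c, rfl⟩ := eq_smul_conicNode k h1
  have hc : c ^ 2 ≠ 0 := pow_ne_zero 2 (left_ne_zero_of_smul hx)
  rw [vRamGradY, conicA_smul, conicB_smul, mul_smul, mul_smul, ← smul_sub, smul_eq_zero,
    or_iff_right hc, ← neg_eq_zero, neg_sub] at h2
  obtain ⟨d, rfl⟩ := eq_smul_conicNode k h2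
  exact ⟨k, c, d, rfl, rfl⟩

lemma vRamGrad_basePt (i j : Fin 4) (c d : ℂ) :
    vRamGradX (c • intVec (basePt i)) (d • intVec (basePt j)) = 0 ∧
      vRamGradY (c • intVec (basePt i)) (d • intVec (basePt j)) = 0 := by
  simp [vRamGradX, vRamGradY, conicA_smul, conicB_smul, conicA_basePt, conicB_basePt]

lemma smul_gradConic_conicNode (k : Fin 3) :
    conicB (intVec (conicNode k)) • gradConicA (intVec (conicNode k)) =
      conicA (intVec (conicNode k)) • gradConicB (intVec (conicNode k)) := by
  ext i
  fin_cases k <;> fin_cases i <;>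
    simp [conicA, conicB, gradConicA, gradConicB, intVec, conicNode]

lemma vRamGrad_conicNode (k : Fin 3) (c d : ℂ) :
    vRamGradX (c • intVec (conicNode k)) (d • intVec (conicNode k)) = 0 ∧
      vRamGradY (c • intVec (conicNode k)) (d • intVec (conicNode k)) = 0 := by
  simp only [vRamGradX, vRamGradY, conicA_smul, conicB_smul, gradConicA_smul, gradConicB_smul]
  have h := smul_gradConic_conicNode k
  constructor
  · linear_combination (norm := module) (d ^ 2 * c) • h
  · linear_combination (norm := module) (-(c ^ 2 * d)) • h

lemma smul_gradConic_conicNode_comm (k : Fin 3) (y' : Fin 3 → ℂ) :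
    (gradConicB (intVec (conicNode k)) ⬝ᵥ y') • gradConicA (intVec (conicNode k)) =
      (gradConicA (intVec (conicNode k)) ⬝ᵥ y') • gradConicB (intVec (conicNode k)) := by
  rw [gradConicA_dotProduct, gradConicB_dotProduct]
  ext i
  fin_cases k <;> fin_cases i <;> simp [gradConicA, gradConicB, intVec, conicNode] <;> ring

lemma eq_smul_of_vRamHess_conicNode_mulVec (k : Fin 3) {c d : ℂ} (hc : c ≠ 0) (hd : d ≠ 0)
    {x' y' : Fin 3 → ℂ} (h : (vRamHess (c • intVec (conicNode k))
      (d • intVec (conicNode k))).mulVec (Sum.elim x' y') = 0) :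
    (∃ s : ℂ, x' = s • intVec (conicNode k)) ∧ ∃ t : ℂ, y' = t • intVec (conicNode k) := by
  rw [vRamHess_mulVec] at h
  simp only [conicA_smul, conicB_smul, gradConicA_smul, gradConicB_smul, smul_dotProduct] at h
  have hX := congrArg (· ∘ Sum.inl) h
  have hY := congrArg (· ∘ Sum.inr) h
  simp only [Sum.elim_comp_inl, Sum.elim_comp_inr] at hX hY
  refine ⟨eq_smul_conicNode k ?_, eq_smul_conicNode k ?_⟩
  · refine (smul_eq_zero_iff_right (pow_ne_zero 2 hd)).1 (Eq.trans ?_ hX)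
    linear_combination (norm := module) (-(c * d)) • smul_gradConic_conicNode_comm k y'
  · refine (smul_eq_zero_iff_right (pow_ne_zero 2 hc)).1 ?_
    rw [← neg_eq_zero]
    refine Eq.trans ?_ hY
    linear_combination (norm := module) (c * d) • smul_gradConic_conicNode_comm k x'

lemma eq_smul_of_vRamHess_mulVec {x y x' y' : Fin 3 → ℂ} (hx : x ≠ 0) (hy : y ≠ 0)
    (h1 : vRamGradX x y = 0) (h2 : vRamGradY x y = 0)
    (h : (vRamHess x y).mulVec (Sum.elim x' y') = 0) :
    (∃ c : ℂ, x' = c • x) ∧ ∃ d : ℂ, y' = d • y := by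
  rcases eq_basePt_or_conicNode_of_vRamGrad_eq_zero hx hy h1 h2 with
    ⟨hAx, hBx, hAy, hBy⟩ | ⟨k, c, d, rfl, rfl⟩
  · rw [vRamHess_mulVec] at h
    have hX := congrArg (· ∘ Sum.inl) h
    have hY := congrArg (· ∘ Sum.inr) h
    simp only [Sum.elim_comp_inl, Sum.elim_comp_inr, hAx, hBx, hAy, hBy, zero_smul, sub_zero,
      zero_add, add_zero] at hX hY
    obtain ⟨hB', hA'⟩ := eq_zero_of_smul_gradConic_eq hx hAx hBx hX
    obtain ⟨hB'', hA''⟩ := eq_zero_of_smul_gradConic_eq hy hAy hBy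
      (by rw [← neg_eq_zero, neg_sub]; exact hY)
    exact ⟨eq_smul_of_gradConic_dotProduct_eq_zero hx hAx hBx hA'' hB'',
      eq_smul_of_gradConic_dotProduct_eq_zero hy hAy hBy hA' hB'⟩
  · have hc := left_ne_zero_of_smul hx
    have hd := left_ne_zero_of_smul hy
    obtain ⟨⟨s, rfl⟩, ⟨t, rfl⟩⟩ := eq_smul_of_vRamHess_conicNode_mulVec k hc hd h
    exact ⟨⟨s / c, by rw [smul_smul, div_mul_cancel₀ _ hc]⟩,
      ⟨t / d, by rw [smul_smul, div_mul_cancel₀ _ hd]⟩⟩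

lemma vRamHess_mulVec_elim_smul {x y : Fin 3 → ℂ} (h1 : vRamGradX x y = 0)
    (h2 : vRamGradY x y = 0) (s t : ℂ) :
    (vRamHess x y).mulVec (Sum.elim (s • x) (t • y)) = 0 := by
  have hX : (s + 2 * t) • vRamGradX x y = 0 := by rw [h1, smul_zero]
  have hY : (2 * s + t) • vRamGradY x y = 0 := by rw [h2, smul_zero]
  rw [vRamGradX] at hX
  rw [vRamGradY] at hY
  simp only [vRamHess_mulVec, gradConicA_smul, gradConicB_smul, dotProduct_smul,
    gradConicA_dotProduct_self, gradConicB_dotProduct_self, smul_eq_mul]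
  rw [← Sum.elim_zero_zero]
  congr 1
  · linear_combination (norm := module) hX
  · linear_combination (norm := module) hY

lemma linearIndependent_elim_zero {ι κ K : Type*} [Field K] {x : ι → K} {y : κ → K}
    (hx : x ≠ 0) (hy : y ≠ 0) : LinearIndependent K ![Sum.elim x 0, Sum.elim 0 y] := by
  rw [LinearIndependent.pair_iff]
  intro s t hst
  have hs : s • x = 0 := funext fun i => by simpa using congrFun hst (Sum.inl i)
  have ht : t • y = 0 := funext fun j => by simpa using congrFun hst (Sum.inr j)
  exact ⟨(smul_eq_zero_iff_left hx).1 hs, (smul_eq_zero_iff_left hy).1 ht⟩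

lemma ker_vRamHess {x y : Fin 3 → ℂ} (hx : x ≠ 0) (hy : y ≠ 0) (h1 : vRamGradX x y = 0)
    (h2 : vRamGradY x y = 0) : LinearMap.ker (vRamHess x y).mulVecLin =
      Submodule.span ℂ (Set.range ![Sum.elim x 0, Sum.elim 0 y]) := by
  ext v
  rw [LinearMap.mem_ker, Matrix.mulVecLin_apply, Matrix.range_cons_cons_empty,
    Submodule.mem_span_pair]
  constructor
  · intro h
    rw [← Sum.elim_comp_inl_inr v] at h ⊢
    obtain ⟨⟨c, hc⟩, ⟨d, hd⟩⟩ := eq_smul_of_vRamHess_mulVec hx hy h1 h2 h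
    exact ⟨c, d, by rw [hc, hd]; ext (i | i) <;> simp⟩
  · rintro ⟨c, d, rfl⟩
    rw [← vRamHess_mulVec_elim_smul h1 h2 c d]
    congr 1
    ext (i | i) <;> simp

lemma rank_vRamHess {x y : Fin 3 → ℂ} (hx : x ≠ 0) (hy : y ≠ 0) (h1 : vRamGradX x y = 0)
    (h2 : vRamGradY x y = 0) : (vRamHess x y).rank = 4 := by
  have hker : Module.finrank ℂ (LinearMap.ker (vRamHess x y).mulVecLin) = 2 := by
    rw [ker_vRamHess hx hy h1 h2, finrank_span_eq_card (linearIndependent_elim_zero hx hy),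
      Fintype.card_fin]
  have hrn := (vRamHess x y).mulVecLin.finrank_range_add_finrank_ker
  rw [hker, Module.finrank_fintype_fun_eq_card, Fintype.card_sum, Fintype.card_fin] at hrn
  exact Nat.add_right_cancel hrn

lemma isBiNode_vRam {p : P2 × P2} (hp : p ∈ biSing vRam) : IsBiNode vRam p := by
  obtain ⟨h1, h2⟩ := (mem_biSing_vRam_iff p).1 hp
  exact ⟨hp, by rw [coords, hessianAt_vRam, rank_vRamHess p.1.rep_nonzero p.2.rep_nonzero h1 h2]⟩

/-- The seven singular points of the members of the pencil of conics: its base points and the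
nodes of its singular members. -/
def pencilPt : Fin 4 ⊕ Fin 3 → Fin 3 → ℤ := Sum.elim basePt conicNode

lemma pencilPt_ne_zero (k : Fin 4 ⊕ Fin 3) : pencilPt k ≠ 0 := by
  revert k; decide

lemma exists_pencilPt_mul_ne {k l : Fin 4 ⊕ Fin 3} (h : k ≠ l) :
    ∃ i j, pencilPt k i * pencilPt l j ≠ pencilPt k j * pencilPt l i := by
  revert k l; decide

/-- The points `pencilPt` as points of `ℙ²`. -/
def pencilProjPt (k : Fin 4 ⊕ Fin 3) : P2 :=
  Projectivization.mk ℂ _ (intVec_ne_zero (pencilPt_ne_zero k))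

lemma pencilProjPt_injective : Function.Injective pencilProjPt := by
  intro k l hkl
  by_contra hne
  obtain ⟨c, hc⟩ := (Projectivization.mk_eq_mk_iff' _ _ _ _ _).1 hkl
  obtain ⟨i, j, hij⟩ := exists_pencilPt_mul_ne hne
  have h := mul_eq_mul_of_smul_intVec_eq hc i j
  exact hij (by linear_combination -h)

/-- The singular points of the threefold: the 16 pairs of base points and the three pairs of
equal nodes. -/
def vRamNode : (Fin 4 × Fin 4) ⊕ Fin 3 → P2 × P2 :=
  Sum.elim (fun ij => (pencilProjPt (.inl ij.1), pencilProjPt (.inl ij.2)))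
    fun k => (pencilProjPt (.inr k), pencilProjPt (.inr k))

lemma vRamNode_injective : Function.Injective vRamNode := by
  rintro (⟨i, j⟩ | k) (⟨i', j'⟩ | k') h <;>
    simp_all [vRamNode, Prod.ext_iff, pencilProjPt_injective.eq_iff]

lemma eq_pencilProjPt {p : P2} {k : Fin 4 ⊕ Fin 3} {c : ℂ} (h : p.rep = c • intVec (pencilPt k)) :
    pencilProjPt k = p := by
  conv_rhs => rw [← p.mk_rep]
  exact ((Projectivization.mk_eq_mk_iff' _ _ _ _ _).2 ⟨c, h.symm⟩).symm

lemma biSing_vRam : biSing vRam = Set.range vRamNode := by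
  ext p
  rw [mem_biSing_vRam_iff]
  constructor
  · rintro ⟨h1, h2⟩
    rcases eq_basePt_or_conicNode_of_vRamGrad_eq_zero p.1.rep_nonzero p.2.rep_nonzero h1 h2 with
      ⟨hAx, hBx, hAy, hBy⟩ | ⟨k, c, d, hx, hy⟩
    · obtain ⟨i, c, hx⟩ := exists_eq_smul_basePt hAx hBx
      obtain ⟨j, d, hy⟩ := exists_eq_smul_basePt hAy hBy
      exact ⟨.inl (i, j), Prod.ext (eq_pencilProjPt hx) (eq_pencilProjPt hy)⟩
    · exact ⟨.inr k, Prod.ext (eq_pencilProjPt hx) (eq_pencilProjPt hy)⟩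
  · have hrep (k : Fin 4 ⊕ Fin 3) : ∃ c : ℂ, (pencilProjPt k).rep = c • intVec (pencilPt k) :=
      (exists_rep_mk_eq_smul (intVec_ne_zero (pencilPt_ne_zero k))).imp fun _ => And.right
    rintro ⟨⟨i, j⟩ | k, rfl⟩
    · obtain ⟨c, hc⟩ := hrep (.inl i)
      obtain ⟨d, hd⟩ := hrep (.inl j)
      simpa only [vRamNode, pencilPt, Sum.elim_inl, hc, hd] using vRamGrad_basePt i j c d
    · obtain ⟨c, hc⟩ := hrep (.inr k)
      simpa only [vRamNode, pencilPt, Sum.elim_inr, hc] using vRamGrad_conicNode k c c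

lemma ncard_biSing_vRam : (biSing vRam).ncard = 19 := by
  rw [biSing_vRam, ← Nat.card_coe_set_eq, Nat.card_range_of_injective vRamNode_injective]
  simp

lemma vRam_mem_biForms : vRam ∈ biForms 2 2 := by
  have hx (i : Fin 3) : (X (Sum.inl i) : BiPoly) ∈ biForms 1 0 := isWeightedHomogeneous_X ℂ _ _
  have hy (i : Fin 3) : (X (Sum.inr i) : BiPoly) ∈ biForms 0 1 := isWeightedHomogeneous_X ℂ _ _
  have hmul {a b c d : ℕ} {f g : BiPoly} (hf : f ∈ biForms a b) (hg : g ∈ biForms c d) :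
      f * g ∈ biForms (a + c) (b + d) := IsWeightedHomogeneous.mul hf hg
  exact sub_mem
    (hmul (hmul (sub_mem (hx 0) (hx 1)) (hx 2)) (hmul (hy 0) (sub_mem (hy 1) (hy 2))))
    (hmul (hmul (hx 0) (sub_mem (hx 1) (hx 2))) (hmul (sub_mem (hy 0) (hy 1)) (hy 2)))

/-! ## Plücker coordinates on `⋀³ ℂ⁶` -/

section ExteriorAlgebra

variable {K E : Type*} [Field K] [AddCommGroup E] [Module K E] {n : ℕ}

lemma ιMulti_ne_zero_of_linearIndependent {v : Fin n → E} (hv : LinearIndependent K v) :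
    ExteriorAlgebra.ιMulti K n v ≠ 0 := by
  obtain ⟨g, hg⟩ := (Fintype.linearCombination K v).exists_leftInverse_of_injective
    (LinearMap.ker_eq_bot.2 (linearIndependent_iff_injective_fintypeLinearCombination.1 hv))
  have hgv (i : Fin n) : g (v i) = Pi.single i 1 := by
    simpa using LinearMap.congr_fun hg (Pi.single i 1)
  let φ : E [⋀^Fin n]→ₗ[K] K := Matrix.detRowAlternating.compLinearMap g
  have hφ : φ v = 1 := by
    change Matrix.det (fun i => g (v i)) = 1
    simp only [hgv]
    rw [← Matrix.det_one (n := Fin n) (R := K)]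
    exact congrArg Matrix.det (by ext i j; simp [Matrix.one_apply, Pi.single_apply, eq_comm])
  intro h
  have := ExteriorAlgebra.liftAlternating_apply_ιMulti (Pi.single n φ) v
  rw [h, map_zero, Pi.single_eq_same, hφ] at this
  exact zero_ne_one this

lemma ιMulti_eq_zero_iff {v : Fin n → E} :
    ExteriorAlgebra.ιMulti K n v = 0 ↔ ¬ LinearIndependent K v :=
  ⟨fun h hv => ιMulti_ne_zero_of_linearIndependent hv h,
    AlternatingMap.map_linearDependent _ v⟩

lemma mem_span_range_iff_ι_mul_ιMulti_eq_zero {v : Fin n → E} (hv : LinearIndependent K v)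
    {z : E} : z ∈ Submodule.span K (Set.range v) ↔
      ExteriorAlgebra.ι K z * ExteriorAlgebra.ιMulti K n v = 0 := by
  have h : ExteriorAlgebra.ι K z * ExteriorAlgebra.ιMulti K n v =
      ExteriorAlgebra.ιMulti K (n + 1) (Fin.cons z v) := by
    simp [ExteriorAlgebra.ιMulti_succ_apply, Matrix.vecTail, Function.comp_def]
  rw [h, ιMulti_eq_zero_iff, linearIndependent_finCons]
  tauto

lemma ιMulti_mul_ιMulti_eq_zero_iff {m : ℕ} {u : Fin m → E} {v : Fin n → E}
    (hu : LinearIndependent K u) (hv : LinearIndependent K v) :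
    ExteriorAlgebra.ιMulti K m u * ExteriorAlgebra.ιMulti K n v = 0 ↔
      Submodule.span K (Set.range u) ⊓ Submodule.span K (Set.range v) ≠ ⊥ := by
  have happend : Fin.append u v ∘ finSumFinEquiv = Sum.elim u v := by
    ext (i | i) <;> simp
  rw [ExteriorAlgebra.ιMulti_mul_ιMulti, ιMulti_eq_zero_iff,
    ← linearIndependent_equiv finSumFinEquiv, happend, linearIndependent_sum]
  simp [hu, hv, disjoint_iff, Function.comp_def]

end ExteriorAlgebra

lemma wedge3_eq_ιMulti (p q r : W6) : wedge3 p q r = ExteriorAlgebra.ιMulti ℂ 3 ![p, q, r] := by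
  simp [wedge3, mul_assoc, Matrix.vecTail]

lemma wedge3_mul_wedge3 (p q r p' q' r' : W6) : wedge3 p q r * wedge3 p' q' r' =
    ExteriorAlgebra.ιMulti ℂ 6 ![p, q, r, p', q', r'] := by
  simp [wedge3, mul_assoc, Matrix.vecTail]

lemma wedge3_swap_left (p q r : W6) : wedge3 q p r = -wedge3 p q r := by
  rw [wedge3, wedge3, ← neg_mul, eq_neg_of_add_eq_zero_left (ExteriorAlgebra.ι_add_mul_swap q p)]

lemma wedge3_swap_right (p q r : W6) : wedge3 p r q = -wedge3 p q r := by
  rw [wedge3, wedge3, mul_assoc, mul_assoc,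
    eq_neg_of_add_eq_zero_left (ExteriorAlgebra.ι_add_mul_swap r q), mul_neg]

lemma wedge3_mem (p q r : W6) : wedge3 p q r ∈ ⋀[ℂ]^3 W6 := by
  rw [wedge3_eq_ιMulti]
  exact ExteriorAlgebra.ιMulti_range ℂ 3 ⟨_, rfl⟩

/-- The standard basis of `ℂ⁶`. -/
def stdE (i : Fin 6) : W6 := Pi.single i 1

lemma coe_basisFun_eq_stdE : ⇑(Pi.basisFun ℂ (Fin 6)) = stdE := by
  ext i
  simp [stdE]

/-- The index triples of the Plücker coordinates on `⋀³ ℂ⁶`. They are ordered so that the triples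
`k` and `k.rev` are complementary and concatenate to an even permutation of the six indices when
`k < 10`, to an odd one otherwise. The triples in positions 1 to 9 are those with one index
below 3. -/
def plTriple : Fin 20 → Fin 3 → Fin 6 :=
  ![![0, 1, 2],
    ![0, 4, 5], ![0, 5, 3], ![0, 3, 4],
    ![1, 4, 5], ![1, 5, 3], ![1, 3, 4],
    ![2, 4, 5], ![2, 5, 3], ![2, 3, 4],
    ![0, 1, 5], ![0, 1, 4], ![0, 1, 3],
    ![2, 0, 5], ![2, 0, 4], ![2, 0, 3],
    ![1, 2, 5], ![1, 2, 4], ![1, 2, 3],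
    ![3, 4, 5]]

/-- The Plücker coordinates on `⋀³ ℂ⁶`, as linear forms on the whole exterior algebra. -/
def plCoord (k : Fin 20) : ExteriorAlgebra ℂ W6 →ₗ[ℂ] ℂ :=
  ExteriorAlgebra.liftAlternating (R := ℂ) (Pi.single 3
    (Matrix.detRowAlternating.compLinearMap (LinearMap.funLeft ℂ ℂ (plTriple k))))

lemma plCoord_wedge3 (k : Fin 20) (p q r : W6) : plCoord k (wedge3 p q r) =
    Matrix.det (.of ![p ∘ plTriple k, q ∘ plTriple k, r ∘ plTriple k]) := by
  rw [wedge3_eq_ιMulti, plCoord, ExteriorAlgebra.liftAlternating_apply_ιMulti, Pi.single_eq_same]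
  refine congrArg (Matrix.det (n := Fin 3) (R := ℂ)) ?_
  ext i
  fin_cases i <;> rfl

/-- The basis of `⋀³ ℂ⁶` dual to the Plücker coordinates. -/
def plBasis (k : Fin 20) : ExteriorAlgebra ℂ W6 :=
  wedge3 (stdE (plTriple k 0)) (stdE (plTriple k 1)) (stdE (plTriple k 2))

lemma plBasis_mem (k : Fin 20) : plBasis k ∈ ⋀[ℂ]^3 W6 := wedge3_mem _ _ _

lemma plCoord_plBasis (k l : Fin 20) : plCoord k (plBasis l) = if k = l then 1 else 0 := by
  have hdet : ∀ k l : Fin 20, Matrix.det (Matrix.of fun i j =>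
      if plTriple k j = plTriple l i then (1 : ℤ) else 0) = if k = l then 1 else 0 := by
    simp only [Matrix.det_fin_three]
    decide +kernel
  have hcast := congrArg (Int.cast : ℤ → ℂ) (hdet k l)
  rw [Int.cast_det] at hcast
  rw [plBasis, plCoord_wedge3]
  convert hcast using 1
  · congr 1
    ext i j
    fin_cases i <;> simp [stdE, Pi.single_apply]
  · simp

lemma exteriorPower_three_le_span_plBasis :
    ⋀[ℂ]^3 W6 ≤ Submodule.span ℂ (Set.range plBasis) := by
  have hs : Submodule.span ℂ (Set.range stdE) = ⊤ := by
    rw [← coe_basisFun_eq_stdE, Module.Basis.span_eq]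
  rw [← exteriorPower.ιMulti_family_span_fixedDegree_of_span ℂ hs, Submodule.span_le]
  rintro _ ⟨s, rfl⟩
  let f := Set.powersetCard.ofFinEmbEquiv.symm s
  have hf : ExteriorAlgebra.ιMulti_family ℂ 3 stdE s =
      wedge3 (stdE (f 0)) (stdE (f 1)) (stdE (f 2)) := by
    rw [wedge3_eq_ιMulti, ExteriorAlgebra.ιMulti_family]
    congr 1
    ext i
    fin_cases i <;> rfl
  have htriple : ∀ i j k : Fin 6, i < j → j < k → ∃ l : Fin 20, plTriple l = ![i, j, k] ∨
    plTriple l = ![i, k, j] ∨ plTriple l = ![j, i, k] := by decide +kernel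
  obtain ⟨l, hl⟩ := htriple _ _ _ (f.strictMono (show 0 < 1 by decide))
    (f.strictMono (show 1 < 2 by decide))
  have hmem : plBasis l ∈ Submodule.span ℂ (Set.range plBasis) := Submodule.subset_span ⟨l, rfl⟩
  rw [hf]
  rcases hl with h | h | h
  · simpa [plBasis, h] using hmem
  · rw [← neg_neg (wedge3 _ _ _), ← wedge3_swap_right]
    exact neg_mem (by simpa [plBasis, h] using hmem)
  · rw [← neg_neg (wedge3 _ _ _), ← wedge3_swap_left]
    exact neg_mem (by simpa [plBasis, h] using hmem)

lemma sum_plCoord_smul_plBasis {ω : ExteriorAlgebra ℂ W6} (h : ω ∈ ⋀[ℂ]^3 W6) :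
    ∑ k, plCoord k ω • plBasis k = ω := by
  obtain ⟨c, rfl⟩ := (Submodule.mem_span_range_iff_exists_fun ℂ).1
    (exteriorPower_three_le_span_plBasis h)
  simp [plCoord_plBasis]

lemma eq_of_plCoord_eq {ω η : ExteriorAlgebra ℂ W6} (hω : ω ∈ ⋀[ℂ]^3 W6) (hη : η ∈ ⋀[ℂ]^3 W6)
    (h : ∀ k, plCoord k ω = plCoord k η) : ω = η := by
  rw [← sum_plCoord_smul_plBasis hω, ← sum_plCoord_smul_plBasis hη]
  simp only [h]

lemma volW_eq_ιMulti : volW = ExteriorAlgebra.ιMulti ℂ 6 stdE := by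
  rw [volW, wedge3_mul_wedge3]
  congr 1
  ext i
  fin_cases i <;> rfl

lemma volW_ne_zero : volW ≠ 0 := by
  rw [volW_eq_ιMulti, ← coe_basisFun_eq_stdE]
  exact ιMulti_ne_zero_of_linearIndependent (Pi.basisFun ℂ (Fin 6)).linearIndependent

lemma wedge3_mul_wedge3_stdE (f g : Fin 3 → Fin 6) :
    wedge3 (stdE (f 0)) (stdE (f 1)) (stdE (f 2)) * wedge3 (stdE (g 0)) (stdE (g 1)) (stdE (g 2)) =
      ExteriorAlgebra.ιMulti ℂ 6 (stdE ∘ ![f 0, f 1, f 2, g 0, g 1, g 2]) := by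
  rw [wedge3_mul_wedge3]
  congr 1
  ext i
  fin_cases i <;> rfl

lemma plBasis_mul_plBasis_rev (k : Fin 20) :
    plBasis k * plBasis k.rev = (if k < 10 then 1 else -1 : ℂ) • volW := by
  have hperm : ∀ k : Fin 20, ∃ σ : Equiv.Perm (Fin 6),
      (∀ i, σ i = ![plTriple k 0, plTriple k 1, plTriple k 2,
        plTriple k.rev 0, plTriple k.rev 1, plTriple k.rev 2] i) ∧
      Equiv.Perm.sign σ = if k < 10 then 1 else -1 := by
    decide +kernel
  obtain ⟨σ, hσ, hsign⟩ := hperm k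
  rw [plBasis, plBasis, wedge3_mul_wedge3_stdE, ← funext hσ, AlternatingMap.map_perm, hsign,
    ← volW_eq_ιMulti]
  split_ifs <;> simp

lemma plBasis_mul_plBasis_of_ne {k l : Fin 20} (h : l ≠ k.rev) : plBasis k * plBasis l = 0 := by
  have hrepeat : ∀ k l : Fin 20, l ≠ k.rev → ∃ i j : Fin 6, i ≠ j ∧
      ![plTriple k 0, plTriple k 1, plTriple k 2, plTriple l 0, plTriple l 1, plTriple l 2] i =
      ![plTriple k 0, plTriple k 1, plTriple k 2, plTriple l 0, plTriple l 1, plTriple l 2] j := by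
    decide +kernel
  obtain ⟨i, j, hij, h'⟩ := hrepeat k l h
  rw [plBasis, plBasis, wedge3_mul_wedge3_stdE]
  exact AlternatingMap.map_eq_zero_of_eq _ _ (congrArg stdE h') hij

lemma mul_eq_sum_plCoord {ω η : ExteriorAlgebra ℂ W6} (hω : ω ∈ ⋀[ℂ]^3 W6)
    (hη : η ∈ ⋀[ℂ]^3 W6) : ω * η =
      (∑ k : Fin 20, (if k < 10 then 1 else -1) * (plCoord k ω * plCoord k.rev η)) • volW := by
  conv_lhs => rw [← sum_plCoord_smul_plBasis hω, ← sum_plCoord_smul_plBasis hη]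
  simp only [Finset.sum_mul_sum, smul_mul_smul_comm, Finset.sum_smul]
  refine Finset.sum_congr rfl fun k _ => ?_
  rw [Finset.sum_eq_single_of_mem k.rev (Finset.mem_univ _)
    fun l _ hl => by rw [plBasis_mul_plBasis_of_ne hl, smul_zero],
    plBasis_mul_plBasis_rev, smul_smul, mul_comm]

/-! ## The Lagrangian subspace -/

/-- The first three coordinates of a vector of `ℂ⁶`; on `U` they are homogeneous coordinates
of `ℙ(U)`. -/
def lo : W6 →ₗ[ℂ] Fin 3 → ℂ := LinearMap.funLeft ℂ ℂ (Fin.castAdd 3)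

/-- The last three coordinates of a vector of `ℂ⁶`, its class modulo `U`. -/
def hi : W6 →ₗ[ℂ] Fin 3 → ℂ := LinearMap.funLeft ℂ ℂ (Fin.natAdd 3)

/-- The coordinates of the hyperplane spanned by `U`, `v` and `w`, those of `v ∧ w` modulo `U`. -/
def hiCross (v w : W6) : Fin 3 → ℂ := crossProduct (hi v) (hi w)

lemma lo_apply (p : W6) : lo p = ![p 0, p 1, p 2] := by
  ext i
  fin_cases i <;> rfl

lemma hi_apply (p : W6) : hi p = ![p 3, p 4, p 5] := by
  ext i
  fin_cases i <;> rfl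

lemma eq_of_lo_eq_of_hi_eq {p q : W6} (hlo : lo p = lo q) (hhi : hi p = hi q) : p = q := by
  ext i
  exact Fin.addCases (m := 3) (n := 3) (congrFun hlo) (congrFun hhi) i

lemma lo_append (a b : Fin 3 → ℂ) : lo (Fin.append a b) = a := by
  ext i
  exact Fin.append_left a b i

lemma hi_append (a b : Fin 3 → ℂ) : hi (Fin.append a b) = b := by
  ext i
  exact Fin.append_right a b i

lemma mem_planeU_iff_hi_eq_zero {p : W6} : p ∈ planeU ↔ hi p = 0 := by
  rw [planeU, Submodule.mem_span_triple]
  constructor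
  · rintro ⟨a, b, c, rfl⟩
    ext i
    fin_cases i <;> simp [hi_apply]
  · intro h
    refine ⟨p 0, p 1, p 2, eq_of_lo_eq_of_hi_eq ?_ (.trans ?_ h.symm)⟩ <;> ext i <;>
      fin_cases i <;> simp [lo_apply, hi_apply]

lemma eq_zero_of_mem_planeU {p : W6} (hp : p ∈ planeU) : p 3 = 0 ∧ p 4 = 0 ∧ p 5 = 0 := by
  have h := mem_planeU_iff_hi_eq_zero.1 hp
  exact ⟨congrFun h 0, congrFun h 1, congrFun h 2⟩

lemma stdE_mem_planeU : stdE 0 ∈ planeU ∧ stdE 1 ∈ planeU ∧ stdE 2 ∈ planeU :=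
  ⟨Submodule.subset_span (by simp [stdE]), Submodule.subset_span (by simp [stdE]),
    Submodule.subset_span (by simp [stdE])⟩

section Polarity

variable {R : Type*} [CommRing R]

/-- The polarity of the space of 3 by 3 matrices whose quadratic form restricts to `2 * vRam` on
the matrices of rank one. -/
def polarity : Matrix (Fin 3) (Fin 3) R →ₗ[R] Matrix (Fin 3) (Fin 3) R where
  toFun M := !![0, M 1 2 + M 2 0, -(M 2 1 + M 1 0);
    -(M 0 2 + M 2 1), 0, M 0 1 + M 2 0;
    M 0 1 + M 1 2, -(M 0 2 + M 1 0), 0]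
  map_add' M N := by
    ext i j
    fin_cases i <;> fin_cases j <;> simp <;> ring
  map_smul' c M := by
    ext i j
    fin_cases i <;> fin_cases j <;> simp <;> ring

lemma polarity_apply (M : Matrix (Fin 3) (Fin 3) R) : polarity M =
    !![0, M 1 2 + M 2 0, -(M 2 1 + M 1 0);
      -(M 0 2 + M 2 1), 0, M 0 1 + M 2 0;
      M 0 1 + M 1 2, -(M 0 2 + M 1 0), 0] := rfl

lemma sum_mul_polarity_comm (M N : Matrix (Fin 3) (Fin 3) R) :
    ∑ i, ∑ j, M i j * polarity N i j = ∑ i, ∑ j, polarity M i j * N i j := by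
  simp only [polarity_apply, Fin.sum_univ_three, Matrix.of_apply, Matrix.cons_val]
  ring

end Polarity

/-- The positions of the Plücker coordinates with one index below 3. -/
def plIndex : Fin 3 → Fin 3 → Fin 20 := ![![1, 2, 3], ![4, 5, 6], ![7, 8, 9]]

lemma plIndex_inj {i j k l : Fin 3} : plIndex i j = plIndex k l ↔ i = k ∧ j = l := by
  revert i j k l
  decide

lemma plIndex_ne_rev_plIndex (i j k l : Fin 3) : plIndex i j ≠ (plIndex k l).rev := by
  revert i j k l
  decide

lemma plIndex_ne_zero (i j : Fin 3) : plIndex i j ≠ 0 ∧ (plIndex i j).rev ≠ 0 := by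
  revert i j
  decide

lemma plIndex_ne_nineteen (i j : Fin 3) : plIndex i j ≠ 19 ∧ (plIndex i j).rev ≠ 19 := by
  revert i j
  decide

lemma eq_plIndex_or (k : Fin 20) :
    k = 0 ∨ k = 19 ∨ ∃ i j, k = plIndex i j ∨ k = (plIndex i j).rev := by
  revert k
  decide +kernel

/-- The matrix of the Plücker coordinates with one index below 3. -/
def linPart : ExteriorAlgebra ℂ W6 →ₗ[ℂ] Matrix (Fin 3) (Fin 3) ℂ :=
  LinearMap.pi fun i => LinearMap.pi fun j => plCoord (plIndex i j)

/-- The matrix of the Plücker coordinates with two indices below 3. -/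
def quadPart : ExteriorAlgebra ℂ W6 →ₗ[ℂ] Matrix (Fin 3) (Fin 3) ℂ :=
  LinearMap.pi fun i => LinearMap.pi fun j => plCoord (plIndex i j).rev

lemma linPart_apply (ω : ExteriorAlgebra ℂ W6) (i j : Fin 3) :
    linPart ω i j = plCoord (plIndex i j) ω := rfl

lemma quadPart_apply (ω : ExteriorAlgebra ℂ W6) (i j : Fin 3) :
    quadPart ω i j = plCoord (plIndex i j).rev ω := rfl

lemma eq_of_parts_eq {ω η : ExteriorAlgebra ℂ W6} (hω : ω ∈ ⋀[ℂ]^3 W6) (hη : η ∈ ⋀[ℂ]^3 W6)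
    (h0 : plCoord 0 ω = plCoord 0 η) (hlin : linPart ω = linPart η)
    (hquad : quadPart ω = quadPart η) (h19 : plCoord 19 ω = plCoord 19 η) : ω = η := by
  refine eq_of_plCoord_eq hω hη fun k => ?_
  obtain rfl | rfl | ⟨i, j, rfl | rfl⟩ := eq_plIndex_or k
  · exact h0
  · exact h19
  · exact congrFun (congrFun hlin i) j
  · exact congrFun (congrFun hquad i) j

lemma mul_eq_sum_parts {ω η : ExteriorAlgebra ℂ W6} (hω : ω ∈ ⋀[ℂ]^3 W6) (hη : η ∈ ⋀[ℂ]^3 W6) :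
    ω * η = (plCoord 0 ω * plCoord 19 η - plCoord 19 ω * plCoord 0 η +
      (∑ i, ∑ j, linPart ω i j * quadPart η i j - ∑ i, ∑ j, quadPart ω i j * linPart η i j)) •
        volW := by
  rw [mul_eq_sum_plCoord hω hη]
  congr 1
  simp only [linPart_apply, quadPart_apply]
  simp [Fin.sum_univ_succ, plIndex, Fin.rev, Fin.lt_def]
  ring

/-- The Lagrangian subspace of `⋀³ ℂ⁶` that is the sum of `⋀³ U` and the graph of `polarity`. -/
def lagA : Submodule ℂ (ExteriorAlgebra ℂ W6) :=
  ⋀[ℂ]^3 W6 ⊓ LinearMap.ker (plCoord 19) ⊓ LinearMap.eqLocus quadPart (polarity ∘ₗ linPart)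

lemma mem_lagA_iff {ω : ExteriorAlgebra ℂ W6} : ω ∈ lagA ↔
    ω ∈ ⋀[ℂ]^3 W6 ∧ plCoord 19 ω = 0 ∧ quadPart ω = polarity (linPart ω) := and_assoc

/-- The element of `lagA` with given coordinates. -/
def lagMk (c : ℂ) (M : Matrix (Fin 3) (Fin 3) ℂ) : ExteriorAlgebra ℂ W6 :=
  c • plBasis 0 +
    ∑ i, ∑ j, (M i j • plBasis (plIndex i j) + polarity M i j • plBasis (plIndex i j).rev)

lemma lagMk_mem_exteriorPower (c : ℂ) (M : Matrix (Fin 3) (Fin 3) ℂ) : lagMk c M ∈ ⋀[ℂ]^3 W6 :=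
  add_mem (Submodule.smul_mem _ _ (plBasis_mem _)) (sum_mem fun _ _ => sum_mem fun _ _ =>
    add_mem (Submodule.smul_mem _ _ (plBasis_mem _)) (Submodule.smul_mem _ _ (plBasis_mem _)))

lemma plCoord_zero_lagMk (c : ℂ) (M : Matrix (Fin 3) (Fin 3) ℂ) : plCoord 0 (lagMk c M) = c := by
  simp [lagMk, plCoord_plBasis, (plIndex_ne_zero _ _).1.symm, (plIndex_ne_zero _ _).2.symm]

lemma plCoord_nineteen_lagMk (c : ℂ) (M : Matrix (Fin 3) (Fin 3) ℂ) :
    plCoord 19 (lagMk c M) = 0 := by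
  simp [lagMk, plCoord_plBasis, (plIndex_ne_nineteen _ _).1.symm, (plIndex_ne_nineteen _ _).2.symm]

lemma linPart_lagMk (c : ℂ) (M : Matrix (Fin 3) (Fin 3) ℂ) : linPart (lagMk c M) = M := by
  ext i j
  simp [linPart_apply, lagMk, plCoord_plBasis, (plIndex_ne_zero _ _).1, plIndex_ne_rev_plIndex,
    plIndex_inj, ite_and]

lemma quadPart_lagMk (c : ℂ) (M : Matrix (Fin 3) (Fin 3) ℂ) :
    quadPart (lagMk c M) = polarity M := by
  ext i j
  simp [quadPart_apply, lagMk, plCoord_plBasis, (plIndex_ne_zero _ _).2,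
    (plIndex_ne_rev_plIndex _ _ _ _).symm, plIndex_inj, ite_and]

lemma lagMk_mem_lagA (c : ℂ) (M : Matrix (Fin 3) (Fin 3) ℂ) : lagMk c M ∈ lagA :=
  mem_lagA_iff.2 ⟨lagMk_mem_exteriorPower c M, plCoord_nineteen_lagMk c M, by
    rw [quadPart_lagMk, linPart_lagMk]⟩

lemma lagMk_eq_of_mem_lagA {ω : ExteriorAlgebra ℂ W6} (h : ω ∈ lagA) :
    lagMk (plCoord 0 ω) (linPart ω) = ω := by
  obtain ⟨h3, h19, hquad⟩ := mem_lagA_iff.1 h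
  exact eq_of_parts_eq (lagMk_mem_exteriorPower _ _) h3 (plCoord_zero_lagMk _ _)
    (linPart_lagMk _ _) (by rw [quadPart_lagMk, hquad]) (by rw [plCoord_nineteen_lagMk, h19])

/-- The coordinates on `lagA`. -/
def lagEquiv : lagA ≃ₗ[ℂ] ℂ × Matrix (Fin 3) (Fin 3) ℂ where
  toFun ω := (plCoord 0 ω, linPart ω)
  map_add' _ _ := by simp
  map_smul' _ _ := by simp
  invFun c := ⟨lagMk c.1 c.2, lagMk_mem_lagA _ _⟩
  left_inv ω := Subtype.ext (lagMk_eq_of_mem_lagA ω.2)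
  right_inv c := by simp [plCoord_zero_lagMk, linPart_lagMk]

lemma isLagrangian_lagA : IsLagrangian lagA := by
  refine ⟨fun _ h => (mem_lagA_iff.1 h).1, ?_, fun a ha b hb => ?_⟩
  · rw [lagEquiv.finrank_eq, Module.finrank_prod, Module.finrank_matrix]
    simp
  · obtain ⟨ha3, ha19, haquad⟩ := mem_lagA_iff.1 ha
    obtain ⟨hb3, hb19, hbquad⟩ := mem_lagA_iff.1 hb
    rw [mul_eq_sum_parts ha3 hb3, ha19, hb19, haquad, hbquad, sum_mul_polarity_comm]
    simp

lemma mem_lagA_of_mul_eq_zero {ω : ExteriorAlgebra ℂ W6} (hω : ω ∈ ⋀[ℂ]^3 W6)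
    (h : ∀ a ∈ lagA, ω * a = 0) : ω ∈ lagA := by
  have hpair (c : ℂ) (M : Matrix (Fin 3) (Fin 3) ℂ) : -(plCoord 19 ω * c) +
      (∑ i, ∑ j, polarity (linPart ω) i j * M i j - ∑ i, ∑ j, quadPart ω i j * M i j) = 0 := by
    have := h _ (lagMk_mem_lagA c M)
    rw [mul_eq_sum_parts hω (lagMk_mem_exteriorPower c M), plCoord_zero_lagMk,
      plCoord_nineteen_lagMk, linPart_lagMk, quadPart_lagMk, sum_mul_polarity_comm] at this
    simpa using (smul_eq_zero.1 this).resolve_right volW_ne_zero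
  refine mem_lagA_iff.2 ⟨hω, by simpa using hpair 1 0, ?_⟩
  ext i j
  have := hpair 0 (Matrix.single i j 1)
  simp only [Matrix.single_apply, mul_zero, neg_zero, mul_ite, mul_one, ite_and,
    Finset.sum_ite_irrel, Finset.sum_ite_eq, Finset.mem_univ, if_true, Finset.sum_const_zero,
    zero_add] at this
  exact (sub_eq_zero.1 this).symm

lemma lagMk_zero (c : ℂ) : lagMk c 0 = c • plBasis 0 := by
  simp [lagMk]

lemma plBasis_zero_mem_lagA : plBasis 0 ∈ lagA := by
  rw [← one_smul ℂ (plBasis 0), ← lagMk_zero]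
  exact lagMk_mem_lagA 1 0

lemma eq_smul_plBasis_zero {ω : ExteriorAlgebra ℂ W6} (h : ω ∈ lagA) (h0 : linPart ω = 0) :
    ω = plCoord 0 ω • plBasis 0 := by
  rw [← lagMk_zero, ← h0, lagMk_eq_of_mem_lagA h]

lemma lagA_le_filt1 : lagA ≤ filt1 := by
  intro ω h
  have hb (k : Fin 20) (hk : plTriple k 0 < 3) : plBasis k ∈ filt1 := by
    refine Submodule.subset_span ⟨_, ?_, _, _, rfl⟩
    obtain ⟨h0, h1, h2⟩ := stdE_mem_planeU
    generalize plTriple k 0 = i at hk ⊢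
    obtain rfl | rfl | rfl : i = 0 ∨ i = 1 ∨ i = 2 := by omega
    · exact h0
    · exact h1
    · exact h2
  have ht : ∀ i j, plTriple (plIndex i j) 0 < 3 ∧ plTriple (plIndex i j).rev 0 < 3 := by decide
  rw [← lagMk_eq_of_mem_lagA h, lagMk]
  exact add_mem (Submodule.smul_mem _ _ (hb _ (by decide))) (sum_mem fun i _ => sum_mem fun j _ =>
    add_mem (Submodule.smul_mem _ _ (hb _ (ht i j).1)) (Submodule.smul_mem _ _ (hb _ (ht i j).2)))

lemma plCoord_zero_wedge3 (z v w : W6) :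
    plCoord 0 (wedge3 z v w) = lo z ⬝ᵥ crossProduct (lo v) (lo w) := by
  rw [plCoord_wedge3, triple_product_eq_det]
  congr 1
  ext i j
  fin_cases i <;> fin_cases j <;> rfl

lemma plCoord_nineteen_wedge3 (z v w : W6) :
    plCoord 19 (wedge3 z v w) = hi z ⬝ᵥ hiCross v w := by
  rw [plCoord_wedge3, hiCross, triple_product_eq_det]
  congr 1
  ext i j
  fin_cases i <;> fin_cases j <;> rfl

section PlaneU

variable {x : W6} (hx : x ∈ planeU) (v w : W6)
include hx

lemma linPart_wedge3 : linPart (wedge3 x v w) = Matrix.vecMulVec (lo x) (hiCross v w) := by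
  obtain ⟨h3, h4, h5⟩ := eq_zero_of_mem_planeU hx
  ext i j
  rw [linPart_apply, plCoord_wedge3, Matrix.det_fin_three]
  fin_cases i <;> fin_cases j <;>
    simp [plIndex, plTriple, lo_apply, hi_apply, hiCross, cross_apply, Matrix.vecMulVec_apply,
      h3, h4, h5] <;> ring

lemma quadPart_wedge3 : quadPart (wedge3 x v w) =
    Matrix.vecMulVec (crossProduct (lo x) (lo v)) (hi w) -
      Matrix.vecMulVec (crossProduct (lo x) (lo w)) (hi v) := by
  obtain ⟨h3, h4, h5⟩ := eq_zero_of_mem_planeU hx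
  ext i j
  rw [quadPart_apply, plCoord_wedge3, Matrix.det_fin_three]
  fin_cases i <;> fin_cases j <;>
    simp [plIndex, plTriple, Fin.rev, lo_apply, hi_apply, cross_apply,
      h3, h4, h5] <;> ring

end PlaneU

lemma filt2_le_ker_linPart : filt2 ≤ LinearMap.ker linPart := by
  rw [filt2, Submodule.span_le]
  rintro _ ⟨p, hp, q, hq, r, rfl⟩
  rw [SetLike.mem_coe, LinearMap.mem_ker, linPart_wedge3 hp, hiCross,
    mem_planeU_iff_hi_eq_zero.1 hq]
  simp

lemma lagA_inf_filt2 : lagA ⊓ filt2 = filt3 := by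
  apply le_antisymm
  · rintro ω ⟨h1, h2⟩
    rw [eq_smul_plBasis_zero h1 (filt2_le_ker_linPart h2)]
    exact Submodule.smul_mem _ _ (Submodule.subset_span
      ⟨_, stdE_mem_planeU.1, _, stdE_mem_planeU.2.1, _, stdE_mem_planeU.2.2, rfl⟩)
  · rw [filt3, Submodule.span_le]
    rintro _ ⟨p, hp, q, hq, r, hr, rfl⟩
    refine ⟨mem_lagA_iff.2 ⟨wedge3_mem _ _ _, ?_, ?_⟩,
      Submodule.subset_span ⟨p, hp, q, hq, r, rfl⟩⟩
    · simp [plCoord_nineteen_wedge3, mem_planeU_iff_hi_eq_zero.1 hp]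
    · simp [linPart_wedge3 hp, quadPart_wedge3 hp, hiCross, mem_planeU_iff_hi_eq_zero.1 hq,
        mem_planeU_iff_hi_eq_zero.1 hr]

/-! ## Planes of `ℙ⁵` -/

/-- The subspace spanned by three vectors, a plane of `ℙ⁵` when `p ∧ q ∧ r ≠ 0`. -/
def span3 (p q r : W6) : Submodule ℂ W6 := Submodule.span ℂ {p, q, r}

section Span3

variable {p q r p' q' r' z : W6}

lemma mem_span3 : z ∈ span3 p q r ↔ ∃ a b c : ℂ, a • p + b • q + c • r = z :=
  Submodule.mem_span_triple

lemma left_mem_span3 (p q r : W6) : p ∈ span3 p q r := Submodule.subset_span (by simp)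

lemma middle_mem_span3 (p q r : W6) : q ∈ span3 p q r := Submodule.subset_span (by simp)

lemma right_mem_span3 (p q r : W6) : r ∈ span3 p q r := Submodule.subset_span (by simp)

lemma span3_eq_span_range (p q r : W6) :
    span3 p q r = Submodule.span ℂ (Set.range ![p, q, r]) := by
  simp only [span3, Matrix.range_cons, Matrix.range_empty, Set.union_empty, Set.singleton_union]

lemma wedge3_ne_zero_iff : wedge3 p q r ≠ 0 ↔ LinearIndependent ℂ ![p, q, r] := by
  rw [wedge3_eq_ιMulti, ne_eq, ιMulti_eq_zero_iff, not_not]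

lemma finrank_span3 (h : wedge3 p q r ≠ 0) : Module.finrank ℂ (span3 p q r) = 3 := by
  rw [span3_eq_span_range, finrank_span_eq_card (wedge3_ne_zero_iff.1 h), Fintype.card_fin]

lemma mem_span3_iff (h : wedge3 p q r ≠ 0) :
    z ∈ span3 p q r ↔ ExteriorAlgebra.ι ℂ z * wedge3 p q r = 0 := by
  rw [span3_eq_span_range, wedge3_eq_ιMulti,
    mem_span_range_iff_ι_mul_ιMulti_eq_zero (wedge3_ne_zero_iff.1 h)]

lemma wedge3_mul_wedge3_eq_zero_iff (h : wedge3 p q r ≠ 0) (h' : wedge3 p' q' r' ≠ 0) :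
    wedge3 p q r * wedge3 p' q' r' = 0 ↔ span3 p q r ⊓ span3 p' q' r' ≠ ⊥ := by
  rw [wedge3_eq_ιMulti, wedge3_eq_ιMulti, ιMulti_mul_ιMulti_eq_zero_iff
    (wedge3_ne_zero_iff.1 h) (wedge3_ne_zero_iff.1 h'), span3_eq_span_range, span3_eq_span_range]

lemma exists_wedge3_eq_smul (hp : p' ∈ span3 p q r) (hq : q' ∈ span3 p q r)
    (hr : r' ∈ span3 p q r) : ∃ c : ℂ, wedge3 p' q' r' = c • wedge3 p q r := by
  obtain ⟨a₁, a₂, a₃, rfl⟩ := mem_span3.1 hp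
  obtain ⟨b₁, b₂, b₃, rfl⟩ := mem_span3.1 hq
  obtain ⟨c₁, c₂, c₃, rfl⟩ := mem_span3.1 hr
  refine ⟨Matrix.det !![a₁, a₂, a₃; b₁, b₂, b₃; c₁, c₂, c₃], eq_of_plCoord_eq (wedge3_mem _ _ _)
    (Submodule.smul_mem _ _ (wedge3_mem _ _ _)) fun k => ?_⟩
  rw [map_smul, plCoord_wedge3, plCoord_wedge3, smul_eq_mul, ← Matrix.det_mul]
  congr 1
  ext i j
  fin_cases i <;> simp [Matrix.mul_apply, Fin.sum_univ_three]

lemma span3_eq_of_wedge3_eq_smul {c : ℂ} (h' : wedge3 p' q' r' ≠ 0)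
    (h : wedge3 p' q' r' = c • wedge3 p q r) : span3 p' q' r' = span3 p q r := by
  have hc : c ≠ 0 := fun hc => h' (by rw [h, hc, zero_smul])
  have h0 : wedge3 p q r ≠ 0 := fun h0 => h' (by rw [h, h0, smul_zero])
  ext z
  rw [mem_span3_iff h', mem_span3_iff h0, h, mul_smul_comm, smul_eq_zero_iff_right hc]

lemma wedge3_mem_iff_of_span3 {A : Submodule ℂ (ExteriorAlgebra ℂ W6)} :
    (∀ p' ∈ span3 p q r, ∀ q' ∈ span3 p q r, ∀ r' ∈ span3 p q r, wedge3 p' q' r' ∈ A) ↔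
      wedge3 p q r ∈ A := by
  refine ⟨fun h => h _ (left_mem_span3 p q r) _ (middle_mem_span3 p q r) _ (right_mem_span3 p q r),
    fun h p' hp q' hq r' hr => ?_⟩
  obtain ⟨c, hc⟩ := exists_wedge3_eq_smul hp hq hr
  exact hc ▸ A.smul_mem c h

lemma span3_mem_planesIn_iff {A : Submodule ℂ (ExteriorAlgebra ℂ W6)} (h : wedge3 p q r ≠ 0) :
    span3 p q r ∈ planesIn A ↔ wedge3 p q r ∈ A :=
  ⟨fun h' => wedge3_mem_iff_of_span3.1 h'.2,
    fun h' => ⟨finrank_span3 h, wedge3_mem_iff_of_span3.2 h'⟩⟩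

lemma exists_eq_span3_of_mem {P : Submodule ℂ W6} (hP : Module.finrank ℂ P = 3) (hp : p ∈ P)
    (hp0 : p ≠ 0) : ∃ v w, wedge3 p v w ≠ 0 ∧ P = span3 p v w := by
  have hp0' : (⟨p, hp⟩ : P) ≠ 0 := fun h => hp0 (congrArg Subtype.val h)
  obtain ⟨v, hv⟩ := exists_linearIndependent_pair_of_one_lt_finrank (R := ℂ) (by omega) hp0'
  obtain ⟨w, hw⟩ := exists_linearIndependent_snoc_of_lt_finrank hv (by omega)
  have hvec : P.subtype ∘ (Fin.snoc ![⟨p, hp⟩, v] w : Fin 3 → P) = ![p, v, w] := by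
    ext i j
    fin_cases i <;> rfl
  have hli : LinearIndependent ℂ ![p, v, w] := hvec ▸ hw.map' P.subtype P.ker_subtype
  refine ⟨v, w, wedge3_ne_zero_iff.2 hli, (Submodule.eq_of_le_of_finrank_eq ?_ ?_).symm⟩
  · rw [span3, Submodule.span_le]
    rintro _ (rfl | rfl | rfl)
    exacts [hp, v.2, w.2]
  · rw [finrank_span3 (wedge3_ne_zero_iff.2 hli), hP]

end Span3

/-! ## Decomposable vectors of the Lagrangian subspace -/

section RankTwo

variable {R : Type*} [CommRing R]

lemma vRamGradX_eq_polarity_mulVec (x y : Fin 3 → R) :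
    vRamGradX x y = (polarity (Matrix.vecMulVec x y)).mulVec y := by
  ext i
  fin_cases i <;>
    simp [vRamGradX, gradConicA, gradConicB, conicA, conicB, polarity_apply, Matrix.vecMulVec_apply,
      Matrix.mulVec, dotProduct, Fin.sum_univ_three] <;> ring

lemma vRamGradY_eq_vecMul_polarity (x y : Fin 3 → R) :
    vRamGradY x y = Matrix.vecMul x (polarity (Matrix.vecMulVec x y)) := by
  ext i
  fin_cases i <;>
    simp [vRamGradY, gradConicA, gradConicB, conicA, conicB, polarity_apply, Matrix.vecMulVec_apply,
      Matrix.vecMul, dotProduct, Fin.sum_univ_three] <;> ring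

lemma adjugate_vecMulVec_sub_vecMulVec (a b c d : Fin 3 → R) :
    (Matrix.vecMulVec a b - Matrix.vecMulVec c d).adjugate.transpose =
      -Matrix.vecMulVec (crossProduct a c) (crossProduct b d) := by
  ext i j
  fin_cases i <;> fin_cases j <;>
    simp [Matrix.adjugate_fin_three, Matrix.vecMulVec_apply, cross_apply] <;> ring

lemma cross_cross_cross_eq_smul (x v w : Fin 3 → R) :
    crossProduct (crossProduct x v) (crossProduct x w) = (x ⬝ᵥ crossProduct v w) • x := by
  rw [cross_cross_eq_smul_sub_smul, dot_self_cross, triple_product_permutation,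
    ← cross_anticomm v w, dotProduct_neg, zero_smul, zero_sub, neg_smul, neg_neg]

lemma vecMulVec_cross_add_vecMulVec_cross_add (p q u : Fin 3 → R) :
    Matrix.vecMulVec (crossProduct q u) p + Matrix.vecMulVec (crossProduct u p) q +
      Matrix.vecMulVec (crossProduct p q) u = (u ⬝ᵥ crossProduct p q) • 1 := by
  ext i j
  simp only [Matrix.add_apply, Matrix.vecMulVec_apply, Matrix.smul_apply]
  fin_cases i <;> fin_cases j <;>
    simp [cross_apply, dotProduct, Fin.sum_univ_three] <;> ring

end RankTwo

section Field

variable {K : Type*} [Field K]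

lemma exists_dotProduct_eq_one {n : Type*} [Fintype n] {x : n → K} (hx : x ≠ 0) :
    ∃ u, u ⬝ᵥ x = 1 := by
  classical
  obtain ⟨i, hi⟩ := Function.ne_iff.1 hx
  exact ⟨Pi.single i (x i)⁻¹, by rw [single_dotProduct, inv_mul_cancel₀ hi]⟩

lemma exists_cross_eq_of_dotProduct_eq_zero {x s : Fin 3 → K} (hx : x ≠ 0)
    (hs : x ⬝ᵥ s = 0) : ∃ a, crossProduct x a = s := by
  obtain ⟨u, hu⟩ := exists_dotProduct_eq_one hx
  refine ⟨crossProduct s u, ?_⟩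
  rw [cross_cross_eq_smul_sub_smul', dotProduct_comm x, hu, dotProduct_comm s, hs, one_smul,
    zero_smul, sub_zero]

lemma exists_cross_eq (y : Fin 3 → K) : ∃ p q, crossProduct p q = y := by
  obtain ⟨p, hp, hpy⟩ : ∃ p : Fin 3 → K, p ≠ 0 ∧ p ⬝ᵥ y = 0 := by
    by_cases h : y 0 = 0
    · exact ⟨Pi.single 0 1, by simp, by rw [single_dotProduct, h, mul_zero]⟩
    · exact ⟨![y 1, -y 0, 0], fun h' => h (by simpa using congrFun h' 1), by
        rw [Matrix.vec3_dotProduct]; simp [mul_comm]⟩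
  obtain ⟨q, hq⟩ := exists_cross_eq_of_dotProduct_eq_zero hp hpy
  exact ⟨p, q, hq⟩

lemma exists_smul_of_vecMulVec_eq_smul {m n : Type*} {x x' : m → K} {y y' : n → K} {c : K}
    (hy : y ≠ 0) (h : Matrix.vecMulVec x y = c • Matrix.vecMulVec x' y') :
    ∃ a : K, x = a • x' := by
  obtain ⟨j, hj⟩ := Function.ne_iff.1 hy
  refine ⟨(y j)⁻¹ * c * y' j, ?_⟩
  ext i
  have hij : x i * y j = c * (x' i * y' j) := congrFun (congrFun h i) j
  rw [Pi.smul_apply, smul_eq_mul, eq_comm, ← mul_right_inj' hj, mul_assoc, mul_assoc,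
    mul_inv_cancel_left₀ hj]
  linear_combination -hij

end Field

section PlaneU

variable {x v w : W6} (hx : x ∈ planeU)
include hx

lemma quadPart_wedge3_mulVec : (quadPart (wedge3 x v w)).mulVec (hiCross v w) = 0 := by
  rw [quadPart_wedge3 hx, Matrix.sub_mulVec, Matrix.vecMulVec_mulVec, Matrix.vecMulVec_mulVec,
    hiCross, dot_self_cross, dot_cross_self]
  simp

lemma vecMul_quadPart_wedge3 : Matrix.vecMul (lo x) (quadPart (wedge3 x v w)) = 0 := by
  rw [quadPart_wedge3 hx, Matrix.vecMul_sub, Matrix.vecMul_vecMulVec, Matrix.vecMul_vecMulVec,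
    dot_self_cross, dot_self_cross]
  simp

lemma adjugate_quadPart_wedge3 : (quadPart (wedge3 x v w)).adjugate.transpose =
    plCoord 0 (wedge3 x v w) • linPart (wedge3 x v w) := by
  rw [quadPart_wedge3 hx, adjugate_vecMulVec_sub_vecMulVec, cross_cross_cross_eq_smul,
    linPart_wedge3 hx, plCoord_zero_wedge3, hiCross, ← cross_anticomm (hi v), Matrix.vecMulVec_neg,
    neg_neg, Matrix.smul_vecMulVec]

lemma vRamGrad_eq_zero_of_wedge3_mem_lagA (h : wedge3 x v w ∈ lagA) :
    vRamGradX (lo x) (hiCross v w) = 0 ∧ vRamGradY (lo x) (hiCross v w) = 0 := by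
  rw [vRamGradX_eq_polarity_mulVec, vRamGradY_eq_vecMul_polarity, ← linPart_wedge3 hx,
    ← (mem_lagA_iff.1 h).2.2]
  exact ⟨quadPart_wedge3_mulVec hx, vecMul_quadPart_wedge3 hx⟩

lemma wedge3_eq_wedge3_of_linPart_eq {x' v' w' : W6} (hx' : x' ∈ planeU)
    (h : wedge3 x v w ∈ lagA) (h' : wedge3 x' v' w' ∈ lagA) (h0 : linPart (wedge3 x v w) ≠ 0)
    (hlin : linPart (wedge3 x v w) = linPart (wedge3 x' v' w')) :
    wedge3 x v w = wedge3 x' v' w' := by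
  have hquad : quadPart (wedge3 x v w) = quadPart (wedge3 x' v' w') := by
    rw [(mem_lagA_iff.1 h).2.2, (mem_lagA_iff.1 h').2.2, hlin]
  have h1 : plCoord 0 (wedge3 x v w) = plCoord 0 (wedge3 x' v' w') := by
    refine smul_left_injective ℂ h0 ?_
    simp only
    rw [← adjugate_quadPart_wedge3 hx, hquad, adjugate_quadPart_wedge3 hx', hlin]
  rw [← lagMk_eq_of_mem_lagA h, ← lagMk_eq_of_mem_lagA h', h1, hlin]

end PlaneU

lemma exists_wedge3_mem_lagA {x y : Fin 3 → ℂ} (hx : x ≠ 0) (hy : y ≠ 0)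
    (h1 : vRamGradX x y = 0) (h2 : vRamGradY x y = 0) :
    ∃ X ∈ planeU, ∃ v w, lo X = x ∧ hiCross v w = y ∧ wedge3 X v w ∈ lagA := by
  set S := polarity (Matrix.vecMulVec x y) with hS
  have hSy : S.mulVec y = 0 := by rw [hS, ← vRamGradX_eq_polarity_mulVec, h1]
  have hxS (z : Fin 3 → ℂ) : x ⬝ᵥ S.mulVec z = 0 := by
    rw [Matrix.dotProduct_mulVec, hS, ← vRamGradY_eq_vecMul_polarity, h2, zero_dotProduct]
  obtain ⟨u, hu⟩ := exists_dotProduct_eq_one hy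
  obtain ⟨p, q, rfl⟩ := exists_cross_eq y
  obtain ⟨a, ha⟩ := exists_cross_eq_of_dotProduct_eq_zero hx (hxS (crossProduct u p))
  obtain ⟨b, hb⟩ := exists_cross_eq_of_dotProduct_eq_zero hx (hxS (crossProduct u q))
  have hsplit : Matrix.vecMulVec (S.mulVec (crossProduct u p)) q -
      Matrix.vecMulVec (S.mulVec (crossProduct u q)) p = S := by
    have h := congrArg (S * ·) (vecMulVec_cross_add_vecMulVec_cross_add p q u)
    simp only [hu, one_smul, mul_one, mul_add, Matrix.mul_vecMulVec, hSy] at h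
    rw [← cross_anticomm u q, Matrix.mulVec_neg, Matrix.neg_vecMulVec, Matrix.zero_vecMulVec,
      add_zero] at h
    rwa [sub_eq_neg_add]
  let X : W6 := Fin.append x (0 : Fin 3 → ℂ)
  have hX : X ∈ planeU := mem_planeU_iff_hi_eq_zero.2 (hi_append _ _)
  have hloX : lo X = x := lo_append _ _
  have hcross : hiCross (Fin.append a p) (Fin.append b q) = crossProduct p q := by
    rw [hiCross, hi_append, hi_append]
  refine ⟨X, hX, Fin.append a p, Fin.append b q, hloX, hcross,
    mem_lagA_iff.2 ⟨wedge3_mem _ _ _, ?_, ?_⟩⟩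
  · rw [plCoord_nineteen_wedge3, mem_planeU_iff_hi_eq_zero.1 hX, zero_dotProduct]
  · rw [quadPart_wedge3 hX, linPart_wedge3 hX, hcross, hloX, lo_append, lo_append,
      hi_append, hi_append, ha, hb, hsplit]

/-! ## The twenty planes -/

lemma planeU_eq_span3 : planeU = span3 (stdE 0) (stdE 1) (stdE 2) := rfl

lemma plBasis_ne_zero (k : Fin 20) : plBasis k ≠ 0 := by
  intro h
  have := plCoord_plBasis k k
  rw [h, map_zero, if_pos rfl] at this
  exact zero_ne_one this

lemma planeU_mem_planesIn : planeU ∈ planesIn lagA :=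
  (span3_mem_planesIn_iff (plBasis_ne_zero 0)).2 plBasis_zero_mem_lagA

lemma exists_eq_span3 {P : Submodule ℂ W6} (hP : Module.finrank ℂ P = 3) :
    ∃ p q r, wedge3 p q r ≠ 0 ∧ P = span3 p q r := by
  obtain ⟨p, hp, hp0⟩ := P.exists_mem_ne_zero_of_ne_bot (by
    rintro rfl
    simp at hP)
  exact ⟨p, exists_eq_span3_of_mem hP hp hp0⟩

lemma inf_ne_bot_of_mem_planesIn {A : Submodule ℂ (ExteriorAlgebra ℂ W6)} (hA : IsLagrangian A)
    {P Q : Submodule ℂ W6} (hP : P ∈ planesIn A) (hQ : Q ∈ planesIn A) : P ⊓ Q ≠ ⊥ := by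
  obtain ⟨p, q, r, h, rfl⟩ := exists_eq_span3 hP.1
  obtain ⟨p', q', r', h', rfl⟩ := exists_eq_span3 hQ.1
  exact (wedge3_mul_wedge3_eq_zero_iff h h').1
    (hA.2.2 _ ((span3_mem_planesIn_iff h).1 hP) _ ((span3_mem_planesIn_iff h').1 hQ))

/-- `P` is the plane of `ℙ(lagA)` other than `ℙ(U)` that corresponds to the singular point `p` of
`vRam`: it meets `ℙ(U)` in the first component of `p` and lies in the hyperplane given by the second
one. -/
def IsPlaneOver (p : P2 × P2) (P : Submodule ℂ W6) : Prop :=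
  ∃ x ∈ planeU, ∃ v w, lo x = p.1.rep ∧ hiCross v w = p.2.rep ∧ wedge3 x v w ∈ lagA ∧
    P = span3 x v w

lemma linPart_wedge3_ne_zero {x v w : W6} (hx : x ∈ planeU) (h1 : lo x ≠ 0)
    (h2 : hiCross v w ≠ 0) : linPart (wedge3 x v w) ≠ 0 := by
  rw [linPart_wedge3 hx]
  exact Matrix.vecMulVec_ne_zero h1 h2

lemma wedge3_ne_zero_of_linPart_ne_zero {x v w : W6} (h : linPart (wedge3 x v w) ≠ 0) :
    wedge3 x v w ≠ 0 := fun h0 => h (by rw [h0, map_zero])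

lemma exists_isPlaneOver {p : P2 × P2} (hp : p ∈ biSing vRam) : ∃ P, IsPlaneOver p P := by
  obtain ⟨h1, h2⟩ := (mem_biSing_vRam_iff p).1 hp
  obtain ⟨x, hx, v, w, hlo, hhi, h⟩ :=
    exists_wedge3_mem_lagA p.1.rep_nonzero p.2.rep_nonzero h1 h2
  exact ⟨_, x, hx, v, w, hlo, hhi, h, rfl⟩

namespace IsPlaneOver

variable {p p' : P2 × P2} {P P' : Submodule ℂ W6}

lemma mem_biSing (h : IsPlaneOver p P) : p ∈ biSing vRam := by
  obtain ⟨x, hx, v, w, hlo, hhi, hA, -⟩ := h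
  rw [mem_biSing_vRam_iff, ← hlo, ← hhi]
  exact vRamGrad_eq_zero_of_wedge3_mem_lagA hx hA

lemma mem_planesIn (h : IsPlaneOver p P) : P ∈ planesIn lagA := by
  obtain ⟨x, hx, v, w, hlo, hhi, hA, rfl⟩ := h
  exact (span3_mem_planesIn_iff (wedge3_ne_zero_of_linPart_ne_zero (linPart_wedge3_ne_zero hx
    (hlo ▸ p.1.rep_nonzero) (hhi ▸ p.2.rep_nonzero)))).2 hA

lemma ne_planeU (h : IsPlaneOver p P) : P ≠ planeU := by
  obtain ⟨x, -, v, w, -, hhi, -, rfl⟩ := h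
  intro hU
  have hv : hi v = 0 := mem_planeU_iff_hi_eq_zero.1 (hU ▸ middle_mem_span3 x v w)
  exact p.2.rep_nonzero (by rw [← hhi, hiCross, hv, map_zero, LinearMap.zero_apply])

lemma eq_plane (h : IsPlaneOver p P) (h' : IsPlaneOver p P') : P = P' := by
  obtain ⟨x, hx, v, w, hlo, hhi, hA, rfl⟩ := h
  obtain ⟨x', hx', v', w', hlo', hhi', hA', rfl⟩ := h'
  have h0 := linPart_wedge3_ne_zero hx (hlo ▸ p.1.rep_nonzero) (hhi ▸ p.2.rep_nonzero)
  have heq := wedge3_eq_wedge3_of_linPart_eq hx hx' hA hA' h0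
    (by rw [linPart_wedge3 hx, linPart_wedge3 hx', hlo, hlo', hhi, hhi'])
  exact span3_eq_of_wedge3_eq_smul (wedge3_ne_zero_of_linPart_ne_zero h0)
    (by rw [heq, one_smul])

lemma eq_point (h : IsPlaneOver p P) (h' : IsPlaneOver p' P) : p = p' := by
  obtain ⟨x, hx, v, w, hlo, hhi, -, rfl⟩ := h
  obtain ⟨x', hx', v', w', hlo', hhi', -, hP⟩ := h'
  obtain ⟨c, hc⟩ := exists_wedge3_eq_smul (hP ▸ left_mem_span3 x v w) (hP ▸ middle_mem_span3 x v w)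
    (hP ▸ right_mem_span3 x v w)
  have hlin := congrArg linPart hc
  rw [map_smul, linPart_wedge3 hx, linPart_wedge3 hx', hlo, hlo', hhi, hhi'] at hlin
  obtain ⟨a, ha⟩ := exists_smul_of_vecMulVec_eq_smul p.2.rep_nonzero hlin
  obtain ⟨b, hb⟩ := exists_smul_of_vecMulVec_eq_smul (c := c) (y' := p'.1.rep) p.1.rep_nonzero
    (by rw [← Matrix.transpose_vecMulVec, hlin, Matrix.transpose_smul, Matrix.transpose_vecMulVec])
  refine Prod.ext ?_ ?_
  · rw [← p.1.mk_rep]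
    exact mk_eq_of_smul_eq_smul_rep _ one_ne_zero (by rw [one_smul, ha])
  · rw [← p.2.mk_rep]
    exact mk_eq_of_smul_eq_smul_rep _ one_ne_zero (by rw [one_smul, hb])

end IsPlaneOver

lemma exists_wedge3_of_mem_planesIn_lagA {P : Submodule ℂ W6} (hP : P ∈ planesIn lagA)
    (hU : P ≠ planeU) : ∃ x ∈ planeU, ∃ v w, lo x ≠ 0 ∧ hiCross v w ≠ 0 ∧ wedge3 x v w ∈ lagA ∧
      P = span3 x v w := by
  obtain ⟨x, ⟨hxP, hxU⟩, hx0⟩ := (P ⊓ planeU).exists_mem_ne_zero_of_ne_bot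
    (inf_ne_bot_of_mem_planesIn isLagrangian_lagA hP planeU_mem_planesIn)
  obtain ⟨v, w, h0, rfl⟩ := exists_eq_span3_of_mem hP.1 hxP hx0
  have hA := (span3_mem_planesIn_iff h0).1 hP
  refine ⟨x, hxU, v, w, fun h => hx0 ?_, fun h => hU ?_, hA, rfl⟩
  · exact eq_of_lo_eq_of_hi_eq (by rw [h, map_zero])
      (by rw [mem_planeU_iff_hi_eq_zero.1 hxU, map_zero])
  · exact span3_eq_of_wedge3_eq_smul h0 (eq_smul_plBasis_zero hA
      (by rw [linPart_wedge3 hxU, h, Matrix.vecMulVec_zero]))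

lemma exists_isPlaneOver_of_mem_planesIn {P : Submodule ℂ W6} (hP : P ∈ planesIn lagA)
    (hU : P ≠ planeU) : ∃ p, IsPlaneOver p P := by
  obtain ⟨x, hx, v, w, h1, h2, hA, rfl⟩ := exists_wedge3_of_mem_planesIn_lagA hP hU
  obtain ⟨a, ha, hrep1⟩ := exists_rep_mk_eq_smul (K := ℂ) h1
  obtain ⟨b, hb, hrep2⟩ := exists_rep_mk_eq_smul (K := ℂ) h2
  have hsmul : wedge3 (a • x) (b • v) w = (a * b) • wedge3 x v w := by
    simp only [wedge3, map_smul, smul_mul_assoc, mul_smul_comm, mul_smul]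
    rw [smul_comm]
  have h0 : wedge3 x v w ≠ 0 :=
    wedge3_ne_zero_of_linPart_ne_zero (linPart_wedge3_ne_zero hx h1 h2)
  refine ⟨(.mk ℂ _ h1, .mk ℂ _ h2), a • x, planeU.smul_mem a hx, b • v, w, ?_, ?_,
    hsmul ▸ lagA.smul_mem _ hA, (span3_eq_of_wedge3_eq_smul ?_ hsmul).symm⟩
  · rw [map_smul, hrep1]
  · rw [hrep2, hiCross, hiCross, map_smul, map_smul, LinearMap.smul_apply]
  · rw [hsmul]
    exact smul_ne_zero (mul_ne_zero ha hb) h0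

lemma ncard_planesIn_lagA : (planesIn lagA).ncard = 20 := by
  choose! plane hplane using fun p hp => exists_isPlaneOver (p := p) hp
  have h19 : (planesIn lagA \ {planeU}).ncard = 19 := by
    rw [← ncard_biSing_vRam]
    symm
    refine Set.ncard_congr (fun p _ => plane p) (fun p hp => ?_) (fun p q hp hq hpq => ?_) ?_
    · exact ⟨(hplane p hp).mem_planesIn, (hplane p hp).ne_planeU⟩
    · exact (hplane p hp).eq_point (hpq ▸ hplane q hq)
    rintro P ⟨hP, hU⟩
    obtain ⟨p, hp⟩ := exists_isPlaneOver_of_mem_planesIn hP hU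
    exact ⟨p, hp.mem_biSing, (hplane p hp.mem_biSing).eq_plane hp⟩
  have hfin : (planesIn lagA \ {planeU}).Finite := Set.finite_of_ncard_ne_zero (by omega)
  rw [← Set.ncard_sdiff_singleton_add_one planeU_mem_planesIn (hfin.of_sdiff
    (Set.finite_singleton _)), h19]

lemma exists_wedge3_mem_lagA_linPart_eq_single (i j : Fin 3) :
    ∃ x v w, wedge3 x v w ∈ lagA ∧ linPart (wedge3 x v w) = Matrix.single i j 1 := by
  have hpt (k : Fin 3) : intVec (basePt k.castSucc) = Pi.single k (1 : ℂ) := by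
    ext l
    fin_cases k <;> fin_cases l <;> simp [intVec, basePt]
  have hgrad := vRamGrad_basePt i.castSucc j.castSucc 1 1
  rw [one_smul, one_smul, hpt, hpt] at hgrad
  obtain ⟨x, hx, v, w, hlo, hhi, h⟩ :=
    exists_wedge3_mem_lagA (by simp) (by simp) hgrad.1 hgrad.2
  rw [Matrix.single_eq_single_vecMulVec_single]
  exact ⟨x, v, w, h, by rw [linPart_wedge3 hx, hlo, hhi]⟩

lemma lagA_eq_span : lagA = Submodule.span ℂ
    {e | ∃ P ∈ planesIn lagA, ∃ p ∈ P, ∃ q ∈ P, ∃ r ∈ P, e = wedge3 p q r} := by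
  set E := Submodule.span ℂ
    {e | ∃ P ∈ planesIn lagA, ∃ p ∈ P, ∃ q ∈ P, ∃ r ∈ P, e = wedge3 p q r} with hE
  have hwedge {p q r : W6} (h : wedge3 p q r ∈ lagA) : wedge3 p q r ∈ E := by
    by_cases h0 : wedge3 p q r = 0
    · rw [h0]
      exact E.zero_mem
    · exact Submodule.subset_span ⟨_, (span3_mem_planesIn_iff h0).2 h, p, left_mem_span3 p q r,
        q, middle_mem_span3 p q r, r, right_mem_span3 p q r, rfl⟩
  refine le_antisymm (fun ω hω => ?_) ?_
  · choose x v w hA hlin using exists_wedge3_mem_lagA_linPart_eq_single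
    have hsub : ω - ∑ i, ∑ j, linPart ω i j • wedge3 (x i j) (v i j) (w i j) ∈ lagA :=
      sub_mem hω (sum_mem fun i _ => sum_mem fun j _ => lagA.smul_mem _ (hA i j))
    have h0 := eq_smul_plBasis_zero hsub (by
      simp only [map_sub, map_sum, map_smul, hlin, Matrix.smul_single, smul_eq_mul, mul_one]
      rw [← Matrix.matrix_eq_sum_single, sub_self])
    rw [sub_eq_iff_eq_add] at h0
    rw [h0]
    exact add_mem (E.smul_mem _ (hwedge plBasis_zero_mem_lagA))
      (sum_mem fun i _ => sum_mem fun j _ => E.smul_mem _ (hwedge (hA i j)))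
  · rw [hE, Submodule.span_le]
    rintro _ ⟨P, hP, p, hp, q, hq, r, hr, rfl⟩
    exact hP.2 p hp q hq r hr

/-! ## The Morin configuration -/

section Tangent

variable {x v w X Y Z : W6}

lemma wedge3_self_left (p q : W6) : wedge3 p p q = 0 := by
  rw [wedge3_eq_ιMulti]
  exact AlternatingMap.map_eq_zero_of_eq _ _ (i := 0) (j := 1) rfl (by decide)

lemma wedge3_self_outer (p q : W6) : wedge3 p q p = 0 := by
  rw [wedge3_eq_ιMulti]
  exact AlternatingMap.map_eq_zero_of_eq _ _ (i := 0) (j := 2) rfl (by decide)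

/-- The derivative of `x ∧ v ∧ w` when `x`, `v` and `w` move with velocities `X`, `Y` and `Z`. -/
def wedge3Deriv (x v w X Y Z : W6) : ExteriorAlgebra ℂ W6 :=
  wedge3 X v w + wedge3 x Y w + wedge3 x v Z

lemma wedge3Deriv_mem : wedge3Deriv x v w X Y Z ∈ ⋀[ℂ]^3 W6 :=
  add_mem (add_mem (wedge3_mem _ _ _) (wedge3_mem _ _ _)) (wedge3_mem _ _ _)

lemma wedge3Deriv_sub_smul_sub_smul (x v w X Y Z : W6) (a b : ℂ) :
    wedge3Deriv x v w (X - a • v - b • w) Y Z = wedge3Deriv x v w X Y Z := by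
  have h : wedge3 (X - a • v - b • w) v w =
      wedge3 X v w - a • wedge3 v v w - b • wedge3 w v w := by
    simp only [wedge3, map_sub, map_smul, sub_mul, smul_mul_assoc]
  rw [wedge3Deriv, h, wedge3_self_left, wedge3_self_outer, smul_zero, smul_zero, sub_zero, sub_zero,
    wedge3Deriv]

lemma span3_swap_left (p q r : W6) : span3 p q r = span3 q p r := by
  rw [span3, span3, Set.insert_comm]

lemma span3_swap_right (p q r : W6) : span3 p q r = span3 p r q := by
  rw [span3, span3, Set.pair_comm]

lemma ι_mul_wedge3_swap (p q r s : W6) :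
    ExteriorAlgebra.ι ℂ q * wedge3 p r s = -(ExteriorAlgebra.ι ℂ p * wedge3 q r s) := by
  simp only [wedge3, ← mul_assoc]
  rw [eq_neg_of_add_eq_zero_left (ExteriorAlgebra.ι_add_mul_swap q p), neg_mul, neg_mul]

lemma ι_mul_wedge3_self (p q r : W6) : ExteriorAlgebra.ι ℂ p * wedge3 p q r = 0 := by
  rw [wedge3, ← mul_assoc, ← mul_assoc, ExteriorAlgebra.ι_sq_zero, zero_mul, zero_mul]

lemma left_mem_span3_of_wedge3Deriv_eq_smul {c : ℂ} (h0 : wedge3 x v w ≠ 0)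
    (h : wedge3Deriv x v w X Y Z = c • wedge3 x v w) : X ∈ span3 x v w := by
  rw [mem_span3_iff h0, ι_mul_wedge3_swap, neg_eq_zero]
  have := congrArg (ExteriorAlgebra.ι ℂ x * ·) h
  simpa only [wedge3Deriv, mul_add, mul_smul_comm, ι_mul_wedge3_self, add_zero, smul_zero]
    using this

lemma wedge3Deriv_swap_left : wedge3Deriv v x w Y X Z = -wedge3Deriv x v w X Y Z := by
  rw [wedge3Deriv, wedge3Deriv, wedge3_swap_left x Y w, wedge3_swap_left X v w,
    wedge3_swap_left x v Z]
  abel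

lemma wedge3Deriv_swap_right : wedge3Deriv x w v X Z Y = -wedge3Deriv x v w X Y Z := by
  rw [wedge3Deriv, wedge3Deriv, wedge3_swap_right X v w, wedge3_swap_right x v Z,
    wedge3_swap_right x Y w]
  abel

lemma middle_mem_span3_of_wedge3Deriv_eq_smul {c : ℂ} (h0 : wedge3 x v w ≠ 0)
    (h : wedge3Deriv x v w X Y Z = c • wedge3 x v w) : Y ∈ span3 x v w := by
  rw [span3_swap_left]
  refine left_mem_span3_of_wedge3Deriv_eq_smul (c := c) (Y := X) (Z := Z) ?_ ?_
  · rwa [wedge3_swap_left x v w, neg_ne_zero]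
  · rw [wedge3Deriv_swap_left, wedge3_swap_left x v w, h, smul_neg]

lemma right_mem_span3_of_wedge3Deriv_eq_smul {c : ℂ} (h0 : wedge3 x v w ≠ 0)
    (h : wedge3Deriv x v w X Y Z = c • wedge3 x v w) : Z ∈ span3 x v w := by
  rw [span3_swap_right]
  refine middle_mem_span3_of_wedge3Deriv_eq_smul (c := c) (X := X) (Z := Y) ?_ ?_
  · rwa [wedge3_swap_right x v w, neg_ne_zero]
  · rw [wedge3Deriv_swap_right, wedge3_swap_right x v w, h, smul_neg]

lemma map_mem_span3_of_wedge3Deriv_eq_smul {τ : span3 x v w →ₗ[ℂ] W6} {c : ℂ}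
    (h0 : wedge3 x v w ≠ 0) (h : wedge3Deriv x v w (τ ⟨x, left_mem_span3 x v w⟩)
      (τ ⟨v, middle_mem_span3 x v w⟩) (τ ⟨w, right_mem_span3 x v w⟩) = c • wedge3 x v w)
    (z : span3 x v w) : τ z ∈ span3 x v w := by
  obtain ⟨z, hz⟩ := z
  obtain ⟨a, b, d, rfl⟩ := mem_span3.1 hz
  have hsum : (⟨a • x + b • v + d • w, hz⟩ : span3 x v w) = a • ⟨x, left_mem_span3 x v w⟩ +
      b • ⟨v, middle_mem_span3 x v w⟩ + d • ⟨w, right_mem_span3 x v w⟩ := rfl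
  rw [hsum, map_add, map_add, map_smul, map_smul, map_smul]
  exact add_mem (add_mem
    (Submodule.smul_mem _ a (left_mem_span3_of_wedge3Deriv_eq_smul h0 h))
    (Submodule.smul_mem _ b (middle_mem_span3_of_wedge3Deriv_eq_smul h0 h)))
    (Submodule.smul_mem _ d (right_mem_span3_of_wedge3Deriv_eq_smul h0 h))

end Tangent

lemma exists_eq_smul_add_smul_of_dotProduct_cross_eq_zero {K : Type*} [Field K]
    {p q z : Fin 3 → K} (h : crossProduct p q ≠ 0) (hz : z ⬝ᵥ crossProduct p q = 0) :
    ∃ a b : K, z = a • p + b • q := by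
  obtain ⟨u, hu⟩ := exists_dotProduct_eq_one h
  have hid := congrArg (Matrix.vecMul z) (vecMulVec_cross_add_vecMulVec_cross_add p q u)
  simp only [hu, one_smul, Matrix.vecMul_add, Matrix.vecMul_vecMulVec, hz, zero_smul, add_zero,
    Matrix.vecMul_one] at hid
  exact ⟨_, _, hid.symm⟩

lemma vRamHess_mulVec_eq_polarity {R : Type*} [CommRing R] (x y x' y' : Fin 3 → R) :
    (vRamHess x y).mulVec (Sum.elim x' y') = Sum.elim
      ((polarity (Matrix.vecMulVec x' y + Matrix.vecMulVec x y')).mulVec y +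
        (polarity (Matrix.vecMulVec x y)).mulVec y')
      (Matrix.vecMul x' (polarity (Matrix.vecMulVec x y)) +
        Matrix.vecMul x (polarity (Matrix.vecMulVec x' y + Matrix.vecMulVec x y'))) := by
  rw [vRamHess_mulVec]
  simp only [gradConicA_dotProduct, gradConicB_dotProduct]
  congr 1 <;> ext i <;> fin_cases i <;>
    simp only [gradConicA, gradConicB, conicA, conicB, polarity_apply, Matrix.vecMulVec_apply,
      Matrix.mulVec, Matrix.vecMul, dotProduct, Fin.sum_univ_three, Matrix.add_apply,
      Pi.add_apply, Pi.sub_apply, Pi.smul_apply, smul_eq_mul, Matrix.of_apply, Matrix.cons_val,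
      Fin.zero_eta, Fin.mk_one, Fin.reduceFinMk] <;> ring

section PlaneU

variable {x X v w Y Z : W6} (hx : x ∈ planeU)
include hx

lemma quadPart_wedge3_mulVec_add_left : (quadPart (wedge3 x Y w)).mulVec (hiCross v w) +
    (quadPart (wedge3 x v w)).mulVec (hiCross Y w) = 0 := by
  have h : hi Y ⬝ᵥ hiCross v w = -(hi v ⬝ᵥ hiCross Y w) := by
    rw [hiCross, hiCross, triple_product_permutation (hi Y), ← cross_anticomm, dotProduct_neg]
  simp only [quadPart_wedge3 hx, Matrix.sub_mulVec, Matrix.vecMulVec_mulVec, h, op_smul_eq_smul]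
  simp only [hiCross, dot_cross_self]
  module

lemma quadPart_wedge3_mulVec_add_right : (quadPart (wedge3 x v Z)).mulVec (hiCross v w) +
    (quadPart (wedge3 x v w)).mulVec (hiCross v Z) = 0 := by
  have h := quadPart_wedge3_mulVec_add_left (v := w) (w := v) (Y := Z) hx
  have hcross (p : W6) : hiCross p v = -hiCross v p := (cross_anticomm _ _).symm
  rwa [wedge3_swap_right x v Z, wedge3_swap_right x v w, hcross, hcross, map_neg, map_neg,
    Matrix.neg_mulVec_neg, Matrix.neg_mulVec_neg] at h

lemma vecMul_quadPart_wedge3_add (hX : X ∈ planeU) :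
    Matrix.vecMul (lo X) (quadPart (wedge3 x v w)) +
      Matrix.vecMul (lo x) (quadPart (wedge3 X v w)) = 0 := by
  have h (p : W6) : lo x ⬝ᵥ crossProduct (lo X) (lo p) =
      -(lo X ⬝ᵥ crossProduct (lo x) (lo p)) := by
    rw [triple_product_permutation, ← cross_anticomm, dotProduct_neg,
      triple_product_permutation (lo X), ← cross_anticomm, dotProduct_neg]
  simp only [quadPart_wedge3 hx, quadPart_wedge3 hX, Matrix.vecMul_sub, Matrix.vecMul_vecMulVec, h]
  module

lemma linPart_wedge3Deriv (hX : X ∈ planeU) : linPart (wedge3Deriv x v w X Y Z) =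
    Matrix.vecMulVec (lo X) (hiCross v w) +
      Matrix.vecMulVec (lo x) (hiCross Y w + hiCross v Z) := by
  rw [wedge3Deriv, map_add, map_add, linPart_wedge3 hx, linPart_wedge3 hx, linPart_wedge3 hX,
    Matrix.vecMulVec_add, add_assoc]

lemma vRamHess_mulVec_eq_zero_of_wedge3Deriv_mem_lagA (hX : X ∈ planeU)
    (h : wedge3 x v w ∈ lagA) (hD : wedge3Deriv x v w X Y Z ∈ lagA) :
    (vRamHess (lo x) (hiCross v w)).mulVec
      (Sum.elim (lo X) (hiCross Y w + hiCross v Z)) = 0 := by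
  rw [vRamHess_mulVec_eq_polarity, ← linPart_wedge3Deriv hx hX, ← linPart_wedge3 hx,
    ← (mem_lagA_iff.1 h).2.2, ← (mem_lagA_iff.1 hD).2.2, ← Sum.elim_zero_zero]
  simp only [wedge3Deriv, map_add, Matrix.add_mulVec, Matrix.mulVec_add, Matrix.vecMul_add,
    quadPart_wedge3_mulVec hX, vecMul_quadPart_wedge3 hx, zero_add, add_zero]
  congr 1
  · rw [add_add_add_comm, quadPart_wedge3_mulVec_add_left hx, quadPart_wedge3_mulVec_add_right hx,
      add_zero]
  · exact vecMul_quadPart_wedge3_add hx hX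

end PlaneU

lemma plBasis_zero_mul {ω : ExteriorAlgebra ℂ W6} (hω : ω ∈ ⋀[ℂ]^3 W6) :
    plBasis 0 * ω = plCoord 19 ω • volW := by
  rw [← one_smul ℂ (plBasis 0), ← lagMk_zero, mul_eq_sum_parts (lagMk_mem_exteriorPower _ _) hω,
    plCoord_zero_lagMk, plCoord_nineteen_lagMk, linPart_lagMk, quadPart_lagMk, map_zero]
  simp

lemma wedge3_add_wedge3_mul_wedge3_eq_zero (x v w Y Z z : W6) :
    (wedge3 x Y w + wedge3 x v Z) * wedge3 z v w = 0 := by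
  rw [add_mul, wedge3_mul_wedge3, wedge3_mul_wedge3,
    AlternatingMap.map_eq_zero_of_eq _ _ (i := 2) (j := 5) rfl (by decide),
    AlternatingMap.map_eq_zero_of_eq _ _ (i := 1) (j := 4) rfl (by decide), add_zero]

lemma eq_zero_of_wedge3_add_wedge3_eq_smul {x v w Y Z : W6} {e : ℂ} (hy : hiCross v w ≠ 0)
    (h : wedge3 x Y w + wedge3 x v Z = e • plBasis 0) : e = 0 := by
  obtain ⟨u, hu⟩ := exists_dotProduct_eq_one hy
  have h0 := wedge3_add_wedge3_mul_wedge3_eq_zero x v w Y Z (Fin.append 0 u)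
  rw [h, smul_mul_assoc, plBasis_zero_mul (wedge3_mem _ _ _), plCoord_nineteen_wedge3, hi_append,
    hu, one_smul] at h0
  exact (smul_eq_zero.1 h0).resolve_right volW_ne_zero

lemma exists_wedge3Deriv_eq_smul_of_mem_planeU {x v w X Y Z : W6} (hx : x ∈ planeU)
    (hX : X ∈ planeU) (h1 : lo x ≠ 0) (h2 : hiCross v w ≠ 0) (h : wedge3 x v w ∈ lagA)
    (hD : wedge3Deriv x v w X Y Z ∈ lagA) :
    ∃ c : ℂ, wedge3Deriv x v w X Y Z = c • wedge3 x v w := by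
  obtain ⟨hgradX, hgradY⟩ := vRamGrad_eq_zero_of_wedge3_mem_lagA hx h
  obtain ⟨⟨c, hc⟩, d, hd⟩ := eq_smul_of_vRamHess_mulVec h1 h2 hgradX hgradY
    (vRamHess_mulVec_eq_zero_of_wedge3Deriv_mem_lagA hx hX h hD)
  obtain rfl : X = c • x := eq_of_lo_eq_of_hi_eq (by rw [hc, map_smul])
    (by rw [map_smul, mem_planeU_iff_hi_eq_zero.1 hx, mem_planeU_iff_hi_eq_zero.1 hX, smul_zero])
  have hmem : wedge3Deriv x v w (c • x) Y Z - (c + d) • wedge3 x v w ∈ lagA :=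
    sub_mem hD (lagA.smul_mem _ h)
  have h0 := eq_smul_plBasis_zero hmem (by
    rw [map_sub, map_smul, linPart_wedge3Deriv hx hX, linPart_wedge3 hx, hc, hd,
      Matrix.smul_vecMulVec, Matrix.vecMulVec_smul, add_smul, sub_self])
  have hsplit : wedge3Deriv x v w (c • x) Y Z - (c + d) • wedge3 x v w =
      wedge3 x Y w + wedge3 x v (Z - d • w) := by
    simp only [wedge3Deriv, wedge3, map_smul, map_sub, mul_sub, smul_mul_assoc, mul_smul_comm]
    module
  rw [eq_zero_of_wedge3_add_wedge3_eq_smul h2 (hsplit.symm.trans h0), zero_smul, sub_eq_zero] at h0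
  exact ⟨_, h0⟩

lemma exists_wedge3Deriv_eq_smul {x v w X Y Z : W6} (hx : x ∈ planeU) (h1 : lo x ≠ 0)
    (h2 : hiCross v w ≠ 0) (h : wedge3 x v w ∈ lagA) (hD : wedge3Deriv x v w X Y Z ∈ lagA) :
    ∃ c : ℂ, wedge3Deriv x v w X Y Z = c • wedge3 x v w := by
  obtain ⟨a, b, hab⟩ : ∃ a b : ℂ, hi X = a • hi v + b • hi w := by
    refine exists_eq_smul_add_smul_of_dotProduct_cross_eq_zero h2 ?_
    have h19 := (mem_lagA_iff.1 hD).2.1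
    rwa [wedge3Deriv, map_add, map_add, plCoord_nineteen_wedge3, plCoord_nineteen_wedge3,
      plCoord_nineteen_wedge3, mem_planeU_iff_hi_eq_zero.1 hx, zero_dotProduct, zero_dotProduct,
      add_zero, add_zero] at h19
  have hX : X - a • v - b • w ∈ planeU := mem_planeU_iff_hi_eq_zero.2 (by
    rw [map_sub, map_sub, map_smul, map_smul, hab, add_sub_cancel_left, sub_self])
  rw [← wedge3Deriv_sub_smul_sub_smul x v w X Y Z a b] at hD ⊢
  exact exists_wedge3Deriv_eq_smul_of_mem_planeU hx hX h1 h2 h hD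

lemma exists_wedge3Deriv_planeU_eq_smul {X Y Z : W6}
    (hD : wedge3Deriv (stdE 0) (stdE 1) (stdE 2) X Y Z ∈ lagA) :
    ∃ c : ℂ, wedge3Deriv (stdE 0) (stdE 1) (stdE 2) X Y Z = c • plBasis 0 := by
  obtain ⟨h0, h1, h2⟩ := stdE_mem_planeU
  have hfilt {p q r : W6} (hp : p ∈ planeU) (hq : q ∈ planeU) : linPart (wedge3 p q r) = 0 :=
    filt2_le_ker_linPart (Submodule.subset_span ⟨p, hp, q, hq, r, rfl⟩)
  refine ⟨_, eq_smul_plBasis_zero hD ?_⟩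
  rw [wedge3Deriv, wedge3_swap_left (stdE 1) X, wedge3_swap_right (stdE 1) (stdE 2) X,
    wedge3_swap_right (stdE 0) (stdE 2) Y]
  simp only [map_add, map_neg, hfilt, h0, h1, h2, neg_zero, add_zero]

lemma map_mem_of_wedge3Deriv_mem_lagA {P : Submodule ℂ W6} (hP : P ∈ planesIn lagA)
    {τ : P →ₗ[ℂ] W6} (h : ∀ p q r : P, wedge3Deriv p q r (τ p) (τ q) (τ r) ∈ lagA) (z : P) :
    τ z ∈ P := by
  rcases eq_or_ne P planeU with hU | hU
  · rw [planeU_eq_span3] at hU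
    subst hU
    obtain ⟨c, hc⟩ := exists_wedge3Deriv_planeU_eq_smul (h ⟨_, left_mem_span3 _ _ _⟩
      ⟨_, middle_mem_span3 _ _ _⟩ ⟨_, right_mem_span3 _ _ _⟩)
    exact map_mem_span3_of_wedge3Deriv_eq_smul (plBasis_ne_zero 0) hc z
  · obtain ⟨x, hx, v, w, h1, h2, hA, rfl⟩ := exists_wedge3_of_mem_planesIn_lagA hP hU
    obtain ⟨c, hc⟩ := exists_wedge3Deriv_eq_smul hx h1 h2 hA (h ⟨_, left_mem_span3 _ _ _⟩
      ⟨_, middle_mem_span3 _ _ _⟩ ⟨_, right_mem_span3 _ _ _⟩)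
    exact map_mem_span3_of_wedge3Deriv_eq_smul
      (wedge3_ne_zero_of_linPart_ne_zero (linPart_wedge3_ne_zero hx h1 h2)) hc z

lemma mem_lagA_of_forall_mul_wedge3_eq_zero {ω : ExteriorAlgebra ℂ W6} (hω : ω ∈ ⋀[ℂ]^3 W6)
    (h : ∀ Q ∈ planesIn lagA, ∀ p ∈ Q, ∀ q ∈ Q, ∀ r ∈ Q, ω * wedge3 p q r = 0) : ω ∈ lagA := by
  refine mem_lagA_of_mul_eq_zero hω fun a ha => ?_
  have hle : lagA ≤ LinearMap.ker (LinearMap.mulLeft ℂ ω) := by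
    rw [lagA_eq_span, Submodule.span_le]
    rintro _ ⟨Q, hQ, p, hp, q, hq, r, hr, rfl⟩
    exact h Q hQ p hp q hq r hr
  exact hle ha

lemma isFiniteMorinConfiguration_planesIn_lagA :
    IsFiniteMorinConfiguration (planesIn lagA) := by
  refine ⟨Set.finite_of_ncard_ne_zero (by rw [ncard_planesIn_lagA]; decide), fun P =>
    ⟨fun hP => ⟨hP.1, fun Q => inf_ne_bot_of_mem_planesIn isLagrangian_lagA hP⟩, ?_⟩,
    fun P hP τ hτ => map_mem_of_wedge3Deriv_mem_lagA hP fun p q r =>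
      mem_lagA_of_forall_mul_wedge3_eq_zero wedge3Deriv_mem fun Q hQ => hτ Q hQ p q r⟩
  rintro ⟨hP, hmeet⟩
  obtain ⟨p, q, r, h0, rfl⟩ := exists_eq_span3 hP
  rw [span3_mem_planesIn_iff h0]
  refine mem_lagA_of_forall_mul_wedge3_eq_zero (wedge3_mem _ _ _) fun Q hQ p' hp q' hq r' hr => ?_
  obtain ⟨_, _, _, h0', rfl⟩ := exists_eq_span3 hQ.1
  obtain ⟨c, hc⟩ := exists_wedge3_eq_smul hp hq hr
  rw [hc, mul_smul_comm, (wedge3_mul_wedge3_eq_zero_iff h0 h0').2 (hmeet _ hQ), smul_zero]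

lemma sum_vecMulVec_mul {R m n : Type*} [CommSemiring R] [Fintype m] [Fintype n] (x : m → R)
    (y : n → R) (N : Matrix m n R) :
    ∑ i, ∑ j, Matrix.vecMulVec x y i j * N i j = x ⬝ᵥ N.mulVec y := by
  simp only [Matrix.vecMulVec_apply, dotProduct, Matrix.mulVec, Finset.mul_sum, mul_assoc,
    mul_comm (y _)]

lemma dotProduct_vRamGradX_self (x y : Fin 3 → ℂ) :
    x ⬝ᵥ vRamGradX x y = 2 * eval (Sum.elim x y) vRam := by
  rw [vRamGradX, dotProduct_sub, dotProduct_smul, dotProduct_smul, dotProduct_comm x,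
    dotProduct_comm x, gradConicA_dotProduct_self, gradConicB_dotProduct_self, eval_vRam]
  simp only [conicA, conicB, smul_eq_mul]
  ring

lemma isThreefoldOf_lagA : IsThreefoldOf lagA vRam := by
  refine ⟨2, two_ne_zero, fun x hx v w a ha hsub => ?_⟩
  obtain ⟨ha3, ha19, haquad⟩ := mem_lagA_iff.1 ha
  have hlin : linPart a = linPart (wedge3 x v w) := by
    rw [← sub_eq_zero, ← map_sub]
    exact filt2_le_ker_linPart hsub
  have hfirst : ∑ i, ∑ j, linPart (wedge3 x v w) i j * quadPart a i j =
      2 * eval (Sum.elim (lo x) (hiCross v w)) vRam := by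
    rw [haquad, hlin, linPart_wedge3 hx, sum_vecMulVec_mul, ← vRamGradX_eq_polarity_mulVec,
      dotProduct_vRamGradX_self]
  have hsecond : ∑ i, ∑ j, quadPart (wedge3 x v w) i j * linPart a i j = 0 := by
    simp only [hlin, linPart_wedge3 hx, mul_comm (quadPart _ _ _)]
    rw [sum_vecMulVec_mul, quadPart_wedge3_mulVec hx, dotProduct_zero]
  rw [mul_eq_sum_parts (wedge3_mem _ _ _) ha3, hfirst, hsecond, ha19, plCoord_nineteen_wedge3,
    mem_planeU_iff_hi_eq_zero.1 hx, zero_dotProduct, ← lo_apply, ← hi_apply, ← hi_apply, hiCross]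
  simp

lemma isAttachedTo20Planes_vRam : IsAttachedTo20Planes vRam :=
  ⟨lagA, planesIn lagA, isLagrangian_lagA, lagA_le_filt1, lagA_inf_filt2, rfl, planeU_mem_planesIn,
    ncard_planesIn_lagA, isFiniteMorinConfiguration_planesIn_lagA, lagA_eq_span, isThreefoldOf_lagA⟩

end

theorem mainTheorem7 :
    -- `V^ram` is a threefold of bidegree `(2, 2)` with exactly 19 singular points, all nodes,
    -- attached to a Morin configuration of 20 planes
    vRam ∈ biForms 2 2 ∧ (biSing vRam).ncard = 19 ∧ (∀ p ∈ biSing vRam, IsBiNode vRam p) ∧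
    IsAttachedTo20Planes vRam ∧
    -- `|𝓘(1,1)|` has dimension 4; `φ`, in any homogeneous coordinates of `ℙ⁴`, has degree 2,
    -- ramification divisor `V^ram`, and maps `V^ram` onto the Igusa quartic
    Module.finrank ℂ formsThroughO4 = 5 ∧
    ∀ b : Module.Basis (Fin 5) ℂ formsThroughO4,
      HasDegreeTwo (fun k => (b k : BiPoly)) ∧
      IsRamificationDivisor (fun k => (b k : BiPoly)) vRam ∧
      IsIgusaQuartic (imageOfHypersurface (fun k => (b k : BiPoly)) vRam) := by
  refine ⟨vRam_mem_biForms, ncard_biSing_vRam, fun _ hp => isBiNode_vRam hp,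
    isAttachedTo20Planes_vRam, finrank_formsThroughO4, fun b => ?_⟩
  obtain ⟨M, hM, hb⟩ := exists_eq_stdSystem b
  rw [hb]
  exact ⟨hasDegreeTwo_stdSystem hM, isRamificationDivisor_stdSystem_vRam hM,
    isIgusaQuartic_imageOfHypersurface hM⟩
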